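/- Let $1\le d\le n-1$. On $\mathbb R^{n+1}$ let $[x,y]=-x_1y_1-\dots-x_ny_n+x_{n+1}y_{n+1}$, let $\mathbb H^n=\{x:[x,x]=1,\ x_{n+1}>0\}$, $x_0=(0,\dots,0,1)$, $G=SO_0(n,1)$, and let $dx=\sinh^{n-1}\!r\,dr\,d\theta$ be the $G$-invariant measure in the coordinates $x=\theta\sinh r+e_{n+1}\cosh r$, $\theta\in S^{n-1}$, $r>0$. Let $K=SO(n)\subset G$ be the rotations of the first $n$ coordinates, with normalized Haar measure $dk$; let $a_t\in G$ be the hyperbolic rotation in the plane $(x_n,x_{n+1})$ with block $\begin{pmatrix}\cosh t&\sinh t\\ \sinh t&\cosh t\end{pmatrix}$, and for $v\in\mathbb R^{n-1}$ let $$n_v=\begin{pmatrix}I_{n-1}&-v&v\\ v^T&1-|v|^2/2&|v|^2/2\\ v^T&-|v|^2/2&1+|v|^2/2\end{pmatrix}\in G .$$ Identify $\mathbb R^d$ with $\mathbb Re_{n-d}\oplus\dots\oplus\mathbb Re_{n-1}\subset\mathbb R^{n-1}$. The basic $d$-horosphere is $\xi_0=\{x\in\mathbb H^n: x_1=\dots=x_{n-d-1}=0,\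 x_{n+1}-x_n=1\}$, the $d$-horospheres are the sets $g\xi_0$, $g\in G$, and the $d$-horospherical transform of $f:\mathbb H^n\to\mathbb C$ is $$\hat f(g\xi_0)=\int_{\mathbb R^d}f(gn_wx_0)\,dw .$$ For each $x\in\mathbb H^n$ let $r_x\in G$ be any element with $r_xx_0=x$, and for $r=\cosh t>1$, $t>0$, put $$\psi_x(r)=c^{-1}e^{td/2}\int_K\hat f(r_xka_t\xi_0)\,dk,\qquad c=2^{d/2-1}\sigma_{d-1}\Gamma(d/2),\quad \sigma_{d-1}=\frac{2\pi^{d/2}}{\Gamma(d/2)} .$$ With $(I^{1/2}_-\psi)(s)=\Gamma(1/2)^{-1}\int_s^\infty(v-s)^{-1/2}\psi(v)\,dv$, define $$\mathcal D^{d/2}_-\psi=(-1)^m\psi^{(m)}\ \text{ if } d=2m,\qquad \mathcal D^{d/2}_-\psi=(-1)^ms^{1/2}\Big(\frac d{ds}\Big)^m\big[s^{m-1/2}I^{1/2}_-s^{-m}\psi\big]\ \text{ if } d=2m-1 .$$ (i) Let $f$ be continuous with $f(x)=O(x_{n+1}^{-\mu})$ for some $\mu>d/2$. Then the integrals defining $\hat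 f(\xi)$ and $\int_K\hat f(r_xka_t\xi_0)\,dk$ converge absolutely for all $\xi$, $x$ and $t$, $(\mathcal D^{d/2}_-\psi_x)(s)$ exists for all $x\in\mathbb H^n$ and $s>1$, and $$f(x)=\lim_{s\to1^+}(\mathcal D^{d/2}_-\psi_x)(s)$$ uniformly in $x\in\mathbb H^n$. (ii) Let $f\in L^p(\mathbb H^n)$, $1\le p<2(n-1)/d$. Then for every $x$ and almost every $t\in\mathbb R$ the integral $\hat f(r_xka_t\xi_0)$ converges absolutely for almost all $k$ and is integrable over $K$ in $k$; for every $x$ the derivative $(\mathcal D^{d/2}_-\psi_x)(s)$ exists for almost every $s>1$; for almost every $s>1$ it exists for almost every $x$ and is in $L^p(\mathbb H^n)$ as a function of $x$; and $$\|(\mathcal D^{d/2}_-\psi_{(\cdot)})(s)-f\|_{L^p(\mathbb H^n)}\to0\quad\text{as } s\to1^+,$$ the limit being an essential one (over $s$ outside a set of measure zero). In both cases, if $d=2m-1$, then $(\mathcal D^{d/2}_-\psi_x)(s)=(-1)^ms^{1/2}\frac d{ds}\big[s^{1/2}I^{1/2}_-s^{-1}\psi_x^{(m-1)}\big]$, for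 all $x$ and all $s>1$ in case (i), and for all $x$ and almost every $s>1$ in case (ii). -/

import Mathlib

open MeasureTheory Filter Topology Set
open scoped Matrix Pointwise ENNReal

noncomputable section

namespace Horospherical

/-! ### The pseudo-Euclidean space, the hyperboloid and the group `SO₀(n,1)` -/

/-- The form `[x, y] = -x₁y₁ - … - xₙyₙ + xₙ₊₁yₙ₊₁` on `ℝⁿ⁺¹`.
The coordinates `x₁, …, xₙ₊₁` are indexed by `0, …, n`. -/
def form {n : ℕ} (x y : Fin (n + 1) → ℝ) : ℝ :=
  -∑ i : Fin n, x i.castSucc * y i.castSucc + x (Fin.last n) * y (Fin.last n)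

/-- The upper sheet of the two-sheeted hyperboloid. -/
def hyperboloid (n : ℕ) : Set (Fin (n + 1) → ℝ) :=
  {x | form x x = 1 ∧ 0 < x (Fin.last n)}

/-- The real hyperbolic space `ℍⁿ`, with the topology and Borel structure induced by `ℝⁿ⁺¹`. -/
abbrev HypSpace (n : ℕ) : Type := hyperboloid n

/-- The coordinate `xₙ₊₁` of a point of `ℍⁿ`. -/
def height {n : ℕ} (x : HypSpace n) : ℝ := x.1 (Fin.last n)

/-- The origin `x₀ = (0, …, 0, 1)` of `ℍⁿ`. -/
def origin (n : ℕ) : HypSpace n :=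
  ⟨Pi.single (Fin.last n) 1, by
    constructor
    · simp [form, Fin.castSucc_ne_last]
    · simp⟩

/-- The Gram matrix `diag(-1, …, -1, 1)` of the form. -/
def gram (n : ℕ) : Matrix (Fin (n + 1)) (Fin (n + 1)) ℝ :=
  Matrix.diagonal fun i => if i = Fin.last n then 1 else -1

theorem form_eq {n : ℕ} (x y : Fin (n + 1) → ℝ) : form x y = x ⬝ᵥ (gram n *ᵥ y) := by
  simp [form, gram, dotProduct, Matrix.mulVec_diagonal, Fin.sum_univ_castSucc,
    Fin.castSucc_ne_last]

theorem gram_mul_gram (n : ℕ) : gram n * gram n = 1 := by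
  rw [gram, Matrix.diagonal_mul_diagonal, ← Matrix.diagonal_one]
  congr 1
  ext i
  split_ifs <;> simp

theorem gram_transpose (n : ℕ) : (gram n)ᵀ = gram n := Matrix.diagonal_transpose _

theorem form_add_left {n : ℕ} (x y z : Fin (n + 1) → ℝ) :
    form (x + y) z = form x z + form y z := by
  simp [form_eq, add_dotProduct]

theorem form_smul_left {n : ℕ} (a : ℝ) (x z : Fin (n + 1) → ℝ) :
    form (a • x) z = a * form x z := by
  simp [form_eq]

theorem form_comm {n : ℕ} (x y : Fin (n + 1) → ℝ) : form x y = form y x := by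
  simp [form, mul_comm]

theorem form_add_right {n : ℕ} (x y z : Fin (n + 1) → ℝ) :
    form z (x + y) = form z x + form z y := by
  simp [form_comm z, form_add_left]

theorem form_smul_right {n : ℕ} (a : ℝ) (x z : Fin (n + 1) → ℝ) :
    form z (a • x) = a * form z x := by
  simp [form_comm z, form_smul_left]

theorem form_mulVec_of_gram {n : ℕ} {A : Matrix (Fin (n + 1)) (Fin (n + 1)) ℝ}
    (hA : Aᵀ * gram n * A = gram n) (x y : Fin (n + 1) → ℝ) :
    form (A *ᵥ x) (A *ᵥ y) = form x y := by
  rw [form_eq, form_eq, Matrix.mulVec_mulVec, ← Matrix.vecMul_transpose,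
    ← Matrix.dotProduct_mulVec, Matrix.mulVec_mulVec, ← Matrix.mul_assoc, hA]

theorem gram_of_form_mulVec {n : ℕ} {A : Matrix (Fin (n + 1)) (Fin (n + 1)) ℝ}
    (hA : ∀ x y, form (A *ᵥ x) (A *ᵥ y) = form x y) : Aᵀ * gram n * A = gram n := by
  ext i j
  have h := hA (Pi.single i 1) (Pi.single j 1)
  rw [form_eq, form_eq, Matrix.mulVec_mulVec, ← Matrix.vecMul_transpose,
    ← Matrix.dotProduct_mulVec, Matrix.mulVec_mulVec, ← Matrix.mul_assoc] at h
  simpa using h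

/-- Two points of the upper sheet have positive product. -/
theorem form_pos {n : ℕ} {x y : Fin (n + 1) → ℝ} (hx : x ∈ hyperboloid n)
    (hy : y ∈ hyperboloid n) : 0 < form x y := by
  obtain ⟨hx1, hx0⟩ := hx
  obtain ⟨hy1, hy0⟩ := hy
  have cs := Finset.sum_mul_sq_le_sq_mul_sq Finset.univ (fun i : Fin n => x i.castSucc)
    (fun i => y i.castSucc)
  simp only [form, ← pow_two] at hx1 hy1
  simp only [form]
  set S := ∑ i : Fin n, x i.castSucc * y i.castSucc
  set P := ∑ i : Fin n, x i.castSucc ^ 2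
  set Q := ∑ i : Fin n, y i.castSucc ^ 2
  have hP : P = x (Fin.last n) ^ 2 - 1 := by linarith
  have hQ : Q = y (Fin.last n) ^ 2 - 1 := by linarith
  have hQ0 : 0 ≤ Q := Finset.sum_nonneg fun i _ => sq_nonneg _
  have hlt : S ^ 2 < (x (Fin.last n) * y (Fin.last n)) ^ 2 := by
    rw [hP, hQ] at cs
    rw [hQ] at hQ0
    have : 0 < x (Fin.last n) ^ 2 := by positivity
    nlinarith
  have := lt_of_pow_lt_pow_left₀ 2 (by positivity) hlt
  linarith

theorem mulVec_single_last {n : ℕ} (A : Matrix (Fin (n + 1)) (Fin (n + 1)) ℝ) :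
    (A *ᵥ (origin n).1) (Fin.last n) = A (Fin.last n) (Fin.last n) := by
  simp [origin]

theorem mulVec_mem_hyperboloid {n : ℕ} {A : Matrix (Fin (n + 1)) (Fin (n + 1)) ℝ}
    (hA : Aᵀ * gram n * A = gram n) (hpos : 0 < A (Fin.last n) (Fin.last n))
    {x : Fin (n + 1) → ℝ} (hx : x ∈ hyperboloid n) : A *ᵥ x ∈ hyperboloid n := by
  have h1 : form (A *ᵥ x) (A *ᵥ x) = 1 := by rw [form_mulVec_of_gram hA]; exact hx.1
  refine ⟨h1, ?_⟩
  have hz : A *ᵥ (origin n).1 ∈ hyperboloid n :=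
    ⟨by rw [form_mulVec_of_gram hA]; exact (origin n).2.1, by rwa [mulVec_single_last]⟩
  have hp : 0 < form (A *ᵥ x) (A *ᵥ (origin n).1) := by
    rw [form_mulVec_of_gram hA]; exact form_pos hx (origin n).2
  rcases lt_trichotomy ((A *ᵥ x) (Fin.last n)) 0 with h | h | h
  · have hneg : (-1 : ℝ) • (A *ᵥ x) ∈ hyperboloid n := by
      constructor
      · rw [form_smul_left, form_smul_right, h1]; norm_num
      · simpa using h
    have := form_pos hneg hz
    rw [form_smul_left] at this
    linarith
  · have : 0 ≤ ∑ i : Fin n, (A *ᵥ x) i.castSucc * (A *ᵥ x) i.castSucc :=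
      Finset.sum_nonneg fun i _ => mul_self_nonneg _
    simp only [form, h] at h1
    linarith
  · exact h

/-- The group `SO₀(n,1)`, the identity component of `SO(n,1)`: the matrices of determinant `1`
that preserve the form and have a positive lower right entry (that is, preserve the upper
sheet). -/
def SO0 (n : ℕ) : Submonoid (Matrix (Fin (n + 1)) (Fin (n + 1)) ℝ) where
  carrier := {A | Aᵀ * gram n * A = gram n ∧ A.det = 1 ∧ 0 < A (Fin.last n) (Fin.last n)}
  one_mem' := by simp
  mul_mem' := by
    rintro A B ⟨hA, hA1, hA0⟩ ⟨hB, hB1, hB0⟩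
    refine ⟨?_, by rw [Matrix.det_mul, hA1, hB1, one_mul], ?_⟩
    · rw [Matrix.transpose_mul]
      calc Bᵀ * Aᵀ * gram n * (A * B) = Bᵀ * (Aᵀ * gram n * A) * B := by
            simp only [Matrix.mul_assoc]
        _ = gram n := by rw [hA, hB]
    · have := (mulVec_mem_hyperboloid hA hA0 (mulVec_mem_hyperboloid hB hB0 (origin n).2)).2
      rwa [Matrix.mulVec_mulVec, mulVec_single_last] at this

instance instGroupSO0 (n : ℕ) : Group (SO0 n) where
  inv A := ⟨gram n * A.1ᵀ * gram n, by
    obtain ⟨A, hA, hA1, hA0⟩ := A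
    have h1 : (gram n * Aᵀ * gram n) * A = 1 := by
      calc (gram n * Aᵀ * gram n) * A = gram n * (Aᵀ * gram n * A) := by
            simp only [Matrix.mul_assoc]
        _ = 1 := by rw [hA, gram_mul_gram]
    have h2 : A * (gram n * Aᵀ * gram n) = 1 := mul_eq_one_comm.mp h1
    refine ⟨?_, ?_, ?_⟩
    · simp only [Matrix.transpose_mul, gram_transpose, Matrix.transpose_transpose]
      calc gram n * (A * gram n) * gram n * (gram n * Aᵀ * gram n)
          = gram n * (A * (gram n * (gram n * gram n) * Aᵀ * gram n)) := by
            simp only [Matrix.mul_assoc]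
        _ = gram n := by rw [gram_mul_gram, Matrix.mul_one, h2, Matrix.mul_one]
    · have h3 := congrArg Matrix.det h1
      rwa [Matrix.det_mul, hA1, mul_one, Matrix.det_one] at h3
    · simpa [gram, Matrix.mul_diagonal, Matrix.diagonal_mul] using hA0⟩
  inv_mul_cancel A := by
    refine Subtype.ext ?_
    change gram n * A.1ᵀ * gram n * A.1 = 1
    calc gram n * A.1ᵀ * gram n * A.1 = gram n * (A.1ᵀ * gram n * A.1) := by
          simp only [Matrix.mul_assoc]
      _ = 1 := by rw [A.2.1, gram_mul_gram]

/-- The action of `SO₀(n,1)` on `ℍⁿ` by matrix multiplication. -/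
instance instMulActionSO0 (n : ℕ) : MulAction (SO0 n) (HypSpace n) where
  smul A x := ⟨A.1 *ᵥ x.1, mulVec_mem_hyperboloid A.2.1 A.2.2.2 x.2⟩
  one_smul x := Subtype.ext (Matrix.one_mulVec x.1)
  mul_smul A B x := Subtype.ext (Matrix.mulVec_mulVec x.1 A.1 B.1).symm

/-! ### The subgroups `K`, `A`, `N` -/

/-- The group `SO(n)`. -/
abbrev Rot (n : ℕ) : Type := Matrix.specialOrthogonalGroup (Fin n) ℝ

instance instMeasurableSpaceRot (n : ℕ) : MeasurableSpace (Rot n) := borel _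

instance instBorelSpaceRot (n : ℕ) : BorelSpace (Rot n) := ⟨rfl⟩

theorem rot_transpose_mul {n : ℕ} (k : Rot n) : k.1ᵀ * k.1 = 1 :=
  (Matrix.mem_orthogonalGroup_iff' (Fin n) ℝ).mp k.2.1

instance instIsTopologicalGroupRot (n : ℕ) : IsTopologicalGroup (Rot n) where
  continuous_mul := Continuous.subtype_mk
    ((continuous_subtype_val.comp continuous_fst).mul
      (continuous_subtype_val.comp continuous_snd)) _
  continuous_inv := Continuous.subtype_mk
    (continuous_subtype_val.matrix_transpose.congr fun k => by
      ext i j; rfl) _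

instance instCompactSpaceRot (n : ℕ) : CompactSpace (Rot n) := by
  have hset : ((Matrix.specialOrthogonalGroup (Fin n) ℝ : Submonoid _) :
      Set (Matrix (Fin n) (Fin n) ℝ)) = {A | A * Aᵀ = 1} ∩ {A | A.det = 1} := by
    ext A
    exact Matrix.mem_specialOrthogonalGroup_iff.trans
      (and_congr_left' (Matrix.mem_orthogonalGroup_iff (Fin n) ℝ))
  have hclosed : IsClosed ({A : Matrix (Fin n) (Fin n) ℝ | A * Aᵀ = 1} ∩ {A | A.det = 1}) :=
    (isClosed_eq (by fun_prop) continuous_const).inter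
      (isClosed_eq (by fun_prop) continuous_const)
  have hsub : {A : Matrix (Fin n) (Fin n) ℝ | A * Aᵀ = 1} ∩ {A | A.det = 1} ⊆
      Set.pi Set.univ fun _ => Set.pi Set.univ fun _ => Set.Icc (-1 : ℝ) 1 := by
    rintro A ⟨hA, -⟩ i - j -
    have h1 := congrFun (congrFun hA i) i
    simp only [Matrix.mul_apply, Matrix.transpose_apply, Matrix.one_apply_eq] at h1
    have h2 : A i j * A i j ≤ 1 := h1 ▸ Finset.single_le_sum
      (f := fun j => A i j * A i j) (fun j _ => mul_self_nonneg _) (Finset.mem_univ j)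
    exact ⟨by nlinarith, by nlinarith⟩
  have hcomp : IsCompact ({A : Matrix (Fin n) (Fin n) ℝ | A * Aᵀ = 1} ∩ {A | A.det = 1}) :=
    (isCompact_univ_pi fun _ => isCompact_univ_pi fun _ => isCompact_Icc).of_isClosed_subset
      hclosed hsub
  exact isCompact_iff_compactSpace.mp (hset ▸ hcomp)

/-- The normalized Haar measure `dk` on `SO(n)`. -/
def rotHaar (n : ℕ) : Measure (Rot n) := Measure.haarMeasure ⊤

/-- `k ∈ SO(n)` as the block matrix `diag(k, 1)`. -/
def rot {n : ℕ} (k : Rot n) : SO0 n :=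
  ⟨Matrix.reindex finSumFinEquiv finSumFinEquiv
    (Matrix.fromBlocks k.1 0 0 (1 : Matrix (Fin 1) (Fin 1) ℝ)), by
    have hlast : (finSumFinEquiv (m := n) (n := 1)).symm (Fin.last n) = Sum.inr 0 := by
      rw [Equiv.symm_apply_eq]; rfl
    refine ⟨?_, ?_, ?_⟩
    · have hg : gram n = Matrix.reindex finSumFinEquiv finSumFinEquiv
          (Matrix.fromBlocks (-1 : Matrix (Fin n) (Fin n) ℝ) 0 0
            (1 : Matrix (Fin 1) (Fin 1) ℝ)) := by
        ext i j
        obtain ⟨i, rfl⟩ := (finSumFinEquiv (m := n) (n := 1)).surjective i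
        obtain ⟨j, rfl⟩ := (finSumFinEquiv (m := n) (n := 1)).surjective j
        rcases i with i | i <;> rcases j with j | j <;>
          simp [gram, Matrix.diagonal_apply, Matrix.one_apply, Fin.ext_iff]
        · have := i.2
          split_ifs <;> first | omega | simp
        · have := i.2
          omega
        · have := j.2
          omega
      rw [hg]
      simp only [Matrix.reindex_apply, Matrix.transpose_submatrix,
        Matrix.submatrix_mul_equiv, Matrix.fromBlocks_transpose, Matrix.fromBlocks_multiply]
      simp [rot_transpose_mul]
    · rw [Matrix.det_reindex_self, Matrix.det_fromBlocks_zero₂₁, Matrix.det_one, mul_one]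
      exact k.2.2
    · simp [hlast]⟩

/-- The index of the coordinate `xₙ`. -/
def idx (n : ℕ) : Fin (n + 1) := ⟨n - 1, by omega⟩

theorem idx_ne_last (n : ℕ) [NeZero n] : idx n ≠ Fin.last n := by
  have := NeZero.pos n
  simp only [idx, ne_eq, Fin.ext_iff, Fin.val_last]
  omega

theorem form_single_last {n : ℕ} (x : Fin (n + 1) → ℝ) :
    form (Pi.single (Fin.last n) 1) x = x (Fin.last n) := by
  simp [form_eq, gram, Matrix.mulVec_diagonal]

theorem form_single_idx {n : ℕ} [NeZero n] (x : Fin (n + 1) → ℝ) :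
    form (Pi.single (idx n) 1) x = -x (idx n) := by
  simp [form_eq, gram, Matrix.mulVec_diagonal, idx_ne_last]

theorem det_mul_self_of_gram {n : ℕ} {B : Matrix (Fin (n + 1)) (Fin (n + 1)) ℝ}
    (hB : Bᵀ * gram n * B = gram n) : (B * B).det = 1 := by
  have h := congrArg Matrix.det hB
  have hg := congrArg Matrix.det (gram_mul_gram n)
  rw [Matrix.det_mul, Matrix.det_one] at hg
  rw [Matrix.det_mul, Matrix.det_mul, Matrix.det_transpose] at h
  rw [Matrix.det_mul]
  calc B.det * B.det = (B.det * (gram n).det * B.det) * (gram n).det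
        + B.det * B.det * (1 - (gram n).det * (gram n).det) := by ring
    _ = 1 := by rw [h, hg]; ring

/-- The hyperbolic rotation `a_t` in the coordinate plane `(xₙ, xₙ₊₁)`: the identity matrix with
the block of these two coordinates replaced by `[cosh t, sinh t; sinh t, cosh t]`. -/
def boostMatrix (n : ℕ) (t : ℝ) : Matrix (Fin (n + 1)) (Fin (n + 1)) ℝ :=
  1 + (Real.cosh t - 1) • (Matrix.single (idx n) (idx n) 1
        + Matrix.single (Fin.last n) (Fin.last n) 1)
      + Real.sinh t • (Matrix.single (idx n) (Fin.last n) 1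
        + Matrix.single (Fin.last n) (idx n) 1)

theorem boostMatrix_mulVec {n : ℕ} (t : ℝ) (x : Fin (n + 1) → ℝ) :
    boostMatrix n t *ᵥ x = x
      + ((Real.cosh t - 1) * x (idx n) + Real.sinh t * x (Fin.last n)) • Pi.single (idx n) 1
      + ((Real.cosh t - 1) * x (Fin.last n) + Real.sinh t * x (idx n))
        • Pi.single (Fin.last n) 1 := by
  ext i
  simp only [boostMatrix, Matrix.add_mulVec, Matrix.smul_mulVec, Matrix.one_mulVec,
    Matrix.single_mulVec, Pi.add_apply, Pi.smul_apply, Pi.single_apply, smul_eq_mul, one_mul,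
    Function.update_apply, Pi.zero_apply]
  split_ifs <;> ring

theorem boostMatrix_gram {n : ℕ} [NeZero n] (t : ℝ) :
    (boostMatrix n t)ᵀ * gram n * boostMatrix n t = gram n := by
  refine gram_of_form_mulVec fun x y => ?_
  simp only [boostMatrix_mulVec, form_add_left, form_add_right, form_smul_left, form_smul_right,
    form_single_last, form_single_idx, form_comm x (Pi.single _ _)]
  simp only [Pi.single_eq_same, Pi.single_eq_of_ne (idx_ne_last n),
    Pi.single_eq_of_ne (idx_ne_last n).symm]
  have := Real.cosh_sq t
  have h2 : Real.sinh t ^ 2 = Real.cosh t ^ 2 - 1 := by linarith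
  ring_nf
  simp only [h2]
  ring

theorem boostMatrix_add {n : ℕ} [NeZero n] (s t : ℝ) :
    boostMatrix n (s + t) = boostMatrix n s * boostMatrix n t := by
  refine Matrix.mulVec_injective (funext fun x => ?_)
  rw [← Matrix.mulVec_mulVec]
  ext i
  simp only [boostMatrix_mulVec, Pi.add_apply, Pi.smul_apply, smul_eq_mul, Pi.single_eq_same,
    Pi.single_eq_of_ne (idx_ne_last n), Pi.single_eq_of_ne (idx_ne_last n).symm,
    Real.cosh_add, Real.sinh_add]
  ring

/-- The hyperbolic rotation `a_t` as an element of `SO₀(n,1)`. -/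
def boost {n : ℕ} [NeZero n] (t : ℝ) : SO0 n :=
  ⟨boostMatrix n t, boostMatrix_gram t, by
    have h := boostMatrix_add (n := n) (t / 2) (t / 2)
    rw [add_halves] at h
    rw [h, det_mul_self_of_gram (boostMatrix_gram _)], by
    refine lt_of_lt_of_eq ?_ (mulVec_single_last (boostMatrix n t))
    rw [boostMatrix_mulVec]
    simpa [origin, Pi.single_eq_of_ne (idx_ne_last n), (idx_ne_last n),
      Pi.single_eq_of_ne (idx_ne_last n).symm] using Real.cosh_pos t⟩

/-- The inclusion `ℝⁿ⁻¹ = ℝe₁ ⊕ … ⊕ ℝeₙ₋₁ ⊆ ℝⁿ⁺¹`. -/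
def incl {n : ℕ} (v : Fin (n - 1) → ℝ) : Fin (n + 1) → ℝ :=
  fun i => if h : (i : ℕ) < n - 1 then v ⟨i, h⟩ else 0

theorem incl_idx {n : ℕ} (v : Fin (n - 1) → ℝ) : incl v (idx n) = 0 := by
  simp [incl, idx]

theorem incl_last {n : ℕ} (v : Fin (n - 1) → ℝ) : incl v (Fin.last n) = 0 := by
  simp [incl]

theorem incl_add {n : ℕ} (v v' : Fin (n - 1) → ℝ) : incl (v + v') = incl v + incl v' := by
  ext i
  by_cases h : (i : ℕ) < n - 1 <;> simp [incl, h]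

theorem incl_dotProduct {n : ℕ} [NeZero n] (v v' : Fin (n - 1) → ℝ) :
    incl v ⬝ᵥ incl v' = v ⬝ᵥ v' := by
  obtain ⟨m, rfl⟩ := Nat.exists_eq_succ_of_ne_zero (NeZero.ne n)
  simp [dotProduct, incl, Fin.sum_univ_castSucc]

theorem form_incl {n : ℕ} (v : Fin (n - 1) → ℝ) (x : Fin (n + 1) → ℝ) :
    form (incl v) x = -(incl v ⬝ᵥ x) := by
  simp [form, dotProduct, Fin.sum_univ_castSucc, incl_last]

/-- The matrix `n_v = [I, -v, v; vᵀ, 1 - |v|²/2, |v|²/2; vᵀ, -|v|²/2, 1 + |v|²/2]`,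
written as `1 + v bᵀ + b₀ vᵀ + (|v|²/2) b₀ bᵀ` with `b₀ = (0, …, 0, 1, 1)` and
`b = (0, …, 0, -1, 1)`. -/
def unipMatrix (n : ℕ) (v : Fin (n - 1) → ℝ) : Matrix (Fin (n + 1)) (Fin (n + 1)) ℝ :=
  1 + Matrix.vecMulVec (incl v) (Pi.single (Fin.last n) 1 - Pi.single (idx n) 1)
    + Matrix.vecMulVec (Pi.single (idx n) 1 + Pi.single (Fin.last n) 1) (incl v)
    + ((v ⬝ᵥ v) / 2) • Matrix.vecMulVec (Pi.single (idx n) 1 + Pi.single (Fin.last n) 1)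
        (Pi.single (Fin.last n) 1 - Pi.single (idx n) 1)

theorem unipMatrix_mulVec {n : ℕ} (v : Fin (n - 1) → ℝ) (x : Fin (n + 1) → ℝ) :
    unipMatrix n v *ᵥ x = x + (x (Fin.last n) - x (idx n)) • incl v
      + (incl v ⬝ᵥ x + (v ⬝ᵥ v) / 2 * (x (Fin.last n) - x (idx n))) •
        (Pi.single (idx n) 1 + Pi.single (Fin.last n) 1) := by
  ext i
  simp only [unipMatrix, Matrix.add_mulVec, Matrix.smul_mulVec, Matrix.vecMulVec_mulVec,
    Matrix.one_mulVec, sub_dotProduct, single_one_dotProduct, Pi.add_apply, Pi.smul_apply,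
    smul_eq_mul, MulOpposite.smul_eq_mul_unop, MulOpposite.unop_op]
  ring

theorem unipMatrix_gram {n : ℕ} [NeZero n] (v : Fin (n - 1) → ℝ) :
    (unipMatrix n v)ᵀ * gram n * unipMatrix n v = gram n := by
  refine gram_of_form_mulVec fun x y => ?_
  simp only [unipMatrix_mulVec, form_add_left, form_add_right, form_smul_left, form_smul_right,
    form_single_last, form_single_idx, form_comm x (Pi.single _ _), form_comm x (incl v),
    form_incl, incl_dotProduct, dotProduct_single_one, incl_idx, incl_last]
  simp only [Pi.single_eq_same, Pi.single_eq_of_ne (idx_ne_last n),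
    Pi.single_eq_of_ne (idx_ne_last n).symm]
  ring

theorem unipMatrix_add {n : ℕ} [NeZero n] (v v' : Fin (n - 1) → ℝ) :
    unipMatrix n (v + v') = unipMatrix n v * unipMatrix n v' := by
  refine Matrix.mulVec_injective (funext fun x => ?_)
  rw [← Matrix.mulVec_mulVec]
  ext i
  simp only [unipMatrix_mulVec, dotProduct_add, dotProduct_smul, incl_add, add_dotProduct,
    Pi.add_apply, Pi.smul_apply, smul_eq_mul, Pi.single_eq_same, incl_idx, incl_last,
    Pi.single_eq_of_ne (idx_ne_last n), Pi.single_eq_of_ne (idx_ne_last n).symm,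
    incl_dotProduct, dotProduct_single_one, dotProduct_comm v' v]
  ring

/-- The matrix `n_v` as an element of `SO₀(n,1)`. -/
def unip {n : ℕ} [NeZero n] (v : Fin (n - 1) → ℝ) : SO0 n :=
  ⟨unipMatrix n v, unipMatrix_gram v, by
    have h := unipMatrix_add (n := n) ((1 / 2 : ℝ) • v) ((1 / 2 : ℝ) • v)
    rw [← add_smul, add_halves, one_smul] at h
    rw [h, det_mul_self_of_gram (unipMatrix_gram _)], by
    refine lt_of_lt_of_eq ?_ (mulVec_single_last (unipMatrix n v))
    rw [unipMatrix_mulVec]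
    have h0 : 0 ≤ v ⬝ᵥ v := Finset.sum_nonneg fun i _ => mul_self_nonneg _
    simp only [origin, Pi.add_apply, Pi.smul_apply, smul_eq_mul, Pi.single_eq_same, incl_last,
      dotProduct_single_one, Pi.single_eq_of_ne (idx_ne_last n),
      Pi.single_eq_of_ne (idx_ne_last n).symm]
    linarith⟩

/-- The inclusion of `ℝᵈ = ℝeₙ₋d ⊕ … ⊕ ℝeₙ₋₁` into `ℝⁿ⁻¹ = ℝe₁ ⊕ … ⊕ ℝeₙ₋₁`. -/
def tail {d : ℕ} (n : ℕ) (w : EuclideanSpace ℝ (Fin d)) : Fin (n - 1) → ℝ :=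
  fun i => if h : n - 1 - d ≤ (i : ℕ) then w ⟨i - (n - 1 - d), by omega⟩ else 0

/-! ### The `d`-horospheres and the horospherical transform -/

/-- The basic `d`-horosphere `ξ₀`: the section of `ℍᵈ⁺¹ = ℍⁿ ∩ (ℝeₙ₋d ⊕ … ⊕ ℝeₙ₊₁)` by the
hyperplane `[x, b₀] = 1`, `b₀ = (0, …, 0, 1, 1)`. -/
def basicHorosphere (n d : ℕ) : Set (HypSpace n) :=
  {x | (∀ i : Fin (n + 1), (i : ℕ) < n - 1 - d → x.1 i = 0) ∧
    form x.1 (Pi.single (idx n) 1 + Pi.single (Fin.last n) 1) = 1}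

theorem tail_dotProduct {n d : ℕ} (hd : d ≤ n - 1) (w w' : EuclideanSpace ℝ (Fin d)) :
    tail n w ⬝ᵥ tail n w' = ∑ i, w i * w' i := by
  obtain ⟨e, he⟩ := Nat.exists_eq_add_of_le' hd
  have hsub : n - 1 - d = e := by omega
  rw [dotProduct, ← (finCongr he.symm).sum_comp, Fin.sum_univ_add]
  have h0 : ∀ x : Fin e, ¬ e ≤ (x : ℕ) := fun x => not_le.mpr x.2
  simp [tail, hsub, h0]

theorem unip_origin {n d : ℕ} [NeZero n] (w : EuclideanSpace ℝ (Fin d)) :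
    (unip (tail n w) • origin n).1 = Pi.single (Fin.last n) 1 + incl (tail n w)
      + ((tail n w ⬝ᵥ tail n w) / 2) • (Pi.single (idx n) 1 + Pi.single (Fin.last n) 1) := by
  change unipMatrix n (tail n w) *ᵥ (Pi.single (Fin.last n) 1) = _
  rw [unipMatrix_mulVec]
  simp [Pi.single_eq_of_ne (idx_ne_last n), incl_last]

theorem form_unip_origin {n d : ℕ} [NeZero n] (hd : d ≤ n - 1)
    (w w' : EuclideanSpace ℝ (Fin d)) :
    form (unip (tail n w) • origin n).1 (unip (tail n w') • origin n).1
      = 1 + ‖w - w'‖ ^ 2 / 2 := by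
  rw [EuclideanSpace.real_norm_sq_eq]
  have h : ∑ i, (w - w') i ^ 2 = tail n w ⬝ᵥ tail n w + tail n w' ⬝ᵥ tail n w'
      - 2 * (tail n w ⬝ᵥ tail n w') := by
    simp only [tail_dotProduct hd, Finset.mul_sum, ← Finset.sum_add_distrib,
      ← Finset.sum_sub_distrib]
    exact Finset.sum_congr rfl fun i _ => by simp; ring
  rw [h, unip_origin, unip_origin]
  simp only [form_add_left, form_add_right, form_smul_left, form_smul_right,
    form_single_last, form_single_idx, form_incl, incl_dotProduct, dotProduct_single_one, incl_idx,
    incl_last, Pi.single_eq_same, Pi.single_eq_of_ne (idx_ne_last n),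
    Pi.single_eq_of_ne (idx_ne_last n).symm]
  ring

theorem form_smul_smul {n : ℕ} (g : SO0 n) (x y : HypSpace n) :
    form (g • x).1 (g • y).1 = form x.1 y.1 :=
  form_mulVec_of_gram g.2.1 x.1 y.1

/-- The basic horosphere is the orbit of the origin under the matrices `n_w`, `w ∈ ℝᵈ`. -/
theorem basicHorosphere_eq {n d : ℕ} [NeZero n] (hd : d ≤ n - 1) :
    basicHorosphere n d =
      Set.range fun w : EuclideanSpace ℝ (Fin d) => unip (tail n w) • origin n := by
  have hn := NeZero.pos n
  ext x
  constructor
  · rintro ⟨h1, h2⟩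
    let w : EuclideanSpace ℝ (Fin d) :=
      WithLp.toLp 2 fun j => x.1 ⟨n - 1 - d + j, by omega⟩
    refine ⟨w, Subtype.ext ?_⟩
    have hx : ∀ i : Fin (n + 1), (i : ℕ) < n - 1 → x.1 i = incl (tail n w) i := by
      intro i hi
      by_cases hi2 : n - 1 - d ≤ (i : ℕ)
      · simp only [incl, hi, tail, hi2, dite_true, w]
        exact congrArg x.1 (Fin.ext (by simp only; omega))
      · simp only [incl, hi, tail, hi2, dite_true, dite_false]
        exact h1 i (by omega)
    rw [form_comm, form_add_left, form_single_idx, form_single_last] at h2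
    have hcase : ∀ i : Fin (n + 1), (i : ℕ) < n - 1 ∨ i = idx n ∨ i = Fin.last n := by
      intro i
      simp only [idx, Fin.ext_iff, Fin.val_last]
      omega
    have hdec : x.1 = incl (tail n w) + x.1 (idx n) • Pi.single (idx n) 1
        + x.1 (Fin.last n) • Pi.single (Fin.last n) 1 := by
      ext i
      rcases hcase i with hi | rfl | rfl
      · have ha : i ≠ idx n := by
          simp only [idx, ne_eq, Fin.ext_iff]; omega
        have hb : i ≠ Fin.last n := by
          simp only [ne_eq, Fin.ext_iff, Fin.val_last]; omega
        simp [hx i hi, ha, hb]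
      · simp [incl_idx, idx_ne_last]
      · simp [incl_last, (idx_ne_last n).symm]
    have h3 : form x.1 x.1 = 1 := x.2.1
    have h4 : form x.1 x.1 = -(tail n w ⬝ᵥ tail n w) - x.1 (idx n) ^ 2
        + x.1 (Fin.last n) ^ 2 := by
      conv_lhs => rw [hdec]
      simp only [form_add_left, form_add_right, form_smul_left, form_smul_right,
        form_single_last, form_single_idx, form_incl, incl_dotProduct, dotProduct_single_one,
        incl_idx, incl_last, Pi.single_eq_same, Pi.single_eq_of_ne (idx_ne_last n),
        Pi.single_eq_of_ne (idx_ne_last n).symm]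
      ring
    have h5 : x.1 (Fin.last n) = 1 + x.1 (idx n) := by linarith
    rw [h3, h5] at h4
    have h6 : x.1 (idx n) = (tail n w ⬝ᵥ tail n w) / 2 := by linarith
    change (unip (tail n w) • origin n).1 = x.1
    rw [unip_origin]
    conv_rhs => rw [hdec, h5, h6]
    module
  · rintro ⟨w, rfl⟩
    refine ⟨fun i hi => ?_, ?_⟩
    · have ha : i ≠ idx n := by
        simp only [idx, ne_eq, Fin.ext_iff]; omega
      have hb : i ≠ Fin.last n := by
        simp only [ne_eq, Fin.ext_iff, Fin.val_last]; omega
      have hc : ¬ n - 1 - d ≤ (i : ℕ) := by omega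
      simp only [unip_origin, Pi.add_apply, Pi.smul_apply, Pi.single_eq_of_ne ha,
        Pi.single_eq_of_ne hb]
      simp [incl, tail, hc]
    · simp only [unip_origin, form_add_left, form_smul_left, form_add_right,
        form_single_last, form_single_idx, form_incl, dotProduct_single_one, incl_idx,
        incl_last, Pi.single_eq_same, Pi.single_eq_of_ne (idx_ne_last n),
        Pi.single_eq_of_ne (idx_ne_last n).symm]
      ring

/-- The set `Ξ_d` of all `d`-horospheres `g ξ₀`, `g ∈ SO₀(n,1)`. -/
def Horosphere (n d : ℕ) : Type :=
  {ξ : Set (HypSpace n) // ∃ g : SO0 n, ξ = g • basicHorosphere n d}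

/-- The `d`-horosphere `g ξ₀`. -/
def horosphere {n : ℕ} (d : ℕ) (g : SO0 n) : Horosphere n d := ⟨g • basicHorosphere n d, g, rfl⟩

/-- The `d`-horospherical transform `f̂(ξ) = ∫_{ℝᵈ} f(g n_w x₀) dw`, `ξ = g ξ₀`. The value does not
depend on the choice of `g`, see `horoTransform_horosphere`. -/
def horoTransform {n d : ℕ} [NeZero n] (f : HypSpace n → ℂ) (ξ : Horosphere n d) : ℂ :=
  ∫ w : EuclideanSpace ℝ (Fin d), f ((ξ.2.choose * unip (tail n w)) • origin n)

theorem horoTransform_horosphere {n d : ℕ} [NeZero n] (hd : d ≤ n - 1) (f : HypSpace n → ℂ)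
    (g : SO0 n) : horoTransform f (horosphere d g) =
      ∫ w : EuclideanSpace ℝ (Fin d), f ((g * unip (tail n w)) • origin n) := by
  have hspec := (horosphere d g).2.choose_spec
  set g' : SO0 n := (horosphere d g).2.choose with hg'
  replace hspec : g • basicHorosphere n d = g' • basicHorosphere n d := hspec
  have key : ∀ (g g' : SO0 n), g • basicHorosphere n d = g' • basicHorosphere n d →
      ∀ w : EuclideanSpace ℝ (Fin d), ∃ w' : EuclideanSpace ℝ (Fin d),
        (g * unip (tail n w)) • origin n = (g' * unip (tail n w')) • origin n := by
    intro g g' hgg w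
    have h1 : g • (unip (tail n w) • origin n) ∈ g' • basicHorosphere n d := by
      rw [← hgg, basicHorosphere_eq hd]
      exact Set.smul_mem_smul_set ⟨w, rfl⟩
    rw [basicHorosphere_eq hd] at h1
    obtain ⟨-, ⟨w', rfl⟩, h2⟩ := h1
    exact ⟨w', by rw [mul_smul, mul_smul]; exact h2.symm⟩
  have hdist : ∀ (g g' : SO0 n) (w₁ w₂ u₁ u₂ : EuclideanSpace ℝ (Fin d)),
      (g * unip (tail n w₁)) • origin n = (g' * unip (tail n u₁)) • origin n →
      (g * unip (tail n w₂)) • origin n = (g' * unip (tail n u₂)) • origin n →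
      ‖w₁ - w₂‖ ^ 2 = ‖u₁ - u₂‖ ^ 2 := by
    intro g g' w₁ w₂ u₁ u₂ h1 h2
    have e1 := form_smul_smul g (unip (tail n w₁) • origin n) (unip (tail n w₂) • origin n)
    have e2 := form_smul_smul g' (unip (tail n u₁) • origin n) (unip (tail n u₂) • origin n)
    rw [← mul_smul, ← mul_smul, form_unip_origin hd] at e1 e2
    rw [h1, h2, e2] at e1
    linarith
  choose T hT using key g g' hspec
  choose T' hT' using key g' g hspec.symm
  have hiso : Isometry T := Isometry.of_dist_eq fun w₁ w₂ => by
    rw [dist_eq_norm, dist_eq_norm]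
    exact ((sq_eq_sq₀ (norm_nonneg _) (norm_nonneg _)).mp
      (hdist g g' _ _ _ _ (hT w₁) (hT w₂))).symm
  have hinv : ∀ w, T (T' w) = w := fun w => by
    have h := hdist g' g' w w (T (T' w)) w ((hT' w).trans (hT _)) rfl
    rw [sub_self, norm_zero] at h
    exact sub_eq_zero.mp (norm_eq_zero.mp (by nlinarith [norm_nonneg (T (T' w) - w)]))
  let E : EuclideanSpace ℝ (Fin d) ≃ᵢ EuclideanSpace ℝ (Fin d) :=
    IsometryEquiv.mk' T T' hinv hiso
  have hmp : MeasurePreserving E volume volume := by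
    have h1 := (E.toRealLinearIsometryEquiv).measurePreserving
    have h2 := (measurePreserving_add_right (volume : Measure (EuclideanSpace ℝ (Fin d)))
      (E 0)).comp h1
    have h3 : (E : EuclideanSpace ℝ (Fin d) → EuclideanSpace ℝ (Fin d)) =
        (fun x => x + E 0) ∘ E.toRealLinearIsometryEquiv := by
      funext w
      simp [IsometryEquiv.toRealLinearIsometryEquiv_apply]
    rwa [h3]
  calc horoTransform f (horosphere d g)
      = ∫ w : EuclideanSpace ℝ (Fin d), f ((g' * unip (tail n w)) • origin n) := rfl
    _ = ∫ w : EuclideanSpace ℝ (Fin d), f ((g' * unip (tail n (E w))) • origin n) :=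
        (hmp.integral_comp E.toHomeomorph.measurableEmbedding
          fun w => f ((g' * unip (tail n w)) • origin n)).symm
    _ = _ := by
        congr 1
        ext w
        rw [hT w]
        rfl

/-- The mean `∫_K φ(g k a_t ξ₀) dk` of a function `φ` of `d`-horospheres. For `g = r_x` with
`r_x x₀ = x` this is the mean value operator at `x`. -/
def horoMean {n d : ℕ} [NeZero n] (φ : Horosphere n d → ℂ) (g : SO0 n) (t : ℝ) : ℂ :=
  ∫ k : Rot n, φ (horosphere d (g * rot k * boost t)) ∂(rotHaar n)

/-- The area `σ_{d-1} = 2 π^{d/2} / Γ(d/2)` of the unit sphere of `ℝᵈ`. -/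
def sphereArea (d : ℕ) : ℝ := 2 * Real.pi ^ ((d : ℝ) / 2) / Real.Gamma ((d : ℝ) / 2)

/-- The constant `c = 2^{d/2-1} σ_{d-1} Γ(d/2)`. -/
def meanConst (d : ℕ) : ℝ :=
  2 ^ ((d : ℝ) / 2 - 1) * sphereArea d * Real.Gamma ((d : ℝ) / 2)

/-- The function `ψ(r) = c⁻¹ e^{td/2} ∫_K φ(g k a_t ξ₀) dk`, `t = cosh⁻¹ r`. -/
def psi {n d : ℕ} [NeZero n] (φ : Horosphere n d → ℂ) (g : SO0 n) (r : ℝ) : ℂ :=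
  ((meanConst d)⁻¹ * Real.exp (Real.arcosh r * d / 2)) • horoMean φ g (Real.arcosh r)

/-! ### Riemann–Liouville integrals and derivatives on a half-line -/

/-- The integrand `(v - s)^{α-1} ψ(v)` of the Riemann–Liouville integral. -/
def rlIntegrand (α : ℝ) (ψ : ℝ → ℂ) (s v : ℝ) : ℂ := (v - s) ^ (α - 1) • ψ v

/-- The Riemann–Liouville integral `(I^α_- ψ)(s) = Γ(α)⁻¹ ∫_s^∞ (v - s)^{α-1} ψ(v) dv`. -/
def rlIntegral (α : ℝ) (ψ : ℝ → ℂ) (s : ℝ) : ℂ :=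
  (Real.Gamma α)⁻¹ • ∫ v in Ioi s, rlIntegrand α ψ s v

/-- The classical derivative `F^{(m)}(s)` exists: the derivatives of order less than `m` exist
near `s`, and the derivative of order `m` exists at `s`. -/
def HasIterDeriv (m : ℕ) (F : ℝ → ℂ) (s : ℝ) : Prop :=
  (∀ j, j + 1 < m → ∀ᶠ u in 𝓝 s, DifferentiableAt ℝ (iteratedDeriv j F) u) ∧
    (∀ j, j + 1 = m → DifferentiableAt ℝ (iteratedDeriv j F) s)

/-- The function `s^{m-1/2} I^{1/2}_- [v^{-m} ψ(v)](s)`. -/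
def oddAux (m : ℕ) (ψ : ℝ → ℂ) (s : ℝ) : ℂ :=
  s ^ ((m : ℝ) - 1 / 2) • rlIntegral (1 / 2) (fun v => v ^ (-(m : ℝ)) • ψ v) s

/-- The fractional derivative `𝒟^{d/2}_- ψ`: it is `(-1)^m (d/ds)^m ψ` if `d = 2m`, and
`(-1)^m s^{1/2} (d/ds)^m [s^{m-1/2} I^{1/2}_- s^{-m} ψ]` if `d = 2m - 1`. -/
def fracDeriv (d : ℕ) (ψ : ℝ → ℂ) (s : ℝ) : ℂ :=
  if Even d then (-1) ^ (d / 2) * iteratedDeriv (d / 2) ψ s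
  else (-1) ^ ((d + 1) / 2) * (s ^ (1 / 2 : ℝ) • iteratedDeriv ((d + 1) / 2)
    (oddAux ((d + 1) / 2) ψ) s)

/-- All the derivatives and integrals in the definition of `(𝒟^{d/2}_- ψ)(s)` exist. -/
def FracDerivExists (d : ℕ) (ψ : ℝ → ℂ) (s : ℝ) : Prop :=
  if Even d then HasIterDeriv (d / 2) ψ s
  else (∀ᶠ u in 𝓝 s, IntegrableOn
      (rlIntegrand (1 / 2) (fun v => v ^ (-(((d + 1) / 2 : ℕ) : ℝ)) • ψ v) u) (Ioi u)) ∧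
    HasIterDeriv ((d + 1) / 2) (oddAux ((d + 1) / 2) ψ) s

/-- The second form `(-1)^m s^{1/2} (d/ds) [s^{1/2} I^{1/2}_- s^{-1} ψ^{(m-1)}]` of the fractional
derivative, for `d = 2m - 1`. -/
def fracDerivOdd (m : ℕ) (ψ : ℝ → ℂ) (s : ℝ) : ℂ :=
  (-1) ^ m * (s ^ (1 / 2 : ℝ) • deriv (oddAux 1 (iteratedDeriv (m - 1) ψ)) s)

/-- All the derivatives and integrals in `fracDerivOdd m ψ s` exist; the derivative `ψ^{(m-1)}`
under the integral sign is required almost everywhere. -/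
def FracDerivOddExists (m : ℕ) (ψ : ℝ → ℂ) (s : ℝ) : Prop :=
  (∀ᶠ u in 𝓝 s, (∀ᵐ v ∂volume.restrict (Ioi u), HasIterDeriv (m - 1) ψ v) ∧
    IntegrableOn
      (rlIntegrand (1 / 2) (fun v => v ^ (-((1 : ℕ) : ℝ)) • iteratedDeriv (m - 1) ψ v) u)
      (Ioi u)) ∧
    DifferentiableAt ℝ (oddAux 1 (iteratedDeriv (m - 1) ψ)) s

/-! ### The function spaces -/

/-- The space `C_μ(ℍⁿ)` of continuous functions with `f(x) = O(xₙ₊₁^{-μ})`. -/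
def decaySpace (n : ℕ) (μ : ℝ) : Set (HypSpace n → ℂ) :=
  {f | Continuous f ∧ ∃ C : ℝ, ∀ x, ‖f x‖ ≤ C * height x ^ (-μ)}


/-- The hyperbolic coordinates `(θ, r) ↦ θ sinh r + eₙ₊₁ cosh r`. -/
def polar {n : ℕ} (q : Metric.sphere (0 : EuclideanSpace ℝ (Fin n)) 1 × ℝ) : HypSpace n :=
  ⟨Fin.snoc (fun i : Fin n => q.1.1 i * Real.sinh q.2) (Real.cosh q.2), by
    have h : ∑ i, q.1.1 i ^ 2 = 1 := by
      have := EuclideanSpace.real_norm_sq_eq q.1.1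
      rw [← this, mem_sphere_zero_iff_norm.mp q.1.2]; norm_num
    refine ⟨?_, by simpa using Real.cosh_pos q.2⟩
    have h2 : ∑ i, q.1.1 i * Real.sinh q.2 * (q.1.1 i * Real.sinh q.2) = Real.sinh q.2 ^ 2 := by
      calc _ = (∑ i, q.1.1 i ^ 2) * Real.sinh q.2 ^ 2 := by
            rw [Finset.sum_mul]
            exact Finset.sum_congr rfl fun i _ => by ring
        _ = _ := by rw [h, one_mul]
    simp only [form, Fin.snoc_castSucc, Fin.snoc_last, h2]
    linarith [Real.cosh_sq q.2]⟩

/-- The map `polar` is continuous, hence Borel. -/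
theorem continuous_polar (n : ℕ) : Continuous (polar (n := n)) := by
  refine Continuous.subtype_mk (continuous_pi fun i => ?_) _
  refine Fin.lastCases ?_ (fun i => ?_) i
  · simp only [Fin.snoc_last]; fun_prop
  · simp only [Fin.snoc_castSucc]; fun_prop

/-- The `SO₀(n,1)`-invariant measure `dx = sinhⁿ⁻¹ r dr dθ` on `ℍⁿ`, where `dθ` is the surface
measure of the unit sphere of `ℝⁿ` and `r > 0`. -/
def hypMeasure (n : ℕ) : Measure (HypSpace n) :=
  Measure.map polar ((volume : Measure (EuclideanSpace ℝ (Fin n))).toSphere.prod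
    ((volume.restrict (Ioi (0 : ℝ))).withDensity
      fun r => ENNReal.ofReal (Real.sinh r ^ (n - 1))))

end Horospherical

end

namespace Horospherical

/-! ### Elementary geometry of the hyperboloid -/

/-! The quantity `form x y` is the hyperbolic cosine of the distance from x to y, and everything is
expressed through it. Push the measure dk dw forward under (k, w) ↦ r_x k a_t n_w x₀. The image
point lies at distance cosh⁻¹ v from x with v = cosh t + eᵗ|w|²/2, and the rotations spread it
uniformly over the sphere of that radius. In the variable v the radial part of dw becomes a constant
multiple of e^{-td/2} (v - cosh t)^{d/2-1} dv. After the normalization, ψ_x is therefore the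
Riemann–Liouville integral of order d/2 of the spherical mean v ↦ M_x(v) of f about x
(`map_horoPoint`, `psi_eq`, `FiniteTail.isRLIntegral`).

The remaining inversion is one-dimensional. If d = 2m, then ψ_x is an m-fold primitive of M_x. If d
= 2m - 1, a beta integral (`rlIntegral_comp`) gives s^{m-1/2} I^{1/2} s^{-m} I^{d/2} M =
I^m[v^{-1/2} M], again an m-fold primitive. The m derivatives and the factor s^{1/2} then return M.
Only the last derivative is delicate: it exists wherever the primitive of `fracBase` is
differentiable with the expected derivative. That is every s > 1 if M_x is continuous, and almost
every s by Lebesgue's theorem otherwise. Hence the fractional derivative of ψ_x at s equals M_x(s)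
(`IsRLIntegral.fracDeriv_eq`). The second odd form follows from the same beta identity with both
orders equal to 1/2.

It remains to let s → 1. A continuous function that vanishes at infinity is uniformly continuous for
the invariant distance, so its spherical means converge uniformly (`tendstoUniformly_sphereMean`).
In Lᵖ the mean operators are contractions for almost every s, by Jensen's inequality and the
invariance of dx; convergence holds for continuous functions of compact support, and these are dense
(`tendsto_eLpNorm_meanValue_sub_of_memLp`).

Convergence of the integrals is reduced to finiteness of ∫ v^{d/2-1} M_x|f|(v) dv at infinity
(`FiniteTail`), which is where μ > d/2 and p < 2(n-1)/d enter. Invariance of dx comes from Lebesgue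
measure on a solid cone over ℍⁿ, which matrices of determinant 1 preserve. As x ↦ r_x is arbitrary,
measurability in x is obtained by replacing r_x with a continuous section; spherical means depend on
x alone. -/

theorem coe_smul {n : ℕ} (g : SO0 n) (x : HypSpace n) : (g • x).1 = g.1 *ᵥ x.1 := rfl

theorem form_origin_left {n : ℕ} (x : HypSpace n) : form (origin n).1 x.1 = height x :=
  form_single_last x.1

theorem height_origin (n : ℕ) : height (origin n) = 1 := by simp [height, origin]

theorem height_pos {n : ℕ} (x : HypSpace n) : 0 < height x := x.2.2

theorem sum_sq_eq {n : ℕ} (x : HypSpace n) :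
    ∑ i : Fin n, x.1 i.castSucc ^ 2 = height x ^ 2 - 1 := by
  have h : form x.1 x.1 = 1 := x.2.1
  simp only [form, ← pow_two] at h
  simp only [height]
  linarith

theorem one_le_height {n : ℕ} (x : HypSpace n) : 1 ≤ height x := by
  have h := sum_sq_eq x
  have h0 : 0 ≤ ∑ i : Fin n, x.1 i.castSucc ^ 2 := Finset.sum_nonneg fun i _ => sq_nonneg _
  nlinarith [height_pos x]

theorem continuous_coord {n : ℕ} (i : Fin (n + 1)) :
    Continuous fun x : HypSpace n => x.1 i :=
  (continuous_apply i).comp continuous_subtype_val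

theorem continuous_height {n : ℕ} : Continuous (height (n := n)) :=
  continuous_coord _

theorem continuous_form {n : ℕ} :
    Continuous fun p : HypSpace n × HypSpace n => form p.1.1 p.2.1 := by
  have h1 : ∀ i : Fin (n + 1), Continuous fun p : HypSpace n × HypSpace n => p.1.1 i :=
    fun i => (continuous_coord i).comp continuous_fst
  have h2 : ∀ i : Fin (n + 1), Continuous fun p : HypSpace n × HypSpace n => p.2.1 i :=
    fun i => (continuous_coord i).comp continuous_snd
  unfold form
  fun_prop

/-- Cauchy–Schwarz in the first n coordinates. It is the crude bound cosh(a + b) ≤ 2 cosh a cosh b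
for the triangle inequality through the origin. -/
theorem form_le {n : ℕ} (x y : HypSpace n) : form x.1 y.1 ≤ 2 * height x * height y := by
  have cs := Finset.sum_mul_sq_le_sq_mul_sq Finset.univ (fun i : Fin n => x.1 i.castSucc)
    (fun i => y.1 i.castSucc)
  rw [sum_sq_eq, sum_sq_eq] at cs
  have hx := one_le_height x
  have hy := one_le_height y
  have h1 : (∑ i : Fin n, x.1 i.castSucc * y.1 i.castSucc) ^ 2 ≤ (height x * height y) ^ 2 := by
    nlinarith [sq_nonneg (height x), sq_nonneg (height y)]
  have h2 := abs_le_of_sq_le_sq' h1 (by positivity)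
  simp only [form]
  have h3 : x.1 (Fin.last n) * y.1 (Fin.last n) = height x * height y := rfl
  rw [h3]
  linarith [h2.1]

/-- With a = `height x` and b = `height y`, the nonnegative sum of the squares (b xᵢ - a yᵢ)²
expands to 2ab `form x y` - a² - b², so `form x y` ≥ (a² + b²)/(2ab) ≥ 1. -/
theorem one_le_form {n : ℕ} (x y : HypSpace n) : 1 ≤ form x.1 y.1 := by
  have h0 : 0 ≤ ∑ i : Fin n, (height y * x.1 i.castSucc - height x * y.1 i.castSucc) ^ 2 :=
    Finset.sum_nonneg fun i _ => sq_nonneg _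
  have h1 : ∑ i : Fin n, (height y * x.1 i.castSucc - height x * y.1 i.castSucc) ^ 2
      = height y ^ 2 * ∑ i : Fin n, x.1 i.castSucc ^ 2
        + height x ^ 2 * ∑ i : Fin n, y.1 i.castSucc ^ 2
        - 2 * (height x * height y) * ∑ i : Fin n, x.1 i.castSucc * y.1 i.castSucc := by
    simp only [Finset.mul_sum, ← Finset.sum_add_distrib, ← Finset.sum_sub_distrib]
    exact Finset.sum_congr rfl fun i _ => by ring
  rw [sum_sq_eq, sum_sq_eq] at h1
  have h3 : form x.1 y.1 = -∑ i : Fin n, x.1 i.castSucc * y.1 i.castSucc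
    + height x * height y := rfl
  have hx := one_le_height x
  have hy := one_le_height y
  have h4 : 0 < height x * height y := by positivity
  nlinarith [sq_nonneg (height x - height y)]

/-- The equality case of the same expansion: first the heights must agree, and then every square
vanishes. -/
theorem eq_of_form_eq_one {n : ℕ} {x y : HypSpace n} (h : form x.1 y.1 = 1) : x = y := by
  have h1 : ∑ i : Fin n, (height y * x.1 i.castSucc - height x * y.1 i.castSucc) ^ 2
      = height y ^ 2 * ∑ i : Fin n, x.1 i.castSucc ^ 2
        + height x ^ 2 * ∑ i : Fin n, y.1 i.castSucc ^ 2
        - 2 * (height x * height y) * ∑ i : Fin n, x.1 i.castSucc * y.1 i.castSucc := by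
    simp only [Finset.mul_sum, ← Finset.sum_add_distrib, ← Finset.sum_sub_distrib]
    exact Finset.sum_congr rfl fun i _ => by ring
  rw [sum_sq_eq, sum_sq_eq] at h1
  have h3 : form x.1 y.1 = -∑ i : Fin n, x.1 i.castSucc * y.1 i.castSucc
    + height x * height y := rfl
  have h0 : 0 ≤ ∑ i : Fin n, (height y * x.1 i.castSucc - height x * y.1 i.castSucc) ^ 2 :=
    Finset.sum_nonneg fun i _ => sq_nonneg _
  have h5 : ∑ i : Fin n, x.1 i.castSucc * y.1 i.castSucc = height x * height y - 1 := by linarith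
  rw [h5] at h1
  have hhy : height x = height y := by nlinarith [sq_nonneg (height x - height y)]
  have h6 : ∑ i : Fin n, (height y * x.1 i.castSucc - height x * y.1 i.castSucc) ^ 2 = 0 := by
    rw [h1, hhy]; ring
  rw [Finset.sum_eq_zero_iff_of_nonneg fun i _ => sq_nonneg _] at h6
  refine Subtype.ext (funext fun i => ?_)
  refine Fin.lastCases hhy (fun i => ?_) i
  have h7 := h6 i (Finset.mem_univ i)
  rw [hhy, ← mul_sub] at h7
  have := pow_eq_zero_iff (two_ne_zero) |>.mp h7
  rcases mul_eq_zero.mp this with h8 | h8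
  · exact absurd h8 (height_pos y).ne'
  · linarith

/-- The triangle inequality through y: `g⁻¹` moves y to the origin, where `form_le` applies. -/
theorem height_le_form {n : ℕ} (x y : HypSpace n) (g : SO0 n) (hg : g • origin n = y) :
    height x ≤ 2 * form x.1 y.1 * height y := by
  have h := form_le (g⁻¹ • x) (g⁻¹ • origin n)
  rw [form_smul_smul, form_comm, form_origin_left] at h
  have h1 : height (g⁻¹ • x) = form x.1 y.1 := by
    rw [← form_origin_left, ← form_smul_smul g, smul_inv_smul, hg, form_comm]
  have h2 : height (g⁻¹ • origin n) = height y := by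
    rw [← form_origin_left, ← form_smul_smul g, smul_inv_smul, hg, form_comm, form_origin_left]
  rwa [h1, h2] at h

/-! ### The action of the rotations -/

theorem rot_smul_castSucc {n : ℕ} (k : Rot n) (x : HypSpace n) (i : Fin n) :
    (rot k • x).1 i.castSucc = (k.1 *ᵥ fun j => x.1 j.castSucc) i := by
  rw [coe_smul]
  have hlast : (finSumFinEquiv (m := n) (n := 1)).symm (Fin.last n) = Sum.inr 0 := by
    rw [Equiv.symm_apply_eq]; rfl
  have hc : ∀ j : Fin n, (finSumFinEquiv (m := n) (n := 1)).symm j.castSucc = Sum.inl j := by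
    intro j; rw [Equiv.symm_apply_eq]; rfl
  simp [rot, Matrix.mulVec, dotProduct, Fin.sum_univ_castSucc, hlast, hc]

theorem height_rot_smul {n : ℕ} (k : Rot n) (x : HypSpace n) :
    height (rot k • x) = height x := by
  unfold height
  rw [coe_smul]
  have hlast : (finSumFinEquiv (m := n) (n := 1)).symm (Fin.last n) = Sum.inr 0 := by
    rw [Equiv.symm_apply_eq]; rfl
  have hc : ∀ j : Fin n, (finSumFinEquiv (m := n) (n := 1)).symm j.castSucc = Sum.inl j := by
    intro j; rw [Equiv.symm_apply_eq]; rfl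
  simp [rot, Matrix.mulVec, dotProduct, Fin.sum_univ_castSucc, hlast, hc]

theorem rot_mul {n : ℕ} (k l : Rot n) : rot (k * l) = rot k * rot l := by
  refine Subtype.ext ?_
  change Matrix.reindex _ _ _ = Matrix.reindex _ _ _ * Matrix.reindex _ _ _
  simp [Matrix.submatrix_mul_equiv, Matrix.fromBlocks_multiply]

theorem continuous_smul_rot_smul {n : ℕ} :
    Continuous fun p : Rot n × HypSpace n => rot p.1 • p.2 := by
  refine Continuous.subtype_mk (continuous_pi fun i => ?_) _
  refine Fin.lastCases ?_ (fun i => ?_) i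
  · exact (continuous_height.comp continuous_snd).congr fun p => (height_rot_smul p.1 p.2).symm
  · refine Continuous.congr (f := fun p : Rot n × HypSpace n =>
      (p.1.1 *ᵥ fun j => p.2.1 j.castSucc) i) ?_
      fun p => (rot_smul_castSucc p.1 p.2 i).symm
    unfold Matrix.mulVec dotProduct
    refine continuous_finsetSum _ fun j _ => Continuous.mul ?_ ?_
    · exact (continuous_subtype_val.comp continuous_fst).matrix_elem i j
    · exact (continuous_coord _).comp continuous_snd

theorem continuous_smul_left {n : ℕ} (g : SO0 n) : Continuous fun x : HypSpace n => g • x :=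
  Continuous.subtype_mk (by fun_prop) _

/-- The rotations as linear isometries of `ℝⁿ`. -/
noncomputable def rotIsometry {n : ℕ} (k : Rot n) :
    EuclideanSpace ℝ (Fin n) ≃ₗᵢ[ℝ] EuclideanSpace ℝ (Fin n) :=
  LinearIsometry.toLinearIsometryEquiv
    { toLinearMap := Matrix.toEuclideanLin k.1
      norm_map' := fun x => by
        have h : ∀ y : EuclideanSpace ℝ (Fin n), ‖y‖ ^ 2 = y.ofLp ⬝ᵥ y.ofLp := fun y => by
          rw [EuclideanSpace.real_norm_sq_eq, dotProduct]
          exact Finset.sum_congr rfl fun i _ => pow_two _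
        refine (sq_eq_sq₀ (norm_nonneg _) (norm_nonneg _)).mp ?_
        rw [h, h]
        change (k.1 *ᵥ x.ofLp) ⬝ᵥ (k.1 *ᵥ x.ofLp) = _
        rw [Matrix.dotProduct_mulVec, ← Matrix.mulVec_transpose, Matrix.mulVec_mulVec,
          rot_transpose_mul, Matrix.one_mulVec] } rfl

theorem rotIsometry_apply {n : ℕ} (k : Rot n) (x : EuclideanSpace ℝ (Fin n)) :
    rotIsometry k x = WithLp.toLp 2 (k.1 *ᵥ x.ofLp) := rfl

/-- The action of the rotations on the unit sphere. -/
noncomputable def rotSphere {n : ℕ} (k : Rot n)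
    (θ : Metric.sphere (0 : EuclideanSpace ℝ (Fin n)) 1) :
    Metric.sphere (0 : EuclideanSpace ℝ (Fin n)) 1 :=
  ⟨rotIsometry k θ.1, by simp⟩

theorem rot_smul_polar {n : ℕ} (k : Rot n)
    (θ : Metric.sphere (0 : EuclideanSpace ℝ (Fin n)) 1) (t : ℝ) :
    rot k • polar (θ, t) = polar (rotSphere k θ, t) := by
  refine Subtype.ext (funext fun i => ?_)
  refine Fin.lastCases ?_ (fun i => ?_) i
  · exact (height_rot_smul k _).trans (by simp [height, polar])
  · rw [rot_smul_castSucc]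
    simp only [polar, Fin.snoc_castSucc, rotSphere, rotIsometry_apply]
    simp only [Matrix.mulVec, dotProduct, Finset.sum_mul, mul_assoc]

/-- The unit vector `eₙ`. -/
noncomputable def lastVec (n : ℕ) [NeZero n] : Metric.sphere (0 : EuclideanSpace ℝ (Fin n)) 1 :=
  ⟨EuclideanSpace.single ⟨n - 1, Nat.sub_lt (NeZero.pos n) one_pos⟩ 1, by simp⟩

theorem boost_smul_origin {n : ℕ} [NeZero n] (t : ℝ) :
    (boost t : SO0 n) • origin n = polar (lastVec n, t) := by
  refine Subtype.ext ?_
  change boostMatrix n t *ᵥ (Pi.single (Fin.last n) 1) = _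
  rw [boostMatrix_mulVec]
  funext i
  refine Fin.lastCases ?_ (fun i => ?_) i
  · simp [polar, Pi.single_eq_of_ne (idx_ne_last n), Pi.single_eq_of_ne (idx_ne_last n).symm]
  · have : (i.castSucc = idx n) ↔ (i = ⟨n - 1, Nat.sub_lt (NeZero.pos n) one_pos⟩) := by
      simp [idx, Fin.ext_iff]
    simp [polar, Pi.single_apply, this, lastVec, idx_ne_last n,
      Fin.castSucc_ne_last]

theorem height_polar {n : ℕ} (θ : Metric.sphere (0 : EuclideanSpace ℝ (Fin n)) 1) (t : ℝ) :
    height (polar (θ, t)) = Real.cosh t := by simp [height, polar]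

theorem exists_eq_polar {n : ℕ} [NeZero n] (x : HypSpace n) :
    ∃ θ, x = polar (θ, Real.arcosh (height x)) := by
  have h1 := one_le_height x
  have hs := sum_sq_eq x
  have hsinh := Real.sinh_arcosh h1
  have hcosh := Real.cosh_arcosh h1
  -- At the origin the direction is undetermined and any unit vector serves; elsewhere the first n
  -- coordinates are normalized.
  by_cases h0 : height x = 1
  · refine ⟨lastVec n, ?_⟩
    rw [← eq_of_form_eq_one (x := origin n) (y := x) (by rw [form_origin_left, h0])]
    refine eq_of_form_eq_one ?_
    rw [form_origin_left, height_origin, height_polar, Real.cosh_arcosh le_rfl]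
  · have hpos : 0 < height x ^ 2 - 1 := by
      have : 1 < height x := lt_of_le_of_ne h1 (Ne.symm h0)
      nlinarith
    have hq := Real.sqrt_pos.mpr hpos
    refine ⟨⟨WithLp.toLp 2 fun i => x.1 i.castSucc / √(height x ^ 2 - 1), ?_⟩, ?_⟩
    · rw [mem_sphere_zero_iff_norm, ← sq_eq_sq₀ (norm_nonneg _) zero_le_one,
        EuclideanSpace.real_norm_sq_eq]
      simp only [div_pow, ← Finset.sum_div, hs, Real.sq_sqrt hpos.le]
      field_simp
    · refine Subtype.ext (funext fun i => ?_)
      refine Fin.lastCases ?_ (fun i => ?_) i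
      · simp only [polar, Fin.snoc_last, hcosh]; rfl
      · simp only [polar, Fin.snoc_castSucc, hsinh]
        field_simp

/-! ### Transitivity of the rotations on the sphere -/

/-- The matrix of the reflection in the hyperplane orthogonal to `a`. -/
noncomputable def householder {n : ℕ} (a : Fin n → ℝ) : Matrix (Fin n) (Fin n) ℝ :=
  1 + Matrix.vecMulVec a (-(2 / (a ⬝ᵥ a)) • a)

theorem householder_mulVec {n : ℕ} (a x : Fin n → ℝ) :
    householder a *ᵥ x = x - (2 * (a ⬝ᵥ x) / (a ⬝ᵥ a)) • a := by
  ext i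
  simp only [householder, Matrix.add_mulVec, Matrix.one_mulVec, Matrix.vecMulVec_mulVec,
    smul_dotProduct, Pi.add_apply, Pi.sub_apply, Pi.smul_apply, smul_eq_mul,
    MulOpposite.smul_eq_mul_unop, MulOpposite.unop_op]
  ring

/-- A reflection is symmetric, squares to 1 and has determinant -1 by the rank-one determinant
formula, so a product of two of them is a rotation. -/
theorem householder_mem {n : ℕ} {a b : Fin n → ℝ} (ha : a ⬝ᵥ a ≠ 0) (hb : b ⬝ᵥ b ≠ 0) :
    householder a * householder b ∈ Matrix.specialOrthogonalGroup (Fin n) ℝ := by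
  have hdet : ∀ c : Fin n → ℝ, c ⬝ᵥ c ≠ 0 → (householder c).det = -1 := fun c hc => by
    rw [householder, Matrix.vecMulVec_eq Unit, Matrix.det_one_add_replicateCol_mul_replicateRow,
      smul_dotProduct, smul_eq_mul]
    field_simp
    norm_num
  have hsq : ∀ c : Fin n → ℝ, c ⬝ᵥ c ≠ 0 → householder c * householder c = 1 := fun c hc => by
    refine Matrix.mulVec_injective (funext fun x => ?_)
    rw [← Matrix.mulVec_mulVec, householder_mulVec, householder_mulVec, Matrix.one_mulVec]
    ext i
    simp only [dotProduct_sub, dotProduct_smul, Pi.sub_apply, Pi.smul_apply, smul_eq_mul]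
    field_simp
    ring
  have htr : ∀ c : Fin n → ℝ, (householder c)ᵀ = householder c := fun c => by
    ext i j
    simp only [householder, Matrix.transpose_apply, Matrix.add_apply, Matrix.vecMulVec_apply,
      Matrix.one_apply, eq_comm (a := j), Pi.smul_apply, smul_eq_mul]
    ring
  rw [Matrix.mem_specialOrthogonalGroup_iff, Matrix.mem_orthogonalGroup_iff]
  refine ⟨?_, by rw [Matrix.det_mul, hdet a ha, hdet b hb]; norm_num⟩
  rw [Matrix.transpose_mul, htr, htr]
  calc householder a * householder b * (householder b * householder a)
      = householder a * (householder b * householder b) * householder a := by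
        simp only [Matrix.mul_assoc]
    _ = 1 := by rw [hsq b hb, Matrix.mul_one, hsq a ha]

/-- The reflection in u - v carries v to u but has determinant -1. Composing it with the reflection
in a vector b orthogonal to v, which fixes v, repairs the determinant; such a b exists because n ≥
2. -/
theorem exists_rotSphere_eq {n : ℕ} (hn : 2 ≤ n)
    (u v : Metric.sphere (0 : EuclideanSpace ℝ (Fin n)) 1) : ∃ k : Rot n, rotSphere k v = u := by
  have hunit : ∀ w : Metric.sphere (0 : EuclideanSpace ℝ (Fin n)) 1, w.1.ofLp ⬝ᵥ w.1.ofLp = 1 :=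
    fun w => by
      have := EuclideanSpace.real_norm_sq_eq w.1
      rw [mem_sphere_zero_iff_norm.mp w.2] at this
      simp only [dotProduct, ← pow_two, ← this]; norm_num
  by_cases huv : u = v
  · refine ⟨1, Subtype.ext ?_⟩
    change rotIsometry 1 v.1 = u.1
    rw [rotIsometry_apply, huv]
    simp
  set a : Fin n → ℝ := u.1.ofLp - v.1.ofLp with ha
  have ha0 : a ⬝ᵥ a ≠ 0 := fun h => huv (Subtype.ext (by
    have := dotProduct_self_eq_zero.mp h
    exact (WithLp.ofLp_injective 2) (sub_eq_zero.mp this)))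
  obtain ⟨b, hb0, hb⟩ : ∃ b : Fin n → ℝ, b ⬝ᵥ b ≠ 0 ∧ b ⬝ᵥ v.1.ofLp = 0 := by
    let i0 : Fin n := ⟨0, by omega⟩
    let i1 : Fin n := ⟨1, by omega⟩
    have h01 : i0 ≠ i1 := by simp [i0, i1]
    by_cases h0 : v.1.ofLp i0 = 0
    · exact ⟨Pi.single i0 1, by simp, by simp [h0]⟩
    · refine ⟨v.1.ofLp i1 • Pi.single i0 1 - v.1.ofLp i0 • Pi.single i1 1, ?_, ?_⟩
      · simp only [sub_dotProduct, dotProduct_sub, smul_dotProduct, dotProduct_smul,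
          single_one_dotProduct, Pi.single_eq_same, Pi.single_eq_of_ne h01,
          Pi.single_eq_of_ne h01.symm, smul_eq_mul]
        have : 0 < v.1.ofLp i0 ^ 2 := by positivity
        nlinarith [sq_nonneg (v.1.ofLp i1)]
      · simp [sub_dotProduct, mul_comm]
  refine ⟨⟨_, householder_mem ha0 hb0⟩, Subtype.ext ?_⟩
  change WithLp.toLp 2 ((householder a * householder b) *ᵥ v.1.ofLp) = u.1
  rw [← Matrix.mulVec_mulVec, householder_mulVec b, hb]
  simp only [mul_zero, zero_div, zero_smul, sub_zero]
  rw [householder_mulVec]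
  have h1 : a ⬝ᵥ a = 2 - 2 * (u.1.ofLp ⬝ᵥ v.1.ofLp) := by
    simp only [ha, sub_dotProduct, dotProduct_sub, hunit, dotProduct_comm v.1.ofLp u.1.ofLp]
    ring
  have h2 : a ⬝ᵥ v.1.ofLp = u.1.ofLp ⬝ᵥ v.1.ofLp - 1 := by
    simp only [ha, sub_dotProduct, hunit]
  have h3 : 2 * (a ⬝ᵥ v.1.ofLp) / (a ⬝ᵥ a) = -1 := by
    rw [div_eq_iff ha0, h1, h2]; ring
  rw [h3, ha]
  ext i
  simp

/-- Every point of `ℍⁿ` is `k aₜ x₀`. -/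
theorem exists_eq_rot_smul_boost {n : ℕ} [NeZero n] (hn : 2 ≤ n) (x : HypSpace n) :
    ∃ k : Rot n, x = rot k • (boost (Real.arcosh (height x)) : SO0 n) • origin n := by
  obtain ⟨θ, hθ⟩ := exists_eq_polar x
  obtain ⟨k, hk⟩ := exists_rotSphere_eq hn θ (lastVec n)
  refine ⟨k, ?_⟩
  rw [boost_smul_origin, rot_smul_polar, hk]
  exact hθ

/-- The distance from the origin to a point of a_t ξ₀ depends on |w| only. This formula is the
substitution that produces the fractional integral. -/
theorem height_boost_smul_unip {n d : ℕ} [NeZero n] (hd : d ≤ n - 1) (t : ℝ)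
    (w : EuclideanSpace ℝ (Fin d)) :
    height ((boost t : SO0 n) • (unip (tail n w) : SO0 n) • origin n)
      = Real.cosh t + Real.exp t * ‖w‖ ^ 2 / 2 := by
  rw [EuclideanSpace.real_norm_sq_eq]
  have h : ∑ i, w i ^ 2 = tail n w ⬝ᵥ tail n w := by
    rw [tail_dotProduct hd]
    exact Finset.sum_congr rfl fun i _ => pow_two _
  rw [h]
  change (boostMatrix n t *ᵥ (unip (tail n w) • origin n).1) (Fin.last n) = _
  rw [boostMatrix_mulVec, unip_origin]
  simp only [Pi.add_apply, Pi.smul_apply, smul_eq_mul, Pi.single_eq_same, incl_last, incl_idx,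
    Pi.single_eq_of_ne (idx_ne_last n), Pi.single_eq_of_ne (idx_ne_last n).symm]
  rw [← Real.cosh_add_sinh]
  ring

/-! ### Polar coordinates -/

theorem lintegral_polar {E : Type*} [NormedAddCommGroup E] [NormedSpace ℝ E] [MeasurableSpace E]
    [FiniteDimensional ℝ E] [BorelSpace E] [Nontrivial E] (μ : Measure E) [μ.IsAddHaarMeasure]
    (F : E → ℝ≥0∞) (hF : Measurable F) :
    ∫⁻ x, F x ∂μ = ∫⁻ θ, ∫⁻ ρ in Ioi (0 : ℝ),
      ENNReal.ofReal (ρ ^ (Module.finrank ℝ E - 1)) * F (ρ • θ.1) ∂volume ∂μ.toSphere := by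
  have hmeas : Measurable fun p : Metric.sphere (0 : E) 1 × Ioi (0 : ℝ) => F (p.2.1 • p.1.1) :=
    hF.comp (by fun_prop)
  calc ∫⁻ x, F x ∂μ = ∫⁻ x : ({(0)}ᶜ : Set E), F x ∂(μ.comap (↑)) := by
        rw [lintegral_subtype_comap (measurableSet_singleton _).compl, restrict_compl_singleton]
    _ = ∫⁻ p, F (p.2.1 • p.1.1) ∂(μ.toSphere.prod (.volumeIoiPow (Module.finrank ℝ E - 1))) := by
        rw [← μ.measurePreserving_homeomorphUnitSphereProd.lintegral_comp hmeas]
        refine lintegral_congr fun x => ?_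
        have hx : ‖x.1‖ ≠ 0 := norm_ne_zero_iff.mpr x.2
        simp [homeomorphUnitSphereProd, smul_smul, hx]
    _ = _ := by
        rw [lintegral_prod _ hmeas.aemeasurable]
        refine lintegral_congr fun θ => ?_
        have hθ : Measurable fun ρ : Ioi (0 : ℝ) => F (ρ.1 • θ.1) :=
          hmeas.comp measurable_prodMk_left
        refine (lintegral_withDensity_eq_lintegral_mul _ (by fun_prop) hθ).trans ?_
        exact lintegral_subtype_comap measurableSet_Ioi
          fun ρ : ℝ => ENNReal.ofReal (ρ ^ (Module.finrank ℝ E - 1)) * F (ρ • θ.1)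

theorem lintegral_hypMeasure {n : ℕ} (F : HypSpace n → ℝ≥0∞) (hF : Measurable F) :
    ∫⁻ x, F x ∂hypMeasure n = ∫⁻ θ, ∫⁻ t in Ioi (0 : ℝ),
      ENNReal.ofReal (Real.sinh t ^ (n - 1)) * F (polar (θ, t)) ∂volume
        ∂(volume : Measure (EuclideanSpace ℝ (Fin n))).toSphere := by
  have hm := hF.comp (continuous_polar n).measurable
  rw [hypMeasure, lintegral_map hF (continuous_polar n).measurable]
  refine (lintegral_prod _ hm.aemeasurable).trans (lintegral_congr fun θ => ?_)
  exact lintegral_withDensity_eq_lintegral_mul _ (by fun_prop) (hm.comp measurable_prodMk_left)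

/-- The projection of `ℍⁿ` onto the first `n` coordinates has this map as its inverse. -/
noncomputable def graph {n : ℕ} (u : EuclideanSpace ℝ (Fin n)) : HypSpace n :=
  ⟨Fin.snoc (fun i : Fin n => u i) √(1 + ‖u‖ ^ 2), by
    have h : ∑ i, u i * u i = ‖u‖ ^ 2 := by
      rw [EuclideanSpace.real_norm_sq_eq]
      exact Finset.sum_congr rfl fun i _ => (pow_two _).symm
    refine ⟨?_, ?_⟩
    · simp only [form, Fin.snoc_castSucc, Fin.snoc_last, h]
      rw [Real.mul_self_sqrt (by positivity)]; ring
    · simp only [Fin.snoc_last]; positivity⟩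

theorem continuous_graph (n : ℕ) : Continuous (graph (n := n)) := by
  refine Continuous.subtype_mk (continuous_pi fun i => ?_) _
  refine Fin.lastCases ?_ (fun i => ?_) i
  · simp only [Fin.snoc_last]; fun_prop
  · simp only [Fin.snoc_castSucc]; fun_prop

theorem graph_smul {n : ℕ} (θ : Metric.sphere (0 : EuclideanSpace ℝ (Fin n)) 1) (t : ℝ) :
    graph (Real.sinh t • θ.1) = polar (θ, t) := by
  refine Subtype.ext (funext fun i => ?_)
  refine Fin.lastCases ?_ (fun i => ?_) i
  · simp only [graph, polar, Fin.snoc_last, norm_smul, mem_sphere_zero_iff_norm.mp θ.2, mul_one,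
      Real.norm_eq_abs, sq_abs]
    rw [add_comm, ← Real.cosh_sq, Real.sqrt_sq (Real.cosh_pos t).le]
  · simp [graph, polar, mul_comm]

theorem sinh_image_Ioi : Real.sinh '' Ioi 0 = Ioi 0 := by
  ext x
  constructor
  · rintro ⟨t, ht, rfl⟩
    exact Real.sinh_pos_iff.mpr ht
  · intro hx
    exact ⟨Real.arsinh x, Real.arsinh_pos_iff.mpr hx, Real.sinh_arsinh x⟩

/-- With ρ = sinh t, the density sinhⁿ⁻¹ t dt becomes ρⁿ⁻¹ dρ / √(1 + ρ²). -/
theorem lintegral_hypMeasure_eq_graph {n : ℕ} [NeZero n] (F : HypSpace n → ℝ≥0∞)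
    (hF : Measurable F) :
    ∫⁻ x, F x ∂hypMeasure n
      = ∫⁻ u : EuclideanSpace ℝ (Fin n), ENNReal.ofReal (√(1 + ‖u‖ ^ 2))⁻¹ * F (graph u) := by
  have hm : Measurable fun u : EuclideanSpace ℝ (Fin n) =>
      ENNReal.ofReal (√(1 + ‖u‖ ^ 2))⁻¹ * F (graph u) :=
    Measurable.mul (by fun_prop) (hF.comp (continuous_graph n).measurable)
  rw [lintegral_hypMeasure F hF, lintegral_polar volume _ hm]
  refine lintegral_congr fun θ => ?_
  conv_rhs => rw [finrank_euclideanSpace_fin, ← sinh_image_Ioi,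
    lintegral_image_eq_lintegral_abs_deriv_mul measurableSet_Ioi
      (fun x _ => (Real.hasDerivAt_sinh x).hasDerivWithinAt) Real.sinh_injective.injOn]
  refine setLIntegral_congr_fun measurableSet_Ioi fun t ht => ?_
  simp only [graph_smul, norm_smul, mem_sphere_zero_iff_norm.mp θ.2, mul_one,
      Real.norm_eq_abs, sq_abs]
  rw [add_comm, ← Real.cosh_sq, Real.sqrt_sq (Real.cosh_pos t).le,
    abs_of_pos (Real.cosh_pos t), ← mul_assoc, ← mul_assoc, mul_right_comm (ENNReal.ofReal _),
    ← ENNReal.ofReal_mul (Real.cosh_pos t).le, mul_inv_cancel₀ (Real.cosh_pos t).ne',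
    ENNReal.ofReal_one, one_mul]

/-! ### Invariance of the measure -/

/-- The part of the solid cone over `ℍⁿ` below `ℍⁿ`. -/
def truncatedCone (n : ℕ) : Set (Fin (n + 1) → ℝ) :=
  {z | 0 < form z z ∧ form z z < 1 ∧ 0 < z (Fin.last n)}

open Classical in
/-- The central projection of the solid cone to `ℍⁿ`. -/
noncomputable def coneProj {n : ℕ} (z : Fin (n + 1) → ℝ) : HypSpace n :=
  if h : (√(form z z))⁻¹ • z ∈ hyperboloid n then ⟨_, h⟩ else origin n

theorem inv_sqrt_smul_mem {n : ℕ} {z : Fin (n + 1) → ℝ} (h : 0 < form z z)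
    (h' : 0 < z (Fin.last n)) : (√(form z z))⁻¹ • z ∈ hyperboloid n := by
  have hs := Real.sqrt_pos.mpr h
  refine ⟨?_, by simp only [Pi.smul_apply, smul_eq_mul]; positivity⟩
  rw [form_smul_left, form_smul_right, ← mul_assoc, ← mul_inv, Real.mul_self_sqrt h.le,
    inv_mul_cancel₀ h.ne']

theorem coe_coneProj {n : ℕ} {z : Fin (n + 1) → ℝ} (h : 0 < form z z)
    (h' : 0 < z (Fin.last n)) : (coneProj z).1 = (√(form z z))⁻¹ • z := by
  rw [coneProj, dif_pos (inv_sqrt_smul_mem h h')]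

theorem continuous_form_self (n : ℕ) : Continuous fun z : Fin (n + 1) → ℝ => form z z := by
  unfold form; fun_prop

theorem measurableSet_hyperboloid (n : ℕ) : MeasurableSet (hyperboloid n) :=
  (measurableSet_eq_fun (continuous_form_self n).measurable measurable_const).inter
    (measurableSet_lt measurable_const (measurable_pi_apply _))

theorem measurableSet_truncatedCone (n : ℕ) : MeasurableSet (truncatedCone n) :=
  (measurableSet_lt measurable_const (continuous_form_self n).measurable).inter
    ((measurableSet_lt (continuous_form_self n).measurable measurable_const).inter
      (measurableSet_lt measurable_const (measurable_pi_apply _)))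

theorem measurable_coneProj (n : ℕ) : Measurable (coneProj (n := n)) := by
  classical
  have h1 : Measurable fun z : Fin (n + 1) → ℝ => (√(form z z))⁻¹ • z :=
    ((continuous_form_self n).measurable.sqrt.inv).smul measurable_id
  unfold coneProj
  refine Measurable.dite (f := fun z : {z : Fin (n + 1) → ℝ //
    (√(form z z))⁻¹ • z ∈ hyperboloid n} => (⟨_, z.2⟩ : HypSpace n))
    (g := fun _ => origin n) ?_ measurable_const (h1 (measurableSet_hyperboloid n))
  exact (h1.comp measurable_subtype_coe).subtype_mk

theorem last_mulVec_pos {n : ℕ} (g : SO0 n) {z : Fin (n + 1) → ℝ} (h : 0 < form z z)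
    (h' : 0 < z (Fin.last n)) : 0 < (g.1 *ᵥ z) (Fin.last n) := by
  have := (mulVec_mem_hyperboloid g.2.1 g.2.2.2 (inv_sqrt_smul_mem h h')).2
  rw [Matrix.mulVec_smul, Pi.smul_apply, smul_eq_mul] at this
  exact (pos_iff_pos_of_mul_pos this).mp (inv_pos.mpr (Real.sqrt_pos.mpr h))

theorem mulVec_mem_truncatedCone {n : ℕ} (g : SO0 n) {z : Fin (n + 1) → ℝ}
    (h : z ∈ truncatedCone n) : g.1 *ᵥ z ∈ truncatedCone n := by
  refine ⟨?_, ?_, last_mulVec_pos g h.1 h.2.2⟩ <;> rw [form_mulVec_of_gram g.2.1]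
  exacts [h.1, h.2.1]

theorem mulVec_mem_truncatedCone_iff {n : ℕ} (g : SO0 n) (z : Fin (n + 1) → ℝ) :
    g.1 *ᵥ z ∈ truncatedCone n ↔ z ∈ truncatedCone n := by
  refine ⟨fun h => ?_, mulVec_mem_truncatedCone g⟩
  have h1 := mulVec_mem_truncatedCone g⁻¹ h
  rw [Matrix.mulVec_mulVec] at h1
  have h2 : (g⁻¹).1 * g.1 = 1 := congrArg Subtype.val (inv_mul_cancel g)
  rwa [h2, Matrix.one_mulVec] at h1

theorem coneProj_mulVec {n : ℕ} (g : SO0 n) {z : Fin (n + 1) → ℝ} (h : z ∈ truncatedCone n) :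
    coneProj (g.1 *ᵥ z) = g • coneProj z := by
  refine Subtype.ext ?_
  have h' := mulVec_mem_truncatedCone g h
  rw [coe_coneProj h'.1 h'.2.2, coe_smul, coe_coneProj h.1 h.2.2, form_mulVec_of_gram g.2.1,
    Matrix.mulVec_smul]

/-- A matrix of the group has determinant 1, maps the cone onto itself and commutes with the central
projection. -/
theorem lintegral_truncatedCone_smul {n : ℕ} (g : SO0 n) (F : HypSpace n → ℝ≥0∞)
    (hF : Measurable F) :
    ∫⁻ z in truncatedCone n, F (g • coneProj z) = ∫⁻ z in truncatedCone n, F (coneProj z) := by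
  have hmp : MeasurePreserving (Matrix.toLin' g.1) volume volume := by
    refine ⟨(Matrix.toLin' g.1).continuous_of_finiteDimensional.measurable, ?_⟩
    rw [Real.map_matrix_volume_pi_eq_smul_volume_pi (by rw [g.2.2.1]; exact one_ne_zero), g.2.2.1]
    simp
  have hG : Measurable fun z : Fin (n + 1) → ℝ =>
      (truncatedCone n).indicator (fun z => F (coneProj z)) z :=
    (hF.comp (measurable_coneProj n)).indicator (measurableSet_truncatedCone n)
  rw [← lintegral_indicator (measurableSet_truncatedCone n),
    ← lintegral_indicator (measurableSet_truncatedCone n), ← hmp.lintegral_comp hG]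
  refine lintegral_congr fun z => ?_
  rw [Matrix.toLin'_apply]
  by_cases hz : z ∈ truncatedCone n
  · rw [indicator_of_mem hz, indicator_of_mem ((mulVec_mem_truncatedCone_iff g z).mpr hz),
      coneProj_mulVec g hz]
  · rw [indicator_of_notMem hz,
      indicator_of_notMem fun h => hz ((mulVec_mem_truncatedCone_iff g z).mp h)]

theorem form_snoc {n : ℕ} (u : EuclideanSpace ℝ (Fin n)) (z : ℝ) :
    form (Fin.snoc (fun i : Fin n => u i) z : Fin (n + 1) → ℝ)
      (Fin.snoc (fun i : Fin n => u i) z) = z ^ 2 - ‖u‖ ^ 2 := by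
  rw [EuclideanSpace.real_norm_sq_eq]
  simp only [form, Fin.snoc_castSucc, Fin.snoc_last, pow_two]
  ring

theorem lintegral_fin_succ {n : ℕ} (F : (Fin (n + 1) → ℝ) → ℝ≥0∞) (hF : Measurable F) :
    ∫⁻ z, F z = ∫⁻ u : EuclideanSpace ℝ (Fin n), ∫⁻ z : ℝ,
      F (Fin.snoc (fun i : Fin n => u i) z) := by
  have h1 := (volume_preserving_piFinSuccAbove (fun _ : Fin (n + 1) => ℝ) (Fin.last n)).symm
  have h2 := EuclideanSpace.volume_preserving_symm_measurableEquiv_toLp (Fin n)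
  have hsnoc : Measurable fun p : ℝ × (Fin n → ℝ) =>
      F (Fin.snoc (fun i : Fin n => p.2 i) p.1) := by
    refine hF.comp (measurable_pi_iff.mpr fun i => ?_)
    refine Fin.lastCases ?_ (fun i => ?_) i
    · simp only [Fin.snoc_last]; fun_prop
    · simp only [Fin.snoc_castSucc]; fun_prop
  calc ∫⁻ z, F z = ∫⁻ p : ℝ × (Fin n → ℝ), F (Fin.snoc (fun i : Fin n => p.2 i) p.1) := by
        rw [← h1.lintegral_comp hF]
        refine lintegral_congr fun p => ?_
        congr 1
        change Fin.insertNth (α := fun _ => ℝ) (Fin.last n) p.1 p.2 = _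
        rw [Fin.insertNth_last]
        rfl
    _ = ∫⁻ y : Fin n → ℝ, ∫⁻ z : ℝ, F (Fin.snoc (fun i : Fin n => y i) z) := by
        rw [Measure.volume_eq_prod]
        exact lintegral_prod_symm _ hsnoc.aemeasurable
    _ = _ := by
        have h3 : Measurable fun y : Fin n → ℝ =>
            ∫⁻ z : ℝ, F (Fin.snoc (fun i : Fin n => y i) z) :=
          Measurable.lintegral_prod_left' (f := fun p : ℝ × (Fin n → ℝ) =>
            F (Fin.snoc (fun i : Fin n => p.2 i) p.1)) hsnoc
        exact (h2.lintegral_comp h3).symm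

theorem hasDerivAt_sqrt_sq_add {b x : ℝ} (hx : 0 < x) :
    HasDerivAt (fun x : ℝ => √(x ^ 2 + b ^ 2)) (x / √(x ^ 2 + b ^ 2)) x := by
  have h0 : x ^ 2 + b ^ 2 ≠ 0 := by positivity
  have h := (((hasDerivAt_id x).pow 2).add_const (b ^ 2)).sqrt h0
  refine h.congr_deriv ?_
  simp
  field_simp

/-- On the vertical line over u, use the parameter l = √(form z z) in (0, 1). The last coordinate is
√(l² + |u|²), with derivative l/√(l² + |u|²), and the point projects to `graph (l⁻¹ • u)`. -/
theorem lintegral_cone_section {n : ℕ} (u : EuclideanSpace ℝ (Fin n)) (F : HypSpace n → ℝ≥0∞) :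
    ∫⁻ z : ℝ, (truncatedCone n).indicator (fun z => F (coneProj z))
        (Fin.snoc (fun i : Fin n => u i) z)
      = ∫⁻ l in Ioo (0 : ℝ) 1, ENNReal.ofReal (l / √(l ^ 2 + ‖u‖ ^ 2)) * F (graph (l⁻¹ • u)) := by
  have himage : (fun x : ℝ => √(x ^ 2 + ‖u‖ ^ 2)) '' Ioo 0 1
      = {z : ℝ | (Fin.snoc (fun i : Fin n => u i) z : Fin (n + 1) → ℝ) ∈ truncatedCone n} := by
    ext z
    simp only [truncatedCone, mem_ofPred_eq, form_snoc, Fin.snoc_last]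
    constructor
    · rintro ⟨l, ⟨hl0, hl1⟩, rfl⟩
      refine ⟨?_, ?_, by positivity⟩ <;> simp only <;> rw [Real.sq_sqrt (by positivity)] <;>
        nlinarith
    · rintro ⟨h1, h2, h3⟩
      refine ⟨√(z ^ 2 - ‖u‖ ^ 2), ⟨Real.sqrt_pos.mpr h1, ?_⟩, ?_⟩
      · rw [Real.sqrt_lt' one_pos]; linarith
      · simp only
        rw [Real.sq_sqrt h1.le, sub_add_cancel, Real.sqrt_sq h3.le]
  have hinj : InjOn (fun x : ℝ => √(x ^ 2 + ‖u‖ ^ 2)) (Ioo 0 1) := by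
    intro x hx y hy hxy
    have h1 : x ^ 2 + ‖u‖ ^ 2 = y ^ 2 + ‖u‖ ^ 2 :=
      (Real.sqrt_inj (by positivity) (by positivity)).mp hxy
    exact (sq_eq_sq₀ hx.1.le hy.1.le).mp (by linarith)
  have hset : MeasurableSet
      {z : ℝ | (Fin.snoc (fun i : Fin n => u i) z : Fin (n + 1) → ℝ) ∈ truncatedCone n} := by
    refine measurableSet_preimage (measurable_pi_iff.mpr fun i => ?_)
      (measurableSet_truncatedCone n)
    refine Fin.lastCases ?_ (fun i => ?_) i
    · simp only [Fin.snoc_last]; fun_prop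
    · simp only [Fin.snoc_castSucc]; fun_prop
  calc _ = ∫⁻ z in {z : ℝ | (Fin.snoc (fun i : Fin n => u i) z : Fin (n + 1) → ℝ) ∈
            truncatedCone n}, F (coneProj (Fin.snoc (fun i : Fin n => u i) z)) := by
        rw [← lintegral_indicator hset]; rfl
    _ = _ := by
        rw [← himage, lintegral_image_eq_lintegral_abs_deriv_mul measurableSet_Ioo
          (fun x hx => (hasDerivAt_sqrt_sq_add hx.1).hasDerivWithinAt) hinj]
        refine setLIntegral_congr_fun measurableSet_Ioo fun l hl => ?_
        have hl0 := hl.1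
        simp only
        rw [abs_of_nonneg (by positivity)]
        congr 2
        have hf : form (Fin.snoc (fun i : Fin n => u i) √(l ^ 2 + ‖u‖ ^ 2) : Fin (n + 1) → ℝ)
            (Fin.snoc (fun i : Fin n => u i) √(l ^ 2 + ‖u‖ ^ 2)) = l ^ 2 := by
          rw [form_snoc, Real.sq_sqrt (by positivity)]; ring
        refine Subtype.ext ?_
        rw [coe_coneProj (by rw [hf]; positivity) (by simp only [Fin.snoc_last]; positivity), hf,
          Real.sqrt_sq hl0.le]
        funext i
        refine Fin.lastCases ?_ (fun i => ?_) i
        · simp only [Pi.smul_apply, Fin.snoc_last, graph, smul_eq_mul, norm_smul, mul_pow,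
            Real.norm_eq_abs, sq_abs]
          rw [← Real.sqrt_sq (inv_nonneg.mpr hl0.le), ← Real.sqrt_mul (sq_nonneg _),
            Real.sqrt_sq (inv_nonneg.mpr hl0.le), mul_add, ← mul_pow, inv_mul_cancel₀ hl0.ne',
            one_pow]
        · simp [graph]

theorem lintegral_comp_inv_smul {E : Type*} [NormedAddCommGroup E] [NormedSpace ℝ E]
    [MeasurableSpace E] [FiniteDimensional ℝ E] [BorelSpace E] (μ : Measure E)
    [μ.IsAddHaarMeasure] {l : ℝ} (hl : 0 < l) (F : E → ℝ≥0∞) (hF : Measurable F) :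
    ∫⁻ x, F (l⁻¹ • x) ∂μ = ENNReal.ofReal (l ^ Module.finrank ℝ E) * ∫⁻ x, F x ∂μ := by
  rw [← lintegral_map hF (measurable_const_smul l⁻¹),
    Measure.map_addHaar_smul μ (inv_ne_zero hl.ne'), lintegral_smul_measure]
  simp [abs_of_pos hl]

/-- For each fixed l, scaling u by l turns the section formula into lⁿ times the integral over the
graph. Lebesgue measure on the cone thus splits into a radial factor and `hypMeasure`. -/
theorem lintegral_truncatedCone {n : ℕ} [NeZero n] (F : HypSpace n → ℝ≥0∞) (hF : Measurable F) :
    ∫⁻ z in truncatedCone n, F (coneProj z)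
      = (∫⁻ l in Ioo (0 : ℝ) 1, ENNReal.ofReal (l ^ n)) * ∫⁻ x, F x ∂hypMeasure n := by
  have hG : Measurable fun z : Fin (n + 1) → ℝ =>
      (truncatedCone n).indicator (fun z => F (coneProj z)) z :=
    (hF.comp (measurable_coneProj n)).indicator (measurableSet_truncatedCone n)
  have hgr := hF.comp (continuous_graph n).measurable
  rw [← lintegral_indicator (measurableSet_truncatedCone n), lintegral_fin_succ _ hG]
  simp only [lintegral_cone_section]
  rw [lintegral_lintegral_swap, lintegral_hypMeasure_eq_graph F hF,
    ← lintegral_mul_const _ (by fun_prop)]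
  · refine setLIntegral_congr_fun measurableSet_Ioo fun l hl => ?_
    have hm : Measurable fun u : EuclideanSpace ℝ (Fin n) =>
        ENNReal.ofReal (√(1 + ‖u‖ ^ 2))⁻¹ * F (graph u) :=
      Measurable.mul (by fun_prop) hgr
    have := lintegral_comp_inv_smul (volume : Measure (EuclideanSpace ℝ (Fin n))) hl.1 _ hm
    rw [finrank_euclideanSpace_fin] at this
    rw [← this]
    refine lintegral_congr fun u => ?_
    congr 2
    have hl0 := hl.1
    simp only [norm_smul, mul_pow, Real.norm_eq_abs, sq_abs]
    have h1 : l ^ 2 + ‖u‖ ^ 2 = l ^ 2 * (1 + l⁻¹ ^ 2 * ‖u‖ ^ 2) := by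
      field_simp
    rw [h1, Real.sqrt_mul (sq_nonneg _), Real.sqrt_sq hl0.le]
    field_simp
  · refine (Measurable.mul (by fun_prop) (hgr.comp ?_)).aemeasurable
    fun_prop

/-- The measure on `ℍⁿ` is invariant. -/
theorem lintegral_hypMeasure_smul {n : ℕ} [NeZero n] (g : SO0 n) (F : HypSpace n → ℝ≥0∞)
    (hF : Measurable F) : ∫⁻ x, F (g • x) ∂hypMeasure n = ∫⁻ x, F x ∂hypMeasure n := by
  have h := lintegral_truncatedCone_smul g F hF
  rw [lintegral_truncatedCone F hF, lintegral_truncatedCone (fun x => F (g • x))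
    (hF.comp (continuous_smul_left g).measurable)] at h
  -- The radial factor ∫₀¹ lⁿ dl is nonzero and finite, so it cancels.
  refine (ENNReal.mul_right_inj ?_ ?_).mp h
  · rw [Ne, lintegral_eq_zero_iff (by fun_prop)]
    intro h0
    have h1 : ∀ᵐ l : ℝ ∂volume.restrict (Ioo 0 1), False := by
      filter_upwards [h0, ae_restrict_mem measurableSet_Ioo] with l hl hl'
      have := pow_pos hl'.1 n
      simp only [Pi.zero_apply, ENNReal.ofReal_eq_zero] at hl
      linarith
    rw [ae_iff] at h1
    simp at h1
  · refine ne_top_of_le_ne_top (b := ∫⁻ _ in Ioo (0 : ℝ) 1, 1) (by simp) ?_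
    refine setLIntegral_mono measurable_const fun l hl => ?_
    rw [ENNReal.ofReal_le_one]
    exact pow_le_one₀ hl.1.le hl.2.le

/-! ### The Haar measure of the rotation group -/

instance instIsHaarMeasureRotHaar (n : ℕ) : (rotHaar n).IsHaarMeasure := by
  unfold rotHaar; infer_instance

instance instIsProbabilityMeasureRotHaar (n : ℕ) : IsProbabilityMeasure (rotHaar n) :=
  ⟨by
    have := Measure.haarMeasure_self (K₀ := (⊤ : TopologicalSpace.PositiveCompacts (Rot n)))
    simpa [rotHaar] using this⟩

/-- A right translate of Haar measure is a Haar measure of total mass 1, and such a measure is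
unique. -/
instance instIsMulRightInvariantRotHaar (n : ℕ) : (rotHaar n).IsMulRightInvariant where
  map_mul_right_eq_self k := by
    have : IsProbabilityMeasure (Measure.map (· * k) (rotHaar n)) :=
      Measure.isProbabilityMeasure_map (by fun_prop)
    have : (Measure.map (· * k) (rotHaar n)).IsHaarMeasure := inferInstance
    exact Measure.isHaarMeasure_eq_of_isProbabilityMeasure _ _

/-! ### Spherical means -/

/-- The point `g k aₜ x₀`, `cosh t = v`, of the sphere of radius `t` centred at `g x₀`. -/
noncomputable def spherePoint {n : ℕ} [NeZero n] (g : SO0 n) (p : Rot n × ℝ) : HypSpace n :=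
  g • rot p.1 • (boost (Real.arcosh p.2) : SO0 n) • origin n

theorem measurable_arcosh : Measurable Real.arcosh := by
  unfold Real.arcosh; fun_prop

theorem spherePoint_eq {n : ℕ} [NeZero n] (g : SO0 n) : spherePoint g =
    (fun x : HypSpace n => g • x) ∘ (fun q : Rot n × HypSpace n => rot q.1 • q.2) ∘
      fun p : Rot n × ℝ => (p.1, polar (lastVec n, Real.arcosh p.2)) := by
  funext p
  simp only [spherePoint, Function.comp_apply, boost_smul_origin]

theorem measurable_spherePoint {n : ℕ} [NeZero n] (g : SO0 n) : Measurable (spherePoint g) := by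
  have h : Measurable fun p : Rot n × ℝ => (p.1, polar (lastVec n, Real.arcosh p.2)) :=
    measurable_fst.prodMk ((continuous_polar n).measurable.comp
      (measurable_const.prodMk (measurable_arcosh.comp measurable_snd)))
  rw [spherePoint_eq]
  exact (continuous_smul_left g).measurable.comp
    ((continuous_smul_rot_smul (n := n)).measurable.comp h)

theorem continuousOn_spherePoint {n : ℕ} [NeZero n] (g : SO0 n) :
    ContinuousOn (spherePoint g) (univ ×ˢ Ici 1) := by
  have h : ContinuousOn (fun p : Rot n × ℝ => (p.1, polar (lastVec n, Real.arcosh p.2)))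
      (univ ×ˢ Ici 1) :=
    continuousOn_fst.prodMk ((continuous_polar n).comp_continuousOn
      (continuousOn_const.prodMk
        (Real.continuousOn_arcosh.comp continuousOn_snd fun p hp => hp.2)))
  rw [spherePoint_eq]
  exact (continuous_smul_left g).comp_continuousOn
    ((continuous_smul_rot_smul (n := n)).comp_continuousOn h)

theorem form_spherePoint {n : ℕ} [NeZero n] (g : SO0 n) (k : Rot n) {v : ℝ} (hv : 1 ≤ v) :
    form (g • origin n).1 (spherePoint g (k, v)).1 = v := by
  rw [spherePoint, form_smul_smul, form_origin_left, height_rot_smul, boost_smul_origin,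
    height_polar, Real.cosh_arcosh hv]

/-- Writing y = k₀ a_t x₀, the rotation k₀ is absorbed by right invariance. The average over K
therefore depends on y through its height alone. -/
theorem lintegral_rot_smul {n : ℕ} [NeZero n] (hn : 2 ≤ n) (g : SO0 n) (F : HypSpace n → ℝ≥0∞)
    (y : HypSpace n) : ∫⁻ k, F (g • rot k • y) ∂rotHaar n
      = ∫⁻ k, F (spherePoint g (k, height y)) ∂rotHaar n := by
  obtain ⟨k₀, hk₀⟩ := exists_eq_rot_smul_boost hn y
  rw [← lintegral_mul_right_eq_self (μ := rotHaar n)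
    (fun k => F (spherePoint g (k, height y))) k₀]
  refine lintegral_congr fun k => ?_
  simp only [spherePoint, rot_mul, mul_smul]
  rw [← hk₀]

/-- The surface measure of a set is defined by the volume of the solid cone over it, and a linear
isometry preserves that volume. -/
theorem measurePreserving_rotSphere {n : ℕ} (k : Rot n) :
    MeasurePreserving (rotSphere k) (volume : Measure (EuclideanSpace ℝ (Fin n))).toSphere
      (volume : Measure (EuclideanSpace ℝ (Fin n))).toSphere := by
  have hm : Measurable (rotSphere k) :=
    (((rotIsometry k).continuous.comp continuous_subtype_val).subtype_mk _).measurable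
  refine ⟨hm, Measure.ext fun s hs => ?_⟩
  rw [Measure.map_apply hm hs, Measure.toSphere_apply' _ (hm hs), Measure.toSphere_apply' _ hs]
  congr 1
  have himage : Ioo (0 : ℝ) 1 • ((↑) '' (rotSphere k ⁻¹' s) : Set (EuclideanSpace ℝ (Fin n)))
      = rotIsometry k ⁻¹' (Ioo (0 : ℝ) 1 • ((↑) '' s)) := by
    ext x
    simp only [Set.mem_smul, mem_image, mem_preimage]
    constructor
    · rintro ⟨c, hc, -, ⟨θ, hθ, rfl⟩, rfl⟩
      exact ⟨c, hc, _, ⟨_, hθ, rfl⟩, by simp [rotSphere]⟩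
    · rintro ⟨c, hc, -, ⟨θ, hθ, rfl⟩, h⟩
      refine ⟨c, hc, _, ⟨⟨(rotIsometry k).symm θ.1, by simp⟩, ?_, rfl⟩, ?_⟩
      · convert hθ
        exact Subtype.ext (by simp [rotSphere])
      · rw [← map_smul, h, LinearIsometryEquiv.symm_apply_apply]
  rw [himage]
  exact (rotIsometry k).measurePreserving.measure_preimage_equiv
    (f := (rotIsometry k).toHomeomorph.toMeasurableEquiv) _

/-- Rotating θ by k changes nothing, so one may average over k; after the integrals are exchanged,
the inner one no longer depends on θ. -/
theorem lintegral_sphere_polar {n : ℕ} [NeZero n] (hn : 2 ≤ n) {t : ℝ}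
    (F : HypSpace n → ℝ≥0∞) (hF : Measurable F) :
    ∫⁻ θ, F (polar (θ, t)) ∂(volume : Measure (EuclideanSpace ℝ (Fin n))).toSphere
      = (volume : Measure (EuclideanSpace ℝ (Fin n))).toSphere univ
        * ∫⁻ k, F (spherePoint 1 (k, Real.cosh t)) ∂rotHaar n := by
  have hm : Measurable fun p : Rot n × Metric.sphere (0 : EuclideanSpace ℝ (Fin n)) 1 =>
      F (rot p.1 • polar (p.2, t)) := by
    have h : Measurable fun p : Rot n × Metric.sphere (0 : EuclideanSpace ℝ (Fin n)) 1 =>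
        (p.1, polar (p.2, t)) :=
      measurable_fst.prodMk ((continuous_polar n).measurable.comp (by fun_prop))
    have h2 := hF.comp ((continuous_smul_rot_smul (n := n)).measurable.comp h)
    simpa only [Function.comp_def] using h2
  have hpol : Measurable fun θ => F (polar (n := n) (θ, t)) := by
    have h2 : Measurable fun θ : Metric.sphere (0 : EuclideanSpace ℝ (Fin n)) 1 => (θ, t) := by
      fun_prop
    exact (hF.comp (continuous_polar n).measurable).comp h2
  calc ∫⁻ θ, F (polar (θ, t)) ∂(volume : Measure (EuclideanSpace ℝ (Fin n))).toSphere
      = ∫⁻ _k, ∫⁻ θ, F (polar (θ, t)) ∂(volume : Measure (EuclideanSpace ℝ (Fin n))).toSphere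
          ∂rotHaar n := by simp
    _ = ∫⁻ k, ∫⁻ θ, F (rot k • polar (θ, t))
          ∂(volume : Measure (EuclideanSpace ℝ (Fin n))).toSphere ∂rotHaar n := by
        refine lintegral_congr fun k => ?_
        rw [← (measurePreserving_rotSphere k).lintegral_comp hpol]
        exact lintegral_congr fun θ => by rw [rot_smul_polar]
    _ = ∫⁻ θ, ∫⁻ k, F (rot k • polar (θ, t)) ∂rotHaar n
          ∂(volume : Measure (EuclideanSpace ℝ (Fin n))).toSphere :=
        lintegral_lintegral_swap hm.aemeasurable
    _ = _ := by
        have h : ∀ θ, ∫⁻ k, F (rot k • polar (θ, t)) ∂rotHaar n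
            = ∫⁻ k, F (spherePoint 1 (k, Real.cosh t)) ∂rotHaar n := fun θ => by
          have := lintegral_rot_smul hn 1 F (polar (θ, t))
          rw [height_polar] at this
          simpa using this
        simp only [h, lintegral_const, mul_comm]

/-- The density of the invariant measure in the coordinate `v = cosh r`. -/
noncomputable def hypWeight (n : ℕ) (v : ℝ) : ℝ :=
  (volume : Measure (EuclideanSpace ℝ (Fin n))).toSphere.real univ
    * (v ^ 2 - 1) ^ (((n : ℝ) - 2) / 2)

theorem measurable_hypWeight (n : ℕ) : Measurable (hypWeight n) := by
  unfold hypWeight; fun_prop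

theorem hypWeight_pos {n : ℕ} [NeZero n] {v : ℝ} (hv : 1 < v) : 0 < hypWeight n v := by
  have h1 : 0 < (volume : Measure (EuclideanSpace ℝ (Fin n))).toSphere.real univ :=
    ENNReal.toReal_pos (by
      have := Measure.toSphere_ne_zero (volume : Measure (EuclideanSpace ℝ (Fin n)))
      rwa [Ne, Measure.measure_univ_eq_zero]) (measure_ne_top _ _)
  have h2 : 0 < v ^ 2 - 1 := by nlinarith
  unfold hypWeight
  positivity

theorem cosh_image_Ioi {t : ℝ} (ht : 0 ≤ t) : Real.cosh '' Ioi t = Ioi (Real.cosh t) := by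
  ext x
  constructor
  · rintro ⟨s, hs, rfl⟩
    exact Real.cosh_strictMonoOn (mem_Ici.mpr ht) (mem_Ici.mpr (ht.trans (le_of_lt hs))) hs
  · intro hx
    have h1 : 1 ≤ x := (Real.one_le_cosh t).trans (le_of_lt hx)
    refine ⟨Real.arcosh x, ?_, Real.cosh_arcosh h1⟩
    rw [← Real.cosh_arcosh h1] at hx
    have := Real.cosh_lt_cosh.mp hx
    rwa [abs_of_nonneg ht, abs_of_nonneg (Real.arcosh_nonneg h1)] at this

/-- Invariance moves the centre to the origin; then v = cosh t turns sinhⁿ⁻¹ t dt into (v² -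
1)^{(n-2)/2} dv. -/
theorem lintegral_spherePoint {n : ℕ} [NeZero n] (hn : 2 ≤ n) (g : SO0 n)
    (F : HypSpace n → ℝ≥0∞) (hF : Measurable F) :
    ∫⁻ x, F x ∂hypMeasure n = ∫⁻ v in Ioi (1 : ℝ), ENNReal.ofReal (hypWeight n v)
      * ∫⁻ k, F (spherePoint g (k, v)) ∂rotHaar n := by
  have hFg : Measurable fun x => F (g • x) := hF.comp (continuous_smul_left g).measurable
  rw [← lintegral_hypMeasure_smul g F hF, lintegral_hypMeasure _ hFg, lintegral_lintegral_swap]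
  · conv_rhs => rw [← Real.cosh_zero, ← cosh_image_Ioi le_rfl,
      lintegral_image_eq_lintegral_abs_deriv_mul measurableSet_Ioi
      (fun x _ => (Real.hasDerivAt_cosh x).hasDerivWithinAt)
      (Real.cosh_strictMonoOn.injOn.mono Ioi_subset_Ici_self)]
    refine setLIntegral_congr_fun measurableSet_Ioi fun t ht => ?_
    have hs : 0 < Real.sinh t := Real.sinh_pos_iff.mpr ht
    have hpol : Measurable fun θ => F (g • polar (n := n) (θ, t)) :=
      hFg.comp ((continuous_polar n).measurable.comp (by fun_prop))
    rw [lintegral_const_mul _ hpol, lintegral_sphere_polar hn _ hFg]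
    have h1 : ∀ k, g • spherePoint (1 : SO0 n) (k, Real.cosh t)
        = spherePoint g (k, Real.cosh t) := fun k => by simp [spherePoint]
    simp only [h1]
    rw [← mul_assoc, ← mul_assoc, ← ENNReal.ofReal_toReal (measure_ne_top
        (volume : Measure (EuclideanSpace ℝ (Fin n))).toSphere univ),
      ← ENNReal.ofReal_mul (by positivity), ← ENNReal.ofReal_mul (abs_nonneg _)]
    congr 2
    have h2 : Real.cosh t ^ 2 - 1 = Real.sinh t ^ 2 := by rw [Real.cosh_sq]; ring
    have h3 : (Real.sinh t ^ 2) ^ (((n : ℝ) - 2) / 2) = Real.sinh t ^ (n - 2) := by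
      rw [← Real.rpow_natCast, ← Real.rpow_mul hs.le, ← Real.rpow_natCast]
      congr 1
      push_cast [hn]
      ring
    rw [hypWeight, h2, h3, abs_of_pos hs, Measure.real]
    obtain ⟨m, rfl⟩ := Nat.exists_eq_add_of_le hn
    have e1 : 2 + m - 1 = m + 1 := by omega
    have e2 : 2 + m - 2 = m := by omega
    rw [e1, e2, pow_succ]
    ring
  · refine (Measurable.mul (by fun_prop) (hFg.comp (continuous_polar n).measurable)).aemeasurable

/-! ### Means over horospheres -/

/-- The point `g k aₜ n_w x₀` of the horosphere `g k aₜ ξ₀`. -/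
noncomputable def horoPoint {n d : ℕ} [NeZero n] (g : SO0 n) (t : ℝ)
    (p : Rot n × EuclideanSpace ℝ (Fin d)) : HypSpace n :=
  g • rot p.1 • (boost t : SO0 n) • (unip (tail n p.2) : SO0 n) • origin n

theorem continuous_unip_smul_origin {n d : ℕ} [NeZero n] :
    Continuous fun w : EuclideanSpace ℝ (Fin d) => (unip (tail n w) : SO0 n) • origin n := by
  have htail : Continuous fun w : EuclideanSpace ℝ (Fin d) => tail n w := by
    refine continuous_pi fun i => ?_
    unfold tail
    split_ifs
    · fun_prop
    · exact continuous_const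
  have hincl : Continuous fun w : EuclideanSpace ℝ (Fin d) => incl (tail n w) := by
    refine continuous_pi fun i => ?_
    unfold incl
    split_ifs with h
    · exact (continuous_apply (⟨i, h⟩ : Fin (n - 1))).comp htail
    · exact continuous_const
  refine continuous_induced_rng.mpr ?_
  refine Continuous.congr ?_ fun w => (unip_origin w).symm
  refine (continuous_const.add hincl).add (Continuous.smul (f := fun w : EuclideanSpace ℝ (Fin d) =>
    (tail n w ⬝ᵥ tail n w) / 2) ?_ continuous_const)
  exact (Continuous.dotProduct htail htail).div_const _

theorem continuous_horoPoint {n d : ℕ} [NeZero n] (g : SO0 n) (t : ℝ) :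
    Continuous (horoPoint (d := d) g t) := by
  have h : Continuous fun p : Rot n × EuclideanSpace ℝ (Fin d) =>
      (p.1, (boost t : SO0 n) • (unip (tail n p.2) : SO0 n) • origin n) :=
    continuous_fst.prodMk ((continuous_smul_left _).comp
      (continuous_unip_smul_origin.comp continuous_snd))
  exact (continuous_smul_left g).comp ((continuous_smul_rot_smul (n := n)).comp h)

theorem toSphere_univ {d : ℕ} (hd : 1 ≤ d) :
    (volume : Measure (EuclideanSpace ℝ (Fin d))).toSphere univ
      = ENNReal.ofReal (sphereArea d) := by
  have hd0 : (0 : ℝ) < d := by exact_mod_cast hd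
  have hg := Real.Gamma_pos_of_pos (half_pos hd0)
  have : Nonempty (Fin d) := ⟨⟨0, hd⟩⟩
  rw [Measure.toSphere_apply_univ, EuclideanSpace.volume_ball, finrank_euclideanSpace_fin,
    ENNReal.ofReal_one, one_pow, one_mul, ← ENNReal.ofReal_natCast, ← ENNReal.ofReal_mul hd0.le,
    Fintype.card_fin, Real.Gamma_add_one (half_pos hd0).ne', sphereArea, Real.sqrt_eq_rpow,
    ← Real.rpow_natCast, ← Real.rpow_mul Real.pi_pos.le]
  congr 1
  rw [one_div_mul_eq_div]
  field_simp

theorem sphereArea_pos {d : ℕ} (hd : 1 ≤ d) : 0 < sphereArea d := by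
  have hd0 : (0 : ℝ) < d := by exact_mod_cast hd
  have hg := Real.Gamma_pos_of_pos (half_pos hd0)
  have := Real.pi_pos
  unfold sphereArea
  positivity

theorem lintegral_comp_norm {d : ℕ} (hd : 1 ≤ d) (G : ℝ → ℝ≥0∞) (hG : Measurable G) :
    ∫⁻ w : EuclideanSpace ℝ (Fin d), G ‖w‖
      = ∫⁻ ρ in Ioi (0 : ℝ), ENNReal.ofReal (sphereArea d * ρ ^ (d - 1)) * G ρ := by
  have : Nonempty (Fin d) := ⟨⟨0, hd⟩⟩
  rw [lintegral_polar volume (fun w => G ‖w‖) (hG.comp measurable_norm)]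
  have h : ∀ θ : Metric.sphere (0 : EuclideanSpace ℝ (Fin d)) 1, ∫⁻ ρ in Ioi (0 : ℝ),
      ENNReal.ofReal (ρ ^ (Module.finrank ℝ (EuclideanSpace ℝ (Fin d)) - 1)) * G ‖ρ • θ.1‖
      = ∫⁻ ρ in Ioi (0 : ℝ), ENNReal.ofReal (ρ ^ (d - 1)) * G ρ := fun θ => by
    refine setLIntegral_congr_fun measurableSet_Ioi fun ρ hρ => ?_
    rw [finrank_euclideanSpace_fin, norm_smul, mem_sphere_zero_iff_norm.mp θ.2, mul_one,
      Real.norm_of_nonneg (le_of_lt hρ)]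
  simp only [h, lintegral_const]
  rw [toSphere_univ hd, mul_comm, ← lintegral_const_mul _ (by fun_prop)]
  refine lintegral_congr fun ρ => ?_
  rw [ENNReal.ofReal_mul (sphereArea_pos hd).le, mul_assoc]

/-- The density of the mean over horospheres at distance `t` in the coordinate `v = cosh r`. -/
noncomputable def horoDensity (d : ℕ) (t v : ℝ) : ℝ :=
  meanConst d * Real.exp (-(t * d / 2)) * ((Real.Gamma (d / 2))⁻¹
    * (v - Real.cosh t) ^ ((d : ℝ) / 2 - 1))

theorem measurable_horoDensity (d : ℕ) (t : ℝ) : Measurable (horoDensity d t) := by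
  unfold horoDensity; fun_prop

theorem meanConst_pos {d : ℕ} (hd : 1 ≤ d) : 0 < meanConst d := by
  have hd0 : (0 : ℝ) < d := by exact_mod_cast hd
  have hg := Real.Gamma_pos_of_pos (half_pos hd0)
  have := sphereArea_pos hd
  unfold meanConst
  positivity

/-- The Jacobian identity for v = cosh t + eᵗρ²/2, dv = eᵗρ dρ. It accounts for the constant
`meanConst` and the exponential e^{-td/2}: with them the density in v pulls back exactly to the
radial density of ℝᵈ. -/
theorem horoDensity_comp {d : ℕ} (hd : 1 ≤ d) (t : ℝ) {ρ : ℝ} (hρ : 0 < ρ) :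
    Real.exp t * ρ * horoDensity d t (Real.cosh t + Real.exp t * ρ ^ 2 / 2)
      = sphereArea d * ρ ^ (d - 1) := by
  have hd0 : (0 : ℝ) < d := by exact_mod_cast hd
  have hg := Real.Gamma_pos_of_pos (half_pos hd0)
  have e1 : (Real.exp t * ρ ^ 2 / 2) ^ ((d : ℝ) / 2 - 1)
      = Real.exp (t * (d / 2 - 1)) * (ρ ^ (d - 1) / ρ) / 2 ^ ((d : ℝ) / 2 - 1) := by
    rw [Real.div_rpow (by positivity) two_pos.le, Real.mul_rpow (Real.exp_pos t).le (by positivity),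
      ← Real.exp_mul, ← Real.rpow_natCast ρ 2, ← Real.rpow_mul hρ.le, ← Real.rpow_natCast ρ (d - 1),
      ← Real.rpow_sub_one hρ.ne']
    congr 3
    push_cast [hd]
    ring
  rw [horoDensity, add_sub_cancel_left, e1, meanConst]
  have e2 : Real.exp t * Real.exp (-(t * d / 2)) * Real.exp (t * (d / 2 - 1)) = 1 := by
    rw [← Real.exp_add, ← Real.exp_add, Real.exp_eq_one_iff]
    ring
  have h2 : (0 : ℝ) < 2 ^ ((d : ℝ) / 2 - 1) := by positivity
  calc _ = (Real.exp t * Real.exp (-(t * d / 2)) * Real.exp (t * (d / 2 - 1)))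
          * (sphereArea d * ρ ^ (d - 1)) := by field_simp
    _ = _ := by rw [e2, one_mul]

/-- For fixed w the average over K is a spherical mean at the level v = cosh t + eᵗ|w|²/2. What
remains is a radial integral over ℝᵈ, rewritten in the variable v. -/
theorem lintegral_horoPoint {n d : ℕ} [NeZero n] (hd : 1 ≤ d) (hdn : d ≤ n - 1) (g : SO0 n) (t : ℝ)
    (F : HypSpace n → ℝ≥0∞) (hF : Measurable F) :
    ∫⁻ k, ∫⁻ w : EuclideanSpace ℝ (Fin d), F (horoPoint g t (k, w)) ∂volume ∂rotHaar n
      = ∫⁻ v in Ioi (Real.cosh t), ENNReal.ofReal (horoDensity d t v)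
        * ∫⁻ k, F (spherePoint g (k, v)) ∂rotHaar n := by
  have hm : Measurable fun p : Rot n × EuclideanSpace ℝ (Fin d) => F (horoPoint g t p) :=
    hF.comp (continuous_horoPoint g t).measurable
  have hA : Measurable fun v => ∫⁻ k, F (spherePoint g (k, v)) ∂rotHaar n :=
    (hF.comp (measurable_spherePoint g)).lintegral_prod_left'
  rw [lintegral_lintegral_swap hm.aemeasurable]
  have h1 : ∀ w : EuclideanSpace ℝ (Fin d), ∫⁻ k, F (horoPoint g t (k, w)) ∂rotHaar n
      = ∫⁻ k, F (spherePoint g (k, Real.cosh t + Real.exp t * ‖w‖ ^ 2 / 2)) ∂rotHaar n :=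
        fun w => by
    have h2 := lintegral_rot_smul (by omega) g F
      ((boost t : SO0 n) • (unip (tail n w) : SO0 n) • origin n)
    rwa [height_boost_smul_unip hdn] at h2
  simp only [h1]
  rw [lintegral_comp_norm hd (fun ρ => ∫⁻ k, F (spherePoint g
    (k, Real.cosh t + Real.exp t * ρ ^ 2 / 2)) ∂rotHaar n) (hA.comp (by fun_prop))]
  have himage : (fun ρ : ℝ => Real.cosh t + Real.exp t * ρ ^ 2 / 2) '' Ioi 0
      = Ioi (Real.cosh t) := by
    have he := Real.exp_pos t
    ext v
    simp only [mem_image, mem_Ioi]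
    constructor
    · rintro ⟨ρ, hρ, rfl⟩
      have : 0 < Real.exp t * ρ ^ 2 / 2 := by positivity
      linarith
    · intro hv
      have hpos : 0 < 2 * (v - Real.cosh t) / Real.exp t :=
        div_pos (by linarith) he
      refine ⟨√(2 * (v - Real.cosh t) / Real.exp t), Real.sqrt_pos.mpr hpos, ?_⟩
      rw [Real.sq_sqrt hpos.le]
      field_simp
      ring
  have hder : ∀ ρ ∈ Ioi (0 : ℝ), HasDerivWithinAt
      (fun ρ : ℝ => Real.cosh t + Real.exp t * ρ ^ 2 / 2) (Real.exp t * ρ) (Ioi 0) ρ := by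
    intro ρ _
    have := ((((hasDerivAt_id ρ).pow 2).const_mul (Real.exp t)).div_const 2).const_add
      (Real.cosh t)
    refine HasDerivAt.hasDerivWithinAt (this.congr_deriv ?_)
    simp
    ring
  have hinj : InjOn (fun ρ : ℝ => Real.cosh t + Real.exp t * ρ ^ 2 / 2) (Ioi 0) := by
    intro x hx y hy hxy
    have he := Real.exp_pos t
    simp only at hxy
    have h2 : Real.exp t * (x ^ 2 - y ^ 2) = 0 := by linarith
    have h3 : x ^ 2 = y ^ 2 := by
      rcases mul_eq_zero.mp h2 with h | h
      · exact absurd h he.ne'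
      · linarith
    exact (sq_eq_sq₀ (le_of_lt hx) (le_of_lt hy)).mp h3
  rw [← himage, lintegral_image_eq_lintegral_abs_deriv_mul measurableSet_Ioi hder hinj]
  refine setLIntegral_congr_fun measurableSet_Ioi fun ρ hρ => ?_
  have hρ' : (0 : ℝ) < ρ := hρ
  rw [← mul_assoc, abs_of_pos (by positivity), ← ENNReal.ofReal_mul (by positivity),
    horoDensity_comp hd t hρ']

/-- The distribution of `g k aₜ n_w x₀`. -/
theorem map_horoPoint {n d : ℕ} [NeZero n] (hd : 1 ≤ d) (hdn : d ≤ n - 1) (g : SO0 n) (t : ℝ) :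
    Measure.map (horoPoint (d := d) g t) ((rotHaar n).prod volume)
      = Measure.map (spherePoint g) ((rotHaar n).prod
        ((volume.restrict (Ioi (Real.cosh t))).withDensity
          fun v => ENNReal.ofReal (horoDensity d t v))) := by
  refine Measure.ext_of_lintegral _ fun F hF => ?_
  have hmS := hF.comp (measurable_spherePoint g)
  have hmH := hF.comp (continuous_horoPoint (d := d) g t).measurable
  have hA : Measurable fun v => ∫⁻ k, F (spherePoint g (k, v)) ∂rotHaar n :=
    hmS.lintegral_prod_left'
  rw [lintegral_map hF (continuous_horoPoint g t).measurable,
    lintegral_map hF (measurable_spherePoint g)]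
  refine (lintegral_prod _ hmH.aemeasurable).trans ?_
  refine (lintegral_horoPoint hd hdn g t F hF).trans ?_
  refine Eq.trans ?_ (lintegral_prod_symm _ hmS.aemeasurable).symm
  exact (lintegral_withDensity_eq_lintegral_mul _ (measurable_horoDensity d t).ennreal_ofReal
    hA).symm

/-- The invariant measure in polar coordinates centred at `g x₀`. -/
theorem map_spherePoint {n : ℕ} [NeZero n] (hn : 2 ≤ n) (g : SO0 n) :
    Measure.map (spherePoint g) ((rotHaar n).prod ((volume.restrict (Ioi 1)).withDensity
      fun v => ENNReal.ofReal (hypWeight n v))) = hypMeasure n := by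
  refine Measure.ext_of_lintegral _ fun F hF => ?_
  have hmS := hF.comp (measurable_spherePoint g)
  have hA : Measurable fun v => ∫⁻ k, F (spherePoint g (k, v)) ∂rotHaar n :=
    hmS.lintegral_prod_left'
  rw [lintegral_map hF (measurable_spherePoint g), lintegral_spherePoint hn g F hF]
  refine (lintegral_prod_symm _ hmS.aemeasurable).trans ?_
  exact lintegral_withDensity_eq_lintegral_mul _ (measurable_hypWeight n).ennreal_ofReal hA

theorem restrict_absolutelyContinuous_hypWeight {n : ℕ} [NeZero n] :
    volume.restrict (Ioi (1 : ℝ)) ≪ (volume.restrict (Ioi 1)).withDensity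
      fun v => ENNReal.ofReal (hypWeight n v) := by
  refine withDensity_absolutelyContinuous' (measurable_hypWeight n).ennreal_ofReal.aemeasurable ?_
  filter_upwards [ae_restrict_mem measurableSet_Ioi] with v hv
  simpa using hypWeight_pos hv

/-- This makes composition with `spherePoint` meaningful for functions known only almost everywhere:
the weight is positive on (1, ∞), so Lebesgue-null sets of radii are null for `hypMeasure` too. -/
theorem map_spherePoint_absolutelyContinuous {n : ℕ} [NeZero n] (hn : 2 ≤ n) (g : SO0 n)
    {ν : Measure ℝ} [SFinite ν] (hν : ν ≪ volume.restrict (Ioi 1)) :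
    Measure.map (spherePoint g) ((rotHaar n).prod ν) ≪ hypMeasure n := by
  rw [← map_spherePoint hn g]
  refine Measure.AbsolutelyContinuous.map ?_ (measurable_spherePoint g)
  exact Measure.AbsolutelyContinuous.rfl.prod
    (hν.trans restrict_absolutelyContinuous_hypWeight)

theorem withDensity_restrict_absolutelyContinuous {r : ℝ} (hr : 1 ≤ r) (ρ : ℝ → ℝ≥0∞) :
    (volume.restrict (Ioi r)).withDensity ρ ≪ volume.restrict (Ioi (1 : ℝ)) :=
  (withDensity_absolutelyContinuous _ _).trans
    (Measure.restrict_mono (Ioi_subset_Ioi hr) le_rfl).absolutelyContinuous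

theorem aestronglyMeasurable_comp_spherePoint {n : ℕ} [NeZero n] (hn : 2 ≤ n) (g : SO0 n)
    {f : HypSpace n → ℂ} (hf : AEStronglyMeasurable f (hypMeasure n)) :
    AEStronglyMeasurable (fun p => f (spherePoint g p))
      ((rotHaar n).prod (volume.restrict (Ioi 1))) :=
  (hf.mono_ac (map_spherePoint_absolutelyContinuous hn g
    Measure.AbsolutelyContinuous.rfl)).comp_measurable (measurable_spherePoint g)

/-! ### Primitives on a half-line -/

/-- The primitive `s ↦ ∫ₛ^∞ h`. -/
noncomputable def tailPrim (h : ℝ → ℂ) (s : ℝ) : ℂ := ∫ v in Ioi s, h v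

theorem tailPrim_eq_sub {h : ℝ → ℂ} {a s : ℝ} (ha : IntegrableOn h (Ioi a)) (has : a ≤ s) :
    tailPrim h s = tailPrim h a - ∫ v in a..s, h v := by
  rw [tailPrim, tailPrim, ← intervalIntegral.integral_Ioi_sub_Ioi ha has]
  ring

theorem hasDerivAt_tailPrim_of_interval {h : ℝ → ℂ} {a s : ℝ} (ha : IntegrableOn h (Ioi a))
    (has : a < s) {c : ℂ} (hd : HasDerivAt (fun x => ∫ v in a..x, h v) c s) :
    HasDerivAt (tailPrim h) (-c) s := by
  refine (hd.const_sub (tailPrim h a)).congr_of_eventuallyEq ?_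
  filter_upwards [Ioi_mem_nhds has] with x hx
  exact tailPrim_eq_sub ha (le_of_lt hx)

theorem continuousOn_tailPrim {h : ℝ → ℂ} (hh : ∀ s > 1, IntegrableOn h (Ioi s)) :
    ContinuousOn (tailPrim h) (Ioi 1) := by
  intro s hs
  obtain ⟨a, ha1, has⟩ := exists_between (show (1 : ℝ) < s from hs)
  have hint : IntegrableOn h (Icc a (s + 1)) :=
    ((hh ((1 + a) / 2) (by linarith)).mono_set
      (fun x hx => show (1 + a) / 2 < x by linarith [hx.1]))
  have h1 := intervalIntegral.continuousOn_primitive_interval (a := a) (b := s + 1)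
    (by rwa [uIcc_of_le (by linarith)])
  rw [uIcc_of_le (by linarith)] at h1
  have h2 := h1.continuousAt (Icc_mem_nhds has (by linarith : s < s + 1))
  refine ContinuousAt.continuousWithinAt ?_
  refine (continuousAt_const.sub h2 : ContinuousAt
    (fun x => tailPrim h a - ∫ v in a..x, h v) s).congr ?_
  filter_upwards [Ioi_mem_nhds has] with x hx
  exact (tailPrim_eq_sub (hh a ha1) (le_of_lt hx)).symm

theorem hasDerivAt_tailPrim_of_continuousOn {h : ℝ → ℂ} (hh : ∀ s > 1, IntegrableOn h (Ioi s))
    (hc : ContinuousOn h (Ioi 1)) {s : ℝ} (hs : 1 < s) :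
    HasDerivAt (tailPrim h) (-h s) s := by
  obtain ⟨a, ha1, has⟩ := exists_between hs
  refine hasDerivAt_tailPrim_of_interval (hh a ha1) has ?_
  refine intervalIntegral.integral_hasDerivAt_right ?_ ?_
    (hc.continuousAt (Ioi_mem_nhds hs))
  · rw [intervalIntegrable_iff_integrableOn_Ioc_of_le has.le]
    exact (hh a ha1).mono_set Ioc_subset_Ioi_self
  · exact ContinuousOn.stronglyMeasurableAtFilter isOpen_Ioi hc s hs

theorem ae_hasDerivAt_tailPrim {h : ℝ → ℂ} (hh : ∀ s > 1, IntegrableOn h (Ioi s)) :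
    ∀ᵐ s ∂volume.restrict (Ioi (1 : ℝ)), HasDerivAt (tailPrim h) (-h s) s := by
  -- Integrability is known only away from 1. Lebesgue's differentiation theorem is applied to h cut
  -- off at each of these countably many levels, which decrease to 1.
  have hk : ∀ k : ℕ, ∀ᵐ s : ℝ, 1 + 1 / ((k : ℝ) + 1) < s →
      HasDerivAt (tailPrim h) (-h s) s := fun k => by
    set a : ℝ := 1 + 1 / ((k : ℝ) + 1) with ha
    have ha1 : 1 < a := by rw [ha]; have : (0 : ℝ) < 1 / ((k : ℝ) + 1) := by positivity
                           linarith
    have hloc : LocallyIntegrable ((Ioi a).indicator h) volume :=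
      ((integrable_indicator_iff measurableSet_Ioi).mpr (hh a ha1)).locallyIntegrable
    filter_upwards [LocallyIntegrable.ae_hasDerivAt_integral hloc] with s hs has
    have h1 := hs a
    rw [indicator_of_mem (show s ∈ Ioi a from has)] at h1
    refine hasDerivAt_tailPrim_of_interval (hh a ha1) has (h1.congr_of_eventuallyEq ?_)
    filter_upwards [Ioi_mem_nhds has] with x hx
    refine intervalIntegral.integral_congr_ae (Eventually.of_forall fun v hv => ?_)
    rw [uIoc_of_le (le_of_lt hx)] at hv
    rw [indicator_of_mem (show v ∈ Ioi a from hv.1)]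
  rw [ae_restrict_iff' measurableSet_Ioi]
  filter_upwards [ae_all_iff.mpr hk] with s hs hs1
  obtain ⟨k, hk⟩ := exists_nat_one_div_lt (sub_pos.mpr (show (1 : ℝ) < s from hs1))
  exact hs k (by linarith)

/-- Iterated derivatives of iterated primitives. -/
theorem iteratedDeriv_of_tailPrim {G : ℕ → ℝ → ℂ} {k : ℕ} (hk : 1 ≤ k)
    (hG : ∀ j < k, ∀ s > 1, IntegrableOn (G j) (Ioi s))
    (hGs : ∀ j < k, ∀ s > 1, G (j + 1) s = tailPrim (G j) s) {F : ℝ → ℂ}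
    (hF : ∀ s > 1, F s = G k s) {s : ℝ} (hs : 1 < s)
    (hd : HasDerivAt (tailPrim (G 0)) (-G 0 s) s) :
    HasIterDeriv k F s ∧ iteratedDeriv k F s = (-1) ^ k * G 0 s := by
  have hev : ∀ j < k, ∀ u > 1, G (j + 1) =ᶠ[𝓝 u] tailPrim (G j) := fun j hj u hu => by
    filter_upwards [Ioi_mem_nhds hu] with x hx
    exact hGs j hj x hx
  have hcont : ∀ j < k, ContinuousOn (G (j + 1)) (Ioi 1) := fun j hj =>
    (continuousOn_tailPrim (hG j hj)).congr fun x hx => hGs j hj x hx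
  -- Every function of the chain except `G 0` is a primitive, hence continuous. All differentiations
  -- but the last are therefore classical at every point of (1, ∞), and the hypothesis on `G 0` at s
  -- is needed only at the end.
  have hderiv : ∀ j, j + 1 < k → ∀ u > 1, HasDerivAt (G (j + 2)) (-G (j + 1) u) u :=
    fun j hj u hu =>
      (hasDerivAt_tailPrim_of_continuousOn (hG (j + 1) hj) (hcont j (by omega)) hu
        ).congr_of_eventuallyEq (hev (j + 1) hj u hu)
  have hiter : ∀ i < k, ∀ u > 1, iteratedDeriv i F u = (-1) ^ i * G (k - i) u := by
    intro i
    induction i with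
    | zero => intro _ u hu; simp [hF u hu]
    | succ i ih =>
      intro hi u hu
      have h1 : iteratedDeriv i F =ᶠ[𝓝 u] fun x => (-1) ^ i * G (k - i) x := by
        filter_upwards [Ioi_mem_nhds hu] with x hx
        exact ih (by omega) x hx
      obtain ⟨j, hj⟩ : ∃ j, k - i = j + 2 := ⟨k - i - 2, by omega⟩
      rw [iteratedDeriv_succ, h1.deriv_eq, hj,
        ((hderiv j (by omega) u hu).const_mul ((-1) ^ i)).deriv,
        show k - (i + 1) = j + 1 by omega]
      ring
  have hdiff : ∀ i, i + 1 < k → ∀ u > 1, DifferentiableAt ℝ (iteratedDeriv i F) u := by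
    intro i hi u hu
    have h1 : iteratedDeriv i F =ᶠ[𝓝 u] fun x => (-1) ^ i * G (k - i) x := by
      filter_upwards [Ioi_mem_nhds hu] with x hx
      exact hiter i (by omega) x hx
    obtain ⟨j, hj⟩ : ∃ j, k - i = j + 2 := ⟨k - i - 2, by omega⟩
    rw [hj] at h1
    exact (((hderiv j (by omega) u hu).const_mul ((-1) ^ i)).congr_of_eventuallyEq
      h1).differentiableAt
  obtain ⟨l, rfl⟩ : ∃ l, k = l + 1 := ⟨k - 1, by omega⟩
  have hlast : HasDerivAt (iteratedDeriv l F) ((-1) ^ l * -G 0 s) s := by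
    refine (hd.const_mul ((-1) ^ l)).congr_of_eventuallyEq ?_
    filter_upwards [Ioi_mem_nhds hs] with x hx
    rw [hiter l (by omega) x hx, show l + 1 - l = 0 + 1 by omega, hGs 0 (by omega) x hx]
  refine ⟨⟨fun j hj => ?_, fun j hj => ?_⟩, ?_⟩
  · filter_upwards [Ioi_mem_nhds hs] with u hu
    exact hdiff j hj u hu
  · obtain rfl : j = l := by omega
    exact hlast.differentiableAt
  · rw [iteratedDeriv_succ, hlast.deriv, pow_succ]
    ring

/-! ### Compositions of integral operators on a half-line -/

/-- Tonelli's theorem for `∫ₛ^∞ ∫ᵥ^∞ κ(v, u) M(u) du dv`. -/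
theorem integral_integral_kernel {s : ℝ} {κ : ℝ → ℝ → ℝ} {q : ℝ → ℝ} {M : ℝ → ℂ}
    (hκ : Measurable (Function.uncurry κ)) (hκ0 : ∀ v u, s < v → v < u → 0 ≤ κ v u)
    (hq0 : ∀ u, s < u → 0 ≤ q u)
    (hq : ∀ u, s < u → ∫⁻ v in Ioo s u, ENNReal.ofReal (κ v u) = ENNReal.ofReal (q u))
    (hM : AEStronglyMeasurable M (volume.restrict (Ioi s)))
    (hqM : IntegrableOn (fun u => q u • M u) (Ioi s)) :
    (∀ᵐ v ∂volume.restrict (Ioi s), IntegrableOn (fun u => κ v u • M u) (Ioi v)) ∧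
    IntegrableOn (fun v => ∫ u in Ioi v, κ v u • M u) (Ioi s) ∧
    ∫ v in Ioi s, ∫ u in Ioi v, κ v u • M u = ∫ u in Ioi s, q u • M u := by
  -- The integrand, extended by zero off the triangle v < u, becomes a function T on a product
  -- space; its norm integrates in v to ‖q(u) M(u)‖, so T is integrable and Fubini's theorem
  -- applies.
  set ν : Measure ℝ := volume.restrict (Ioi s) with hν
  set T : ℝ × ℝ → ℂ := fun p => ({p : ℝ × ℝ | p.1 < p.2}.indicator (fun p => κ p.1 p.2) p) • M p.2
    with hT
  have hset : MeasurableSet {p : ℝ × ℝ | p.1 < p.2} :=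
    measurableSet_lt measurable_fst measurable_snd
  have hTm : AEStronglyMeasurable T (ν.prod ν) :=
    (hκ.indicator hset).aestronglyMeasurable.smul hM.comp_snd
  have hIoo : ∀ u, Iio u ∩ Ioi s = Ioo s u := fun u => by ext v; simp [and_comm]
  have hTv : ∀ u, (fun v => T (v, u)) = (Iio u).indicator fun v => κ v u • M u := fun u => by
    funext v
    by_cases h : v < u <;> simp [hT, indicator, h]
  have hTu : ∀ v, (fun u => T (v, u)) = (Ioi v).indicator fun u => κ v u • M u := fun v => by
    funext u
    by_cases h : v < u <;> simp [hT, indicator, h]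
  have hκint : ∀ u, s < u → IntegrableOn (fun v => κ v u) (Ioo s u) ∧
      ∫ v in Ioo s u, κ v u = q u := fun u hu => by
    have hm : Measurable fun v => κ v u := hκ.comp (measurable_id.prodMk measurable_const)
    have h0 : 0 ≤ᵐ[volume.restrict (Ioo s u)] fun v => κ v u := by
      filter_upwards [ae_restrict_mem measurableSet_Ioo] with v hv
      exact hκ0 v u hv.1 hv.2
    refine ⟨(lintegral_ofReal_ne_top_iff_integrable hm.aestronglyMeasurable h0).mp
      (by rw [hq u hu]; exact ENNReal.ofReal_ne_top), ?_⟩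
    rw [integral_eq_lintegral_of_nonneg_ae h0 hm.aestronglyMeasurable, hq u hu,
      ENNReal.toReal_ofReal (hq0 u hu)]
  have hinner : ∀ u, s < u → ∫ v, ‖T (v, u)‖ ∂ν = ‖q u • M u‖ := fun u hu => by
    have h1 : ∀ v, ‖T (v, u)‖ = (Iio u).indicator (fun v => ‖κ v u • M u‖) v := fun v => by
      rw [congrFun (hTv u) v, norm_indicator_eq_indicator_norm]
    simp only [h1]
    rw [integral_indicator measurableSet_Iio, hν, Measure.restrict_restrict measurableSet_Iio,
      hIoo, norm_smul, Real.norm_of_nonneg (hq0 u hu), ← (hκint u hu).2, ← integral_mul_const]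
    refine setIntegral_congr_fun measurableSet_Ioo fun v hv => ?_
    rw [norm_smul, Real.norm_of_nonneg (hκ0 v u hv.1 hv.2)]
  have hTint : Integrable T (ν.prod ν) := by
    rw [integrable_prod_iff' hTm]
    constructor
    · filter_upwards [ae_restrict_mem measurableSet_Ioi] with u hu
      rw [hTv u, integrable_indicator_iff measurableSet_Iio, IntegrableOn, hν,
        Measure.restrict_restrict measurableSet_Iio, hIoo]
      exact (hκint u hu).1.smul_const _
    · refine hqM.norm.congr ?_
      filter_upwards [ae_restrict_mem measurableSet_Ioi] with u hu
      exact (hinner u hu).symm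
  have hIoi : ∀ v, s < v → Ioi v ∩ Ioi s = Ioi v := fun v hv =>
    inter_eq_left.mpr (Ioi_subset_Ioi hv.le)
  have hout : ∀ v, s < v → ∫ u, T (v, u) ∂ν = ∫ u in Ioi v, κ v u • M u := fun v hv => by
    rw [show (∫ u, T (v, u) ∂ν) = ∫ u, (Ioi v).indicator (fun u => κ v u • M u) u ∂ν by
      rw [← hTu v], integral_indicator measurableSet_Ioi, hν,
      Measure.restrict_restrict measurableSet_Ioi, hIoi v hv]
  refine ⟨?_, ?_, ?_⟩
  · filter_upwards [hTint.prod_right_ae, ae_restrict_mem measurableSet_Ioi] with v hv hsv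
    rw [hTu v, integrable_indicator_iff measurableSet_Ioi, IntegrableOn, hν,
      Measure.restrict_restrict measurableSet_Ioi, hIoi v hsv] at hv
    exact hv
  · refine hTint.integral_prod_left.congr ?_
    filter_upwards [ae_restrict_mem measurableSet_Ioi] with v hv
    exact hout v hv
  · calc _ = ∫ v, ∫ u, T (v, u) ∂ν ∂ν :=
          (setIntegral_congr_fun measurableSet_Ioi fun v hv => hout v hv).symm
      _ = ∫ u, ∫ v, T (v, u) ∂ν ∂ν := integral_integral_swap hTint
      _ = _ := by
          refine setIntegral_congr_fun measurableSet_Ioi fun u hu => ?_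
          rw [show (∫ v, T (v, u) ∂ν) = ∫ v, (Iio u).indicator (fun v => κ v u • M u) v ∂ν by
            rw [← hTv u], integral_indicator measurableSet_Iio, hν,
            Measure.restrict_restrict measurableSet_Iio, hIoo, integral_smul_const,
            (hκint u hu).2]

/-! ### Riemann–Liouville integrals -/

/-- Absolute convergence of `∫ₛ^∞ v^{β-1} M(v) dv` for all `s > 1`. -/
def TailIntegrable (β : ℝ) (M : ℝ → ℂ) : Prop :=
  ∀ s > 1, IntegrableOn (fun v => v ^ (β - 1) • M v) (Ioi s)

theorem TailIntegrable.aestronglyMeasurable {β : ℝ} {M : ℝ → ℂ} (hM : TailIntegrable β M) {s : ℝ}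
    (hs : 1 < s) : AEStronglyMeasurable M (volume.restrict (Ioi s)) := by
  have h1 : AEStronglyMeasurable (fun v : ℝ => v ^ (-(β - 1)))
      (volume.restrict (Ioi s)) := by fun_prop
  refine (h1.smul (hM s hs).aestronglyMeasurable).congr ?_
  filter_upwards [ae_restrict_mem measurableSet_Ioi] with v hv
  have hv0 : (0 : ℝ) < v := by linarith [show s < v from hv]
  rw [Pi.smul_apply', smul_smul, ← Real.rpow_add hv0, neg_add_cancel, Real.rpow_zero, one_smul]

theorem TailIntegrable.smul_of_le {β : ℝ} {M : ℝ → ℂ} (hM : TailIntegrable β M) {s : ℝ}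
    (hs : 1 < s) {w : ℝ → ℝ} (hw : Measurable w) {C : ℝ}
    (hle : ∀ v, s < v → |w v| ≤ C * v ^ (β - 1)) :
    IntegrableOn (fun v => w v • M v) (Ioi s) := by
  refine Integrable.mono' ((hM s hs).norm.const_mul C)
    (hw.aestronglyMeasurable.smul (hM.aestronglyMeasurable hs)) ?_
  filter_upwards [ae_restrict_mem measurableSet_Ioi] with v hv
  have hv0 : (0 : ℝ) < v := by linarith [show s < v from hv]
  rw [norm_smul, norm_smul, Real.norm_eq_abs, Real.norm_of_nonneg (by positivity), ← mul_assoc]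
  exact mul_le_mul_of_nonneg_right (hle v hv) (norm_nonneg _)

theorem TailIntegrable.mono {β β' : ℝ} {M : ℝ → ℂ} (hM : TailIntegrable β M) (h : β' ≤ β) :
    TailIntegrable β' M := fun s hs => by
  refine hM.smul_of_le hs (by fun_prop) (C := 1) fun v hv => ?_
  have hv1 : 1 ≤ v := by linarith
  rw [abs_of_nonneg (by positivity), one_mul]
  exact Real.rpow_le_rpow_of_exponent_le hv1 (by linarith)

theorem TailIntegrable.rpow_smul {β γ : ℝ} {M : ℝ → ℂ} (hM : TailIntegrable β M) :
    TailIntegrable (β - γ) (fun v => v ^ γ • M v) := fun s hs => by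
  refine (hM s hs).congr ?_
  filter_upwards [ae_restrict_mem measurableSet_Ioi] with v hv
  have hv0 : (0 : ℝ) < v := by linarith [show s < v from hv]
  rw [smul_smul, ← Real.rpow_add hv0]
  congr 2
  ring

theorem TailIntegrable.integrableOn {β : ℝ} {M : ℝ → ℂ} (hM : TailIntegrable β M) (hβ : 1 ≤ β)
    {s : ℝ} (hs : 1 < s) : IntegrableOn M (Ioi s) := by
  simpa using hM.mono hβ s hs

theorem TailIntegrable.rlIntegrand {β : ℝ} {M : ℝ → ℂ} (hM : TailIntegrable β M) (hβ : 1 ≤ β)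
    {s : ℝ} (hs : 1 < s) : IntegrableOn (rlIntegrand β M s) (Ioi s) := by
  refine hM.smul_of_le hs (by fun_prop) (C := 1) fun v hv => ?_
  rw [abs_of_nonneg (Real.rpow_nonneg (by linarith) _), one_mul]
  exact Real.rpow_le_rpow (by linarith) (by linarith) (by linarith)

theorem rlIntegral_one (M : ℝ → ℂ) : rlIntegral 1 M = tailPrim M := by
  funext s
  simp [rlIntegral, rlIntegrand, tailPrim]

theorem lintegral_rpow_sub {β : ℝ} (hβ : 0 < β) {s u : ℝ} (hsu : s < u) :
    ∫⁻ v in Ioo s u, ENNReal.ofReal ((u - v) ^ (β - 1)) = ENNReal.ofReal ((u - s) ^ β / β) := by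
  have hint : IntervalIntegrable (fun v : ℝ => (u - v) ^ (β - 1)) volume s u := by
    have h := (intervalIntegral.intervalIntegrable_rpow' (a := 0) (b := u - s)
      (show -1 < β - 1 by linarith)).comp_sub_left u
    simpa using h.symm
  have h0 : 0 ≤ᵐ[volume.restrict (Ioo s u)] fun v => (u - v) ^ (β - 1) := by
    filter_upwards [ae_restrict_mem measurableSet_Ioo] with v hv
    exact Real.rpow_nonneg (by linarith [hv.2]) _
  have hint' : IntegrableOn (fun v : ℝ => (u - v) ^ (β - 1)) (Ioo s u) :=
    ((intervalIntegrable_iff_integrableOn_Ioc_of_le hsu.le).mp hint).mono_set Ioo_subset_Ioc_self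
  rw [← ofReal_integral_eq_lintegral_ofReal hint' h0, ← integral_Ioc_eq_integral_Ioo,
    ← intervalIntegral.integral_of_le hsu.le,
    intervalIntegral.integral_comp_sub_left (fun x => x ^ (β - 1)), sub_self,
    integral_rpow (Or.inl (by linarith)), sub_add_cancel, Real.zero_rpow hβ.ne', sub_zero]

/-- Tonelli's theorem with inner integral (u - s)^β/β, together with Γ(β + 1) = βΓ(β). The inner
integral is claimed to converge only almost everywhere, since the kernel is singular for β < 1. -/
theorem rlIntegral_add_one {β : ℝ} (hβ : 0 < β) {M : ℝ → ℂ} (hM : TailIntegrable (β + 1) M)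
    {s : ℝ} (hs : 1 < s) :
    (∀ᵐ v ∂volume.restrict (Ioi s), IntegrableOn (rlIntegrand β M v) (Ioi v)) ∧
    IntegrableOn (rlIntegral β M) (Ioi s) ∧
    rlIntegral (β + 1) M s = tailPrim (rlIntegral β M) s := by
  have hΓ := Real.Gamma_pos_of_pos hβ
  obtain ⟨h1, h2, h3⟩ := integral_integral_kernel (s := s) (κ := fun v u => (u - v) ^ (β - 1))
    (q := fun u => (u - s) ^ β / β) (M := M)
    (by unfold Function.uncurry; fun_prop) (fun v u _ h => Real.rpow_nonneg (by linarith) _)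
    (fun u hu => div_nonneg (Real.rpow_nonneg (by linarith) _) hβ.le)
    (fun u hu => lintegral_rpow_sub hβ hu) (hM.aestronglyMeasurable hs)
    (hM.smul_of_le hs (by fun_prop) (C := β⁻¹) fun v hv => by
      rw [abs_of_nonneg (div_nonneg (Real.rpow_nonneg (by linarith) _) hβ.le), add_sub_cancel_right,
        div_eq_inv_mul]
      exact mul_le_mul_of_nonneg_left (Real.rpow_le_rpow (by linarith) (by linarith) hβ.le)
        (inv_nonneg.mpr hβ.le))
  refine ⟨h1, h2.smul (Real.Gamma β)⁻¹, ?_⟩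
  have h4 : tailPrim (rlIntegral β M) s
      = (Real.Gamma β)⁻¹ • ∫ v in Ioi s, ∫ u in Ioi v, (u - v) ^ (β - 1) • M u :=
    integral_smul _ _
  rw [h4, h3, rlIntegral, Real.Gamma_add_one hβ.ne', mul_inv_rev, mul_smul, ← integral_smul]
  congr 1
  refine integral_congr_ae (Eventually.of_forall fun v => ?_)
  simp only [rlIntegrand, add_sub_cancel_right, smul_smul]
  congr 1
  field_simp

theorem lintegral_beta {α β : ℝ} (hα : 0 < α) (hβ : 0 < β) :
    ∫⁻ x in Ioo (0 : ℝ) 1, ENNReal.ofReal (x ^ (α - 1) * (1 - x) ^ (β - 1))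
      = ENNReal.ofReal (ProbabilityTheory.beta α β) := by
  have hb := ProbabilityTheory.beta_pos hα hβ
  have h := ProbabilityTheory.lintegral_betaPDF_eq_one hα hβ
  rw [ProbabilityTheory.lintegral_betaPDF] at h
  have h1 : ∀ x : ℝ, ENNReal.ofReal (x ^ (α - 1) * (1 - x) ^ (β - 1))
      = ENNReal.ofReal (ProbabilityTheory.beta α β)
        * ENNReal.ofReal (1 / ProbabilityTheory.beta α β * x ^ (α - 1) * (1 - x) ^ (β - 1)) :=
    fun x => by
      rw [← ENNReal.ofReal_mul hb.le]
      congr 1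
      field_simp
  simp only [h1]
  rw [lintegral_const_mul _ (by fun_prop), h, mul_one]

/-- The substitution v = s/(1 - xc) with c = (u - s)/u carries (0, 1) onto (s, u) and reduces the
kernel to the beta integrand. -/
theorem lintegral_beta_kernel {α β : ℝ} (hα : 0 < α) (hβ : 0 < β) {s u : ℝ} (hs : 0 < s)
    (hsu : s < u) :
    ∫⁻ v in Ioo s u, ENNReal.ofReal ((v - s) ^ (α - 1) * v ^ (-(α + β)) * (u - v) ^ (β - 1))
      = ENNReal.ofReal (ProbabilityTheory.beta α β * s ^ (-β)
          * (u ^ (-α) * (u - s) ^ (α + β - 1))) := by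
  have hu : 0 < u := hs.trans hsu
  set c : ℝ := (u - s) / u with hc
  have hc0 : 0 < c := div_pos (by linarith) hu
  have hc1 : c < 1 := by rw [hc, div_lt_one hu]; linarith
  have hcu : 1 - c = s / u := by rw [hc]; field_simp; ring
  have hpos : ∀ x ∈ Ioo (0 : ℝ) 1, 0 < 1 - x * c := fun x hx => by
    nlinarith [hx.1, hx.2, mul_lt_mul_of_pos_right hx.2 hc0]
  have hder : ∀ x ∈ Ioo (0 : ℝ) 1, HasDerivWithinAt (fun x : ℝ => s / (1 - x * c))
      (s * c / (1 - x * c) ^ 2) (Ioo 0 1) x := fun x hx => by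
    have h1 : HasDerivAt (fun x : ℝ => 1 - x * c) (-c) x := by
      simpa using ((hasDerivAt_id x).mul_const c).const_sub 1
    refine HasDerivAt.hasDerivWithinAt
      (((hasDerivAt_const x s).div h1 (hpos x hx).ne').congr_deriv ?_)
    ring
  have hinj : InjOn (fun x : ℝ => s / (1 - x * c)) (Ioo 0 1) := fun x hx y hy hxy => by
    have h1 := hpos x hx
    have h2 := hpos y hy
    simp only at hxy
    rw [div_eq_div_iff h1.ne' h2.ne'] at hxy
    have h3 := mul_left_cancel₀ hs.ne' hxy
    exact mul_right_cancel₀ hc0.ne' (by linarith)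
  have himage : (fun x : ℝ => s / (1 - x * c)) '' Ioo 0 1 = Ioo s u := by
    ext v
    constructor
    · rintro ⟨x, hx, rfl⟩
      have h1 := hpos x hx
      refine ⟨?_, ?_⟩ <;> simp only
      · rw [lt_div_iff₀ h1]
        nlinarith [mul_pos hs (mul_pos hx.1 hc0)]
      · rw [div_lt_iff₀ h1]
        have : u * c = u - s := by rw [hc]; field_simp
        nlinarith [mul_lt_mul_of_pos_right hx.2 (sub_pos.mpr hsu)]
    · rintro ⟨hv1, hv2⟩
      have hv0 : 0 < v := hs.trans hv1
      refine ⟨(v - s) / (v * c), ⟨div_pos (by linarith) (by positivity), ?_⟩, ?_⟩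
      · rw [div_lt_one (by positivity)]
        have : v * s < u * s := mul_lt_mul_of_pos_right hv2 hs
        have h2 : v * c = v - v * s / u := by rw [hc]; field_simp
        rw [h2]
        have : v * s / u < s := by rw [div_lt_iff₀ hu]; linarith
        linarith
      · simp only
        have : (v - s) / (v * c) * c = (v - s) / v := by field_simp
        rw [this]
        have h3 : 1 - (v - s) / v = s / v := by field_simp; ring
        rw [h3]
        field_simp
  rw [← himage, lintegral_image_eq_lintegral_abs_deriv_mul measurableSet_Ioo hder hinj]
  have hkey : ∀ x ∈ Ioo (0 : ℝ) 1,
      ENNReal.ofReal |s * c / (1 - x * c) ^ 2| * ENNReal.ofReal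
        ((s / (1 - x * c) - s) ^ (α - 1) * (s / (1 - x * c)) ^ (-(α + β))
          * (u - s / (1 - x * c)) ^ (β - 1))
      = ENNReal.ofReal (s ^ (-β) * (u ^ (-α) * (u - s) ^ (α + β - 1)))
        * ENNReal.ofReal (x ^ (α - 1) * (1 - x) ^ (β - 1)) := fun x hx => by
    have h1 := hpos x hx
    have hx0 := hx.1
    have hx1 : 0 < 1 - x := by linarith [hx.2]
    have hus : 0 < u - s := by linarith
    rw [abs_of_pos (by positivity), ← ENNReal.ofReal_mul (by positivity),
      ← ENNReal.ofReal_mul (by positivity)]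
    congr 1
    set D : ℝ := 1 - x * c with hD
    have e1 : s / D - s = s * x * (u - s) / (u * D) := by
      have : 1 - D = x * (u - s) / u := by rw [hD, hc]; ring
      have h2 : s / D - s = s * (1 - D) / D := by field_simp
      rw [h2, this]; field_simp
    have e2 : u - s / D = (u - s) * (1 - x) / D := by
      have h3 : u * D = u - x * (u - s) := by rw [hD, hc]; field_simp
      have h2 : u - s / D = (u * D - s) / D := by field_simp
      rw [h2, h3]; ring
    have e3 : s * c / D ^ 2 = s * (u - s) / (u * D ^ 2) := by rw [hc]; field_simp
    rw [e1, e2, e3]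
    rw [Real.div_rpow (by positivity) (by positivity), Real.div_rpow hs.le h1.le,
      Real.div_rpow (by positivity) h1.le, Real.mul_rpow (by positivity) hus.le,
      Real.mul_rpow hs.le hx0.le, Real.mul_rpow hu.le h1.le, Real.mul_rpow hus.le hx1.le]
    have e4 : (u - s) ^ (α + β - 1) = (u - s) * (u - s) ^ (α - 1) * (u - s) ^ (β - 1) := by
      nth_rewrite 2 [← Real.rpow_one (u - s)]
      rw [← Real.rpow_add hus, ← Real.rpow_add hus]
      congr 1; ring
    have e5 : s ^ (-β) = s * s ^ (α - 1) * s ^ (-(α + β)) := by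
      nth_rewrite 2 [← Real.rpow_one s]
      rw [← Real.rpow_add hs, ← Real.rpow_add hs]
      congr 1; ring
    have e6 : u * (u ^ (-α) * u ^ (α - 1)) = 1 := by
      nth_rewrite 1 [← Real.rpow_one u]
      rw [← Real.rpow_add hu, ← Real.rpow_add hu, ← Real.rpow_zero u]
      congr 1; ring
    -- Here the weight v^{-(α+β)} matters: it is the power for which all factors 1 - xc cancel.
    have e7 : D ^ 2 * (D ^ (α - 1) * D ^ (-(α + β)) * D ^ (β - 1)) = 1 := by
      have : ((2 : ℕ) : ℝ) + (α - 1 + -(α + β) + (β - 1)) = 0 := by push_cast; ring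
      rw [← Real.rpow_natCast D 2, ← Real.rpow_add h1, ← Real.rpow_add h1, ← Real.rpow_add h1,
        this, Real.rpow_zero]
    rw [e4, e5]
    have hU : 0 < u ^ (α - 1) := by positivity
    have hDa : 0 < D ^ (α - 1) := by positivity
    have hDb : 0 < D ^ (-(α + β)) := by positivity
    have hDc : 0 < D ^ (β - 1) := by positivity
    have e6' : u ^ (-α) = (u * u ^ (α - 1))⁻¹ :=
      eq_inv_of_mul_eq_one_left (by linarith)
    have e7' : (D ^ 2)⁻¹ = D ^ (α - 1) * D ^ (-(α + β)) * D ^ (β - 1) :=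
      inv_eq_of_mul_eq_one_right e7
    have e8 : s * (u - s) / (u * D ^ 2) = s * (u - s) / u * (D ^ 2)⁻¹ := by field_simp
    rw [e8, e7', e6']
    field_simp
  rw [setLIntegral_congr_fun measurableSet_Ioo hkey, lintegral_const_mul _ (by fun_prop),
    lintegral_beta hα hβ, ← ENNReal.ofReal_mul (by
      have : 0 < u - s := by linarith
      positivity)]
  congr 1
  ring

/-- Tonelli's theorem with the beta kernel. The weights let two fractional integrals be composed
while assuming tail integrability of order β only, where the unweighted I^α I^β would call for order
α + β. The condition α + β ≥ 1 serves to bound (u - s)^{α+β-1} by u^{α+β-1}. -/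
theorem rlIntegral_comp {α β : ℝ} (hα : 0 < α) (hβ : 0 < β) (hαβ : 1 ≤ α + β) {M : ℝ → ℂ}
    (hM : TailIntegrable β M) {s : ℝ} (hs : 1 < s) :
    (∀ᵐ v ∂volume.restrict (Ioi s), IntegrableOn (rlIntegrand β M v) (Ioi v)) ∧
    IntegrableOn (rlIntegrand α (fun v => v ^ (-(α + β)) • rlIntegral β M v) s) (Ioi s) ∧
    s ^ β • rlIntegral α (fun v => v ^ (-(α + β)) • rlIntegral β M v) s
      = rlIntegral (α + β) (fun v => v ^ (-α) • M v) s := by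
  have hs0 : 0 < s := one_pos.trans hs
  have hb := ProbabilityTheory.beta_pos hα hβ
  have hΓα := Real.Gamma_pos_of_pos hα
  have hΓβ := Real.Gamma_pos_of_pos hβ
  have hΓαβ := Real.Gamma_pos_of_pos (add_pos hα hβ)
  have hq0 : ∀ u, s < u → 0 ≤ ProbabilityTheory.beta α β * s ^ (-β)
      * (u ^ (-α) * (u - s) ^ (α + β - 1)) := fun u hu => by
    have : 0 < u - s := by linarith
    have : 0 < u := by linarith
    positivity
  obtain ⟨h1, h2, h3⟩ := integral_integral_kernel (s := s)
    (κ := fun v u => (v - s) ^ (α - 1) * v ^ (-(α + β)) * (u - v) ^ (β - 1))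
    (q := fun u => ProbabilityTheory.beta α β * s ^ (-β) * (u ^ (-α) * (u - s) ^ (α + β - 1)))
    (M := M) (by unfold Function.uncurry; fun_prop)
    (fun v u hv hu => by
      have : 0 < u - v := by linarith
      have : 0 < v - s := by linarith
      have : 0 < v := by linarith
      positivity)
    hq0 (fun u hu => lintegral_beta_kernel hα hβ hs0 hu) (hM.aestronglyMeasurable hs)
    (hM.smul_of_le hs (by fun_prop) (C := ProbabilityTheory.beta α β * s ^ (-β)) fun v hv => by
      have hv0 : 0 < v := by linarith
      rw [abs_of_nonneg (hq0 v hv)]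
      refine mul_le_mul_of_nonneg_left ?_ (by positivity)
      calc v ^ (-α) * (v - s) ^ (α + β - 1) ≤ v ^ (-α) * v ^ (α + β - 1) :=
            mul_le_mul_of_nonneg_left
              (Real.rpow_le_rpow (by linarith) (by linarith) (by linarith)) (by positivity)
        _ = v ^ (β - 1) := by rw [← Real.rpow_add hv0]; congr 1; ring)
  have hinner : ∀ v, s < v → ∫ u in Ioi v, ((v - s) ^ (α - 1) * v ^ (-(α + β))
      * (u - v) ^ (β - 1)) • M u = Real.Gamma β •
        rlIntegrand α (fun v => v ^ (-(α + β)) • rlIntegral β M v) s v := fun v hv => by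
    simp only [rlIntegrand, rlIntegral, mul_smul, integral_smul]
    rw [smul_comm (Real.Gamma β), smul_comm (Real.Gamma β), smul_smul (Real.Gamma β),
      mul_inv_cancel₀ hΓβ.ne', one_smul]
  refine ⟨?_, ?_, ?_⟩
  · filter_upwards [h1, ae_restrict_mem measurableSet_Ioi] with v hv hsv
    have hsv' : s < v := hsv
    have hc : 0 < (v - s) ^ (α - 1) * v ^ (-(α + β)) := by
      have : 0 < v - s := by linarith
      have : 0 < v := by linarith
      positivity
    refine (hv.smul ((v - s) ^ (α - 1) * v ^ (-(α + β)))⁻¹).congr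
      (Eventually.of_forall fun u => ?_)
    simp only [Pi.smul_apply, rlIntegrand, smul_smul]
    rw [inv_mul_cancel_left₀ hc.ne']
  · refine (h2.smul (Real.Gamma β)⁻¹).congr ?_
    filter_upwards [ae_restrict_mem measurableSet_Ioi] with v hv
    rw [Pi.smul_apply, hinner v hv, smul_smul, inv_mul_cancel₀ hΓβ.ne', one_smul]
  · rw [setIntegral_congr_fun measurableSet_Ioi fun v hv => hinner v hv, integral_smul] at h3
    have h4 : ∫ v in Ioi s, rlIntegrand α (fun v => v ^ (-(α + β)) • rlIntegral β M v) s v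
        = ((Real.Gamma β)⁻¹ * (ProbabilityTheory.beta α β * s ^ (-β))) •
          ∫ u in Ioi s, (u ^ (-α) * (u - s) ^ (α + β - 1)) • M u := by
      rw [mul_smul, ← integral_smul (ProbabilityTheory.beta α β * s ^ (-β))]
      simp only [smul_smul]
      rw [← h3, smul_smul, inv_mul_cancel₀ hΓβ.ne', one_smul]
    rw [rlIntegral, h4, rlIntegral]
    simp only [rlIntegrand, smul_smul]
    have h5 : ∀ u : ℝ, (u ^ (-α) * (u - s) ^ (α + β - 1)) • M u
        = ((u - s) ^ (α + β - 1) * u ^ (-α)) • M u := fun u => by rw [mul_comm]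
    simp only [h5]
    congr 1
    rw [ProbabilityTheory.beta, Real.rpow_neg hs0.le]
    have : 0 < s ^ β := by positivity
    field_simp

theorem rlIntegral_congr {α s : ℝ} {ψ φ : ℝ → ℂ} (h : ∀ᵐ v ∂volume.restrict (Ioi s), ψ v = φ v) :
    rlIntegral α ψ s = rlIntegral α φ s := by
  rw [rlIntegral, rlIntegral]
  congr 1
  refine integral_congr_ae ?_
  filter_upwards [h] with v hv
  rw [rlIntegrand, rlIntegrand, hv]

theorem rlIntegral_const_mul (α : ℝ) (c : ℂ) (φ : ℝ → ℂ) (s : ℝ) :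
    rlIntegral α (fun v => c * φ v) s = c * rlIntegral α φ s := by
  rw [rlIntegral, rlIntegral, mul_smul_comm, ← integral_const_mul]
  simp only [rlIntegrand, mul_smul_comm]

/-- By `rlIntegral_add_one`, the integrals of orders 1, …, k form a chain of successive primitives
starting from h. -/
theorem iteratedDeriv_of_rlIntegral {k : ℕ} (hk : 1 ≤ k) {h : ℝ → ℂ} (hh : TailIntegrable k h)
    {F : ℝ → ℂ} (hF : ∀ s > 1, F s = rlIntegral k h s) {s : ℝ} (hs : 1 < s)
    (hd : HasDerivAt (tailPrim h) (-h s) s) :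
    HasIterDeriv k F s ∧ iteratedDeriv k F s = (-1) ^ k * h s := by
  have hk' : (1 : ℝ) ≤ k := by exact_mod_cast hk
  have hadd : ∀ j, 1 ≤ j → j < k → ∀ s > 1, IntegrableOn (rlIntegral (j : ℕ) h) (Ioi s) ∧
      rlIntegral ((j + 1 : ℕ) : ℝ) h s = tailPrim (rlIntegral (j : ℕ) h) s :=
    fun j hj hjk s hs => by
    have h1 := rlIntegral_add_one (β := j) (by exact_mod_cast hj)
      (hh.mono (by exact_mod_cast hjk)) hs
    exact ⟨h1.2.1, by push_cast; exact h1.2.2⟩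
  -- The chain has h itself in place 0, because `rlIntegral 0 h` is not h: the convention
  -- `Real.Gamma 0 = 0` makes it zero.
  refine iteratedDeriv_of_tailPrim (G := fun j => if j = 0 then h else rlIntegral (j : ℕ) h) hk
    ?_ ?_ (fun s hs => ?_) hs hd
  · intro j hj s hs
    by_cases h0 : j = 0
    · simpa [h0] using hh.integrableOn hk' hs
    · simp only [h0, if_false]
      exact (hadd j (by omega) hj s hs).1
  · intro j hj s hs
    by_cases h0 : j = 0
    · simp [h0, rlIntegral_one]
    · simp only [h0, if_false, Nat.add_eq_zero_iff, false_and]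
      exact (hadd j (by omega) hj s hs).2
  · simp only [show k ≠ 0 by omega, if_false]
    exact hF s hs

/-! ### Inversion of Riemann–Liouville integrals by the fractional derivative -/

/-- The function whose iterated primitive is differentiated in `𝒟^{d/2}_-`. -/
noncomputable def fracBase (d : ℕ) (M : ℝ → ℂ) (v : ℝ) : ℂ :=
  if Even d then M v else v ^ (-(1 / 2 : ℝ)) • M v

/-- The natural number `(d + 1) / 2` is the number of derivatives taken in both parities. For d odd
it exceeds d/2 by 1/2, and the weight v^{-1/2} pays for this. -/
theorem tailIntegrable_fracBase {d : ℕ} {M : ℝ → ℂ} (hM : TailIntegrable (d / 2) M) :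
    TailIntegrable (((d + 1) / 2 : ℕ) : ℝ) (fracBase d M) := by
  rcases Nat.even_or_odd' d with ⟨m, rfl | rfl⟩
  · have h1 : (2 * m + 1) / 2 = m := by omega
    have h2 : fracBase (2 * m) M = M := by
      funext v; simp [fracBase]
    rw [h1, h2]
    convert! hM using 1
    push_cast; ring
  · have h1 : (2 * m + 1 + 1) / 2 = m + 1 := by omega
    have h2 : fracBase (2 * m + 1) M = fun v => v ^ (-(1 / 2 : ℝ)) • M v := by
      funext v; simp [fracBase]
    rw [h1, h2]
    convert! hM.rpow_smul (γ := -(1 / 2)) using 1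
    push_cast; ring

theorem integrableOn_fracBase {d : ℕ} (hd : 1 ≤ d) {M : ℝ → ℂ} (hM : TailIntegrable (d / 2) M)
    {s : ℝ} (hs : 1 < s) : IntegrableOn (fracBase d M) (Ioi s) :=
  (tailIntegrable_fracBase hM).integrableOn
    (by exact_mod_cast (show 1 ≤ (d + 1) / 2 by omega)) hs

/-- `ψ` is the Riemann–Liouville integral of order `d/2` of `M`, up to a null set if `d = 1`. -/
structure IsRLIntegral (d : ℕ) (M ψ : ℝ → ℂ) : Prop where
  ae_eq : ∀ᵐ r ∂volume.restrict (Ioi (1 : ℝ)), ψ r = rlIntegral (d / 2) M r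
  eq : 2 ≤ d → ∀ r > 1, ψ r = rlIntegral (d / 2) M r

theorem IsRLIntegral.ae_eq_Ioi {d : ℕ} {M ψ : ℝ → ℂ} (hψ : IsRLIntegral d M ψ) {s : ℝ}
    (hs : 1 < s) : ∀ᵐ r ∂volume.restrict (Ioi s), ψ r = rlIntegral (d / 2) M r :=
  ae_restrict_of_ae_restrict_of_subset (Ioi_subset_Ioi hs.le) hψ.ae_eq

theorem IsRLIntegral.fracDeriv_even {m : ℕ} (hm : 1 ≤ m) {M ψ : ℝ → ℂ}
    (hM : TailIntegrable ((2 * m : ℕ) / 2) M) (hψ : IsRLIntegral (2 * m) M ψ) {s : ℝ} (hs : 1 < s)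
    (hd : HasDerivAt (tailPrim (fracBase (2 * m) M)) (-fracBase (2 * m) M s) s) :
    FracDerivExists (2 * m) ψ s ∧ fracDeriv (2 * m) ψ s = M s := by
  have hm2 : ((2 * m : ℕ) : ℝ) / 2 = m := by push_cast; ring
  have h2 : fracBase (2 * m) M = M := by funext v; simp [fracBase]
  have h1 : 2 * m / 2 = m := by omega
  rw [h2] at hd
  rw [hm2] at hM
  obtain ⟨h3, h4⟩ := iteratedDeriv_of_rlIntegral (F := ψ) hm hM
    (fun s hs => by rw [← hm2]; exact hψ.eq (by omega) s hs) hs hd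
  rw [FracDerivExists, fracDeriv, if_pos (even_two_mul m), if_pos (even_two_mul m), h1, h4,
    ← mul_assoc, ← mul_pow]
  exact ⟨h3, by simp⟩

theorem sq_rpow_half {s : ℝ} (hs : 0 < s) (z : ℂ) :
    s ^ (1 / 2 : ℝ) • s ^ (-(1 / 2 : ℝ)) • z = z := by
  rw [smul_smul, ← Real.rpow_add hs, add_neg_cancel, Real.rpow_zero, one_smul]

/-- This is `rlIntegral_comp` with α = 1/2 and β = d/2 = m + 1/2, whose sum is the integer m + 1.
The integral ignores the null set on which ψ may differ from the Riemann–Liouville integral when d =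
1. -/
theorem IsRLIntegral.oddAux_eq {m : ℕ} {M ψ : ℝ → ℂ} (hM : TailIntegrable ((2 * m + 1 : ℕ) / 2) M)
    (hψ : IsRLIntegral (2 * m + 1) M ψ) {u : ℝ} (hu : 1 < u) :
    IntegrableOn (rlIntegrand (1 / 2) (fun v => v ^ (-((m + 1 : ℕ) : ℝ)) • ψ v) u) (Ioi u) ∧
    oddAux (m + 1) ψ u = rlIntegral ((m + 1 : ℕ) : ℝ) (fracBase (2 * m + 1) M) u := by
  have hβ : (0 : ℝ) < (2 * m + 1 : ℕ) / 2 := by positivity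
  have hsum : (1 / 2 : ℝ) + (2 * m + 1 : ℕ) / 2 = (m + 1 : ℕ) := by push_cast; ring
  have hsum' : ((m + 1 : ℕ) : ℝ) - 1 / 2 = (2 * m + 1 : ℕ) / 2 := by push_cast; ring
  have h2 : fracBase (2 * m + 1) M = fun v => v ^ (-(1 / 2 : ℝ)) • M v := by
    funext v; simp [fracBase]
  obtain ⟨-, h3, h4⟩ := rlIntegral_comp one_half_pos hβ
    (by rw [hsum]; exact_mod_cast Nat.le_add_left 1 m) hM hu
  rw [hsum] at h3 h4
  have hae := hψ.ae_eq_Ioi hu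
  constructor
  · refine h3.congr ?_
    filter_upwards [hae] with v hv
    simp only [rlIntegrand, hv]
  · rw [oddAux, hsum', h2, ← h4]
    congr 1
    refine rlIntegral_congr ?_
    filter_upwards [hae] with v hv
    rw [hv]

/-- The derivatives give v^{-1/2} M up to sign; the prefactor s^{1/2} removes the weight, and the
two signs cancel. -/
theorem IsRLIntegral.fracDeriv_odd {m : ℕ} {M ψ : ℝ → ℂ}
    (hM : TailIntegrable ((2 * m + 1 : ℕ) / 2) M) (hψ : IsRLIntegral (2 * m + 1) M ψ) {s : ℝ}
    (hs : 1 < s)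
    (hd : HasDerivAt (tailPrim (fracBase (2 * m + 1) M)) (-fracBase (2 * m + 1) M s) s) :
    FracDerivExists (2 * m + 1) ψ s ∧ fracDeriv (2 * m + 1) ψ s = M s := by
  have h1 : (2 * m + 1 + 1) / 2 = m + 1 := by omega
  have hodd : ¬ Even (2 * m + 1) := by simp
  have h2 := tailIntegrable_fracBase hM
  rw [h1] at h2
  obtain ⟨h3, h4⟩ := iteratedDeriv_of_rlIntegral (by omega) h2
    (fun u hu => (hψ.oddAux_eq hM hu).2) hs hd
  rw [FracDerivExists, fracDeriv, if_neg hodd, if_neg hodd, h1, h4]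
  refine ⟨⟨?_, h3⟩, ?_⟩
  · filter_upwards [Ioi_mem_nhds hs] with u hu
    exact (hψ.oddAux_eq hM hu).1
  · rw [fracBase, if_neg hodd]
    simp only [mul_smul_comm]
    rw [sq_rpow_half (one_pos.trans hs), ← mul_assoc, ← mul_pow]
    simp

theorem IsRLIntegral.fracDeriv_eq {d : ℕ} (hd : 1 ≤ d) {M ψ : ℝ → ℂ}
    (hM : TailIntegrable (d / 2) M) (hψ : IsRLIntegral d M ψ) {s : ℝ} (hs : 1 < s)
    (h : HasDerivAt (tailPrim (fracBase d M)) (-fracBase d M s) s) :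
    FracDerivExists d ψ s ∧ fracDeriv d ψ s = M s := by
  rcases Nat.even_or_odd' d with ⟨m, rfl | rfl⟩
  · exact hψ.fracDeriv_even (by omega) hM hs h
  · exact hψ.fracDeriv_odd hM hs h

/-- Since I^{m+1/2} = I^m I^{1/2}, m differentiations leave I^{1/2} M. That function is merely
integrable on half-lines, so the last derivative is available almost everywhere only. For m = 0
nothing is differentiated and the claim is the almost everywhere identity for ψ. -/
theorem IsRLIntegral.ae_iteratedDeriv {m : ℕ} {M ψ : ℝ → ℂ}
    (hM : TailIntegrable ((2 * m + 1 : ℕ) / 2) M) (hψ : IsRLIntegral (2 * m + 1) M ψ) :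
    ∀ᵐ v ∂volume.restrict (Ioi (1 : ℝ)), HasIterDeriv m ψ v ∧
      iteratedDeriv m ψ v = (-1) ^ m * rlIntegral (1 / 2) M v := by
  by_cases hm : m = 0
  · subst hm
    filter_upwards [hψ.ae_eq] with v hv
    refine ⟨⟨fun j hj => by omega, fun j hj => by omega⟩, ?_⟩
    simpa using hv
  have hadd : ∀ j < m, ∀ s > 1, IntegrableOn (rlIntegral (1 / 2 + (j : ℕ)) M) (Ioi s) ∧
      rlIntegral (1 / 2 + ((j + 1 : ℕ) : ℝ)) M s = tailPrim (rlIntegral (1 / 2 + (j : ℕ)) M) s :=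
    fun j hj s hs => by
      have hj' : (j : ℝ) + 1 ≤ m := by exact_mod_cast hj
      have h1 := rlIntegral_add_one (β := 1 / 2 + j) (by positivity)
        (hM.mono (by push_cast; linarith)) hs
      refine ⟨h1.2.1, ?_⟩
      rw [← h1.2.2]
      congr 1
      push_cast; ring
  have h0 : rlIntegral (1 / 2 + ((0 : ℕ) : ℝ)) M = rlIntegral (1 / 2) M := by simp
  have hG0 : ∀ s > 1, IntegrableOn (rlIntegral (1 / 2) M) (Ioi s) := fun s hs => by
    rw [← h0]; exact (hadd 0 (by omega) s hs).1
  filter_upwards [ae_hasDerivAt_tailPrim hG0, ae_restrict_mem measurableSet_Ioi] with v hv hv1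
  have h2 := iteratedDeriv_of_tailPrim (G := fun j => rlIntegral (1 / 2 + (j : ℕ)) M)
    (k := m) (by omega) (fun j hj s hs => (hadd j hj s hs).1) (fun j hj s hs => (hadd j hj s hs).2)
    (F := ψ) (fun s hs => by
      rw [hψ.eq (by omega) s hs]
      congr 1
      push_cast; ring) hv1 (by rw [h0]; exact hv)
  rw [h0] at h2
  exact h2

/-- Under the integral sign the m-th derivative of ψ may be replaced by (-1)^m I^{1/2} M. Then
`rlIntegral_comp` with α = β = 1/2 collapses s^{1/2} I^{1/2} s^{-1} I^{1/2} M into the primitive of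
v^{-1/2} M, and a single derivative remains. -/
theorem IsRLIntegral.fracDerivOdd_eq {m : ℕ} {M ψ : ℝ → ℂ}
    (hM : TailIntegrable ((2 * m + 1 : ℕ) / 2) M) (hψ : IsRLIntegral (2 * m + 1) M ψ) {s : ℝ}
    (hs : 1 < s)
    (hd : HasDerivAt (tailPrim (fracBase (2 * m + 1) M)) (-fracBase (2 * m + 1) M s) s) :
    FracDerivOddExists (m + 1) ψ s ∧ fracDerivOdd (m + 1) ψ s = M s := by
  have hodd : ¬ Even (2 * m + 1) := by simp
  have hiter := hψ.ae_iteratedDeriv hM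
  have hM2 : TailIntegrable (1 / 2) M :=
    hM.mono (by push_cast; linarith [(Nat.cast_nonneg m : (0 : ℝ) ≤ m)])
  have h2 : fracBase (2 * m + 1) M = fun v => v ^ (-(1 / 2 : ℝ)) • M v := by
    funext v; simp [fracBase]
  have hau : ∀ u > 1, (∀ᵐ v ∂volume.restrict (Ioi u), HasIterDeriv m ψ v) ∧
      IntegrableOn (rlIntegrand (1 / 2) (fun v => v ^ (-((1 : ℕ) : ℝ)) • iteratedDeriv m ψ v) u)
        (Ioi u) ∧
      oddAux 1 (iteratedDeriv m ψ) u = (-1) ^ m * tailPrim (fracBase (2 * m + 1) M) u := by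
    intro u hu
    have hae : ∀ᵐ v ∂volume.restrict (Ioi u), HasIterDeriv m ψ v ∧
        iteratedDeriv m ψ v = (-1) ^ m * rlIntegral (1 / 2) M v :=
      ae_restrict_of_ae_restrict_of_subset (Ioi_subset_Ioi (le_of_lt hu)) hiter
    obtain ⟨-, h3, h4⟩ := rlIntegral_comp one_half_pos one_half_pos (by norm_num) hM2 hu
    rw [show (1 / 2 : ℝ) + 1 / 2 = 1 by norm_num] at h3 h4
    refine ⟨hae.mono fun v hv => hv.1, ?_, ?_⟩
    · refine (h3.const_mul ((-1) ^ m)).congr ?_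
      filter_upwards [hae] with v hv
      simp only [rlIntegrand, hv.2, Nat.cast_one, mul_smul_comm]
    · rw [h2, ← rlIntegral_one, ← h4, oddAux, Nat.cast_one,
        show (1 : ℝ) - 1 / 2 = 1 / 2 by norm_num, rlIntegral_congr (φ := fun v =>
          (-1) ^ m * (v ^ (-1 : ℝ) • rlIntegral (1 / 2) M v))]
      · rw [rlIntegral_const_mul, mul_smul_comm]
      · filter_upwards [hae] with v hv
        rw [hv.2, mul_smul_comm]
  have hda : HasDerivAt (oddAux 1 (iteratedDeriv m ψ))
      ((-1) ^ m * -fracBase (2 * m + 1) M s) s := by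
    refine (hd.const_mul ((-1) ^ m)).congr_of_eventuallyEq ?_
    filter_upwards [Ioi_mem_nhds hs] with u hu
    exact (hau u hu).2.2
  rw [FracDerivOddExists, fracDerivOdd, Nat.add_sub_cancel]
  refine ⟨⟨?_, hda.differentiableAt⟩, ?_⟩
  · filter_upwards [Ioi_mem_nhds hs] with u hu
    exact ⟨(hau u hu).1, (hau u hu).2.1⟩
  · rw [hda.deriv, fracBase, if_neg hodd, mul_neg, smul_neg, mul_smul_comm,
      sq_rpow_half (one_pos.trans hs), pow_succ]
    have : ((-1 : ℂ) ^ m) * (-1) ^ m = 1 := by rw [← mul_pow]; simp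
    linear_combination M s * this

/-! ### The mean value operator as a Riemann–Liouville integral of spherical means -/

/-- The mean of `f` over the sphere of radius `arcosh v` centred at `g x₀`. -/
noncomputable def sphereMean {n : ℕ} [NeZero n] (f : HypSpace n → ℂ) (g : SO0 n) (v : ℝ) : ℂ :=
  ∫ k, f (spherePoint g (k, v)) ∂rotHaar n

/-- The mean of `|f|` over the sphere of radius `arcosh v` centred at `g x₀`. -/
noncomputable def sphereAbsMean {n : ℕ} [NeZero n] (f : HypSpace n → ℂ) (g : SO0 n) (v : ℝ) :
    ℝ≥0∞ :=
  ∫⁻ k, ‖f (spherePoint g (k, v))‖ₑ ∂rotHaar n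

theorem horoPoint_eq {n d : ℕ} [NeZero n] (g : SO0 n) (t : ℝ) (k : Rot n)
    (w : EuclideanSpace ℝ (Fin d)) :
    (g * rot k * boost t * unip (tail n w)) • origin n = horoPoint g t (k, w) := by
  simp only [mul_smul, horoPoint]

section

variable {n d : ℕ} [NeZero n] {f : HypSpace n → ℂ}

theorem aestronglyMeasurable_restrict_prod (hn : 2 ≤ n)
    (hf : AEStronglyMeasurable f (hypMeasure n)) (g : SO0 n) {r : ℝ} (hr : 1 ≤ r) :
    AEStronglyMeasurable (fun p => f (spherePoint g p))
      ((rotHaar n).prod (volume.restrict (Ioi r))) :=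
  (aestronglyMeasurable_comp_spherePoint hn g hf).mono_ac
    (Measure.AbsolutelyContinuous.rfl.prod
      (Measure.restrict_mono (Ioi_subset_Ioi hr) le_rfl).absolutelyContinuous)

theorem aestronglyMeasurable_sphereMean (hn : 2 ≤ n)
    (hf : AEStronglyMeasurable f (hypMeasure n)) (g : SO0 n) {r : ℝ} (hr : 1 ≤ r) :
    AEStronglyMeasurable (sphereMean f g) (volume.restrict (Ioi r)) :=
  (aestronglyMeasurable_restrict_prod hn hf g hr).prod_swap.integral_prod_right'

theorem aemeasurable_sphereAbsMean (hn : 2 ≤ n)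
    (hf : AEStronglyMeasurable f (hypMeasure n)) (g : SO0 n) {r : ℝ} (hr : 1 ≤ r) :
    AEMeasurable (sphereAbsMean f g) (volume.restrict (Ioi r)) :=
  (aestronglyMeasurable_restrict_prod hn hf g hr).enorm.lintegral_prod_left'

theorem aestronglyMeasurable_map_horoPoint (hd : 1 ≤ d) (hdn : d ≤ n - 1)
    (hf : AEStronglyMeasurable f (hypMeasure n)) (g : SO0 n) (t : ℝ) :
    AEStronglyMeasurable f (Measure.map (horoPoint (d := d) g t) ((rotHaar n).prod volume)) := by
  rw [map_horoPoint hd hdn]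
  exact hf.mono_ac (map_spherePoint_absolutelyContinuous (by omega) g
    (withDensity_restrict_absolutelyContinuous (Real.one_le_cosh t) _))

/-- By `map_horoPoint`, both conditions say that f is integrable against one and the same image
measure. -/
theorem integrable_horoPoint_iff (hd : 1 ≤ d) (hdn : d ≤ n - 1)
    (hf : AEStronglyMeasurable f (hypMeasure n)) (g : SO0 n) (t : ℝ) :
    Integrable (fun p : Rot n × EuclideanSpace ℝ (Fin d) => f (horoPoint g t p))
        ((rotHaar n).prod volume) ↔
      Integrable (fun p => f (spherePoint g p)) ((rotHaar n).prod
        ((volume.restrict (Ioi (Real.cosh t))).withDensity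
          fun v => ENNReal.ofReal (horoDensity d t v))) := by
  have h := aestronglyMeasurable_map_horoPoint hd hdn hf g t
  have h1 := integrable_map_measure h (continuous_horoPoint g t).measurable.aemeasurable
  rw [map_horoPoint hd hdn] at h h1
  exact h1.symm.trans (integrable_map_measure h (measurable_spherePoint g).aemeasurable)

theorem integrable_horoPoint (hd : 1 ≤ d) (hdn : d ≤ n - 1)
    (hf : AEStronglyMeasurable f (hypMeasure n)) (g : SO0 n) (t : ℝ)
    (hfin : ∫⁻ v in Ioi (Real.cosh t), ENNReal.ofReal (horoDensity d t v)
      * sphereAbsMean f g v < ∞) :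
    Integrable (fun p : Rot n × EuclideanSpace ℝ (Fin d) => f (horoPoint g t p))
        ((rotHaar n).prod volume) := by
  rw [integrable_horoPoint_iff hd hdn hf g t]
  have hm : AEStronglyMeasurable (fun p => f (spherePoint g p)) ((rotHaar n).prod
      ((volume.restrict (Ioi (Real.cosh t))).withDensity
        fun v => ENNReal.ofReal (horoDensity d t v))) :=
    (aestronglyMeasurable_comp_spherePoint (by omega) g hf).mono_ac
      (Measure.AbsolutelyContinuous.rfl.prod
        (withDensity_restrict_absolutelyContinuous (Real.one_le_cosh t) _))
  refine ⟨hm, ?_⟩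
  rw [HasFiniteIntegral, lintegral_prod_symm _ hm.enorm]
  refine lt_of_eq_of_lt ?_ hfin
  exact lintegral_withDensity_eq_lintegral_mul₀
    (measurable_horoDensity d t).ennreal_ofReal.aemeasurable
    (aemeasurable_sphereAbsMean (by omega) hf g (Real.one_le_cosh t))

/-- Both sides are the integral of f against the common image measure; Fubini's theorem on the
second product brings out the spherical mean. -/
theorem integral_horoPoint (hd : 1 ≤ d) (hdn : d ≤ n - 1)
    (hf : AEStronglyMeasurable f (hypMeasure n)) (g : SO0 n) (t : ℝ)
    (hint : Integrable (fun p : Rot n × EuclideanSpace ℝ (Fin d) => f (horoPoint g t p))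
        ((rotHaar n).prod volume)) :
    ∫ k, ∫ w : EuclideanSpace ℝ (Fin d), f (horoPoint g t (k, w)) ∂volume ∂rotHaar n
      = ∫ v in Ioi (Real.cosh t), horoDensity d t v • sphereMean f g v := by
  have h := aestronglyMeasurable_map_horoPoint hd hdn hf g t
  have h1 := integral_map (continuous_horoPoint g t).measurable.aemeasurable h
  rw [map_horoPoint hd hdn] at h h1
  have h2 := integral_map (measurable_spherePoint g).aemeasurable h
  rw [h1] at h2
  have h3 := (integrable_horoPoint_iff hd hdn hf g t).mp hint
  rw [← integral_prod _ hint, h2, integral_prod_symm _ h3]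
  rw [integral_withDensity_eq_integral_toReal_smul
    (measurable_horoDensity d t).ennreal_ofReal (Eventually.of_forall fun v => by simp)]
  refine setIntegral_congr_fun measurableSet_Ioi fun v hv => ?_
  have h4 : 0 ≤ horoDensity d t v := by
    have h5 := meanConst_pos hd
    have h6 := Real.Gamma_pos_of_pos (show (0 : ℝ) < (d : ℝ) / 2 by
      have : (0 : ℝ) < d := by exact_mod_cast hd
      positivity)
    have h7 : 0 < v - Real.cosh t := sub_pos.mpr hv
    unfold horoDensity
    positivity
  simp only [ENNReal.toReal_ofReal h4, sphereMean]

theorem horoMean_eq (hd : 1 ≤ d) (hdn : d ≤ n - 1)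
    (hf : AEStronglyMeasurable f (hypMeasure n)) (g : SO0 n) (t : ℝ)
    (hint : Integrable (fun p : Rot n × EuclideanSpace ℝ (Fin d) => f (horoPoint g t p))
        ((rotHaar n).prod volume)) :
    horoMean (horoTransform f : Horosphere n d → ℂ) g t
      = (meanConst d * Real.exp (-(t * d / 2))) •
        rlIntegral (d / 2) (sphereMean f g) (Real.cosh t) := by
  simp only [horoMean, horoTransform_horosphere hdn, horoPoint_eq]
  rw [integral_horoPoint hd hdn hf g t hint, rlIntegral, smul_smul, ← integral_smul]
  simp only [horoDensity, rlIntegrand, smul_smul, mul_assoc]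

theorem integrable_horoTransform (hdn : d ≤ n - 1) (g : SO0 n) (t : ℝ)
    (hint : Integrable (fun p : Rot n × EuclideanSpace ℝ (Fin d) => f (horoPoint g t p))
        ((rotHaar n).prod volume)) :
    (∀ᵐ k ∂rotHaar n, Integrable fun w : EuclideanSpace ℝ (Fin d) =>
      f ((g * rot k * boost t * unip (tail n w)) • origin n)) ∧
    Integrable (fun k => horoTransform f (horosphere d (g * rot k * boost t))) (rotHaar n) := by
  simp only [horoTransform_horosphere hdn, horoPoint_eq]
  exact ⟨hint.prod_right_ae, hint.integral_prod_left⟩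

/-- The factor c⁻¹e^{td/2} in ψ is the inverse of the constant in `horoMean_eq`. From here on the
problem concerns functions of one real variable. -/
theorem psi_eq (hd : 1 ≤ d) (hdn : d ≤ n - 1)
    (hf : AEStronglyMeasurable f (hypMeasure n)) (g : SO0 n) {r : ℝ} (hr : 1 ≤ r)
    (hint : Integrable (fun p : Rot n × EuclideanSpace ℝ (Fin d) =>
      f (horoPoint g (Real.arcosh r) p)) ((rotHaar n).prod volume)) :
    psi (horoTransform f : Horosphere n d → ℂ) g r = rlIntegral (d / 2) (sphereMean f g) r := by
  rw [psi, horoMean_eq hd hdn hf g _ hint, Real.cosh_arcosh hr, smul_smul]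
  have h : (meanConst d)⁻¹ * Real.exp (Real.arcosh r * d / 2)
      * (meanConst d * Real.exp (-(Real.arcosh r * d / 2))) = 1 := by
    rw [Real.exp_neg]
    have := (meanConst_pos hd).ne'
    have := Real.exp_pos (Real.arcosh r * d / 2)
    field_simp
  rw [h, one_smul]

/-! ### Absolute convergence from a tail condition on spherical means -/

/-- Finiteness of `∫ₛ^∞ v^{d/2-1} M(v) dv` for all `s > 1`, where `M` is the spherical mean of
`|f|`. -/
def FiniteTail (d : ℕ) (f : HypSpace n → ℂ) (g : SO0 n) : Prop :=
  ∀ s > 1, ∫⁻ v in Ioi s, ENNReal.ofReal (v ^ ((d : ℝ) / 2 - 1)) * sphereAbsMean f g v < ∞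

theorem enorm_sphereMean_le (f : HypSpace n → ℂ) (g : SO0 n) (v : ℝ) :
    ‖sphereMean f g v‖ₑ ≤ sphereAbsMean f g v :=
  enorm_integral_le_lintegral_enorm _

theorem FiniteTail.ae_lt_top (hn : 2 ≤ n)
    (hf : AEStronglyMeasurable f (hypMeasure n)) {g : SO0 n} (h : FiniteTail d f g) {s : ℝ}
    (hs : 1 < s) : ∀ᵐ v ∂volume.restrict (Ioi s), sphereAbsMean f g v < ∞ := by
  have hm : AEMeasurable (fun v : ℝ => ENNReal.ofReal (v ^ ((d : ℝ) / 2 - 1)) * sphereAbsMean f g v)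
      (volume.restrict (Ioi s)) :=
    AEMeasurable.mul (by fun_prop) (aemeasurable_sphereAbsMean hn hf g hs.le)
  filter_upwards [ae_lt_top' hm (h s hs).ne, ae_restrict_mem measurableSet_Ioi] with v hv hsv
  have hv0 : (0 : ℝ) < v := by linarith [show s < v from hsv]
  refine lt_top_iff_ne_top.mpr fun h0 => ?_
  rw [h0, ENNReal.mul_top] at hv
  · exact lt_irrefl _ hv
  · simpa using Real.rpow_pos_of_pos hv0 _

theorem FiniteTail.tailIntegrable_of_le
    {g : SO0 n} (h : FiniteTail d f g) {M : ℝ → ℂ}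
    (hM : ∀ s > 1, AEStronglyMeasurable M (volume.restrict (Ioi s)))
    (hle : ∀ᵐ v ∂volume.restrict (Ioi (1 : ℝ)), ‖M v‖ₑ ≤ sphereAbsMean f g v) :
    TailIntegrable (d / 2) M := fun s hs => by
  have hm : AEStronglyMeasurable (fun v : ℝ => v ^ ((d : ℝ) / 2 - 1))
      (volume.restrict (Ioi s)) := by fun_prop
  refine ⟨hm.smul (hM s hs), lt_of_le_of_lt ?_ (h s hs)⟩
  refine lintegral_mono_ae ?_
  filter_upwards [ae_restrict_mem measurableSet_Ioi,
    ae_restrict_of_ae_restrict_of_subset (Ioi_subset_Ioi hs.le) hle] with v hsv hv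
  have hv0 : (0 : ℝ) < v := by linarith [show s < v from hsv]
  rw [enorm_smul, Real.enorm_of_nonneg (Real.rpow_nonneg hv0.le _)]
  gcongr

theorem FiniteTail.tailIntegrable (hn : 2 ≤ n)
    (hf : AEStronglyMeasurable f (hypMeasure n)) {g : SO0 n} (h : FiniteTail d f g) :
    TailIntegrable (d / 2) (sphereMean f g) :=
  h.tailIntegrable_of_le (fun _ hs => aestronglyMeasurable_sphereMean hn hf g (le_of_lt hs))
    (Eventually.of_forall fun v => enorm_sphereMean_le f g v)

theorem FiniteTail.tailIntegrable_abs (hn : 2 ≤ n)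
    (hf : AEStronglyMeasurable f (hypMeasure n)) {g : SO0 n} (h : FiniteTail d f g) :
    TailIntegrable (d / 2) (fun v => (((sphereAbsMean f g v).toReal : ℝ) : ℂ)) := by
  refine h.tailIntegrable_of_le (fun s hs => ?_) (Eventually.of_forall fun v => ?_)
  · exact ((aemeasurable_sphereAbsMean hn hf g (le_of_lt hs)).ennreal_toReal.complex_ofReal
      ).aestronglyMeasurable
  · rw [← ofReal_norm, Complex.norm_real, Real.norm_of_nonneg ENNReal.toReal_nonneg]
    exact ENNReal.ofReal_toReal_le

/-- As `horoDensity` is a constant multiple of the Riemann–Liouville kernel, convergence of the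
fractional integral of the mean of |f| is absolute convergence over K × ℝᵈ. -/
theorem FiniteTail.integrable_horoPoint (hd : 1 ≤ d) (hdn : d ≤ n - 1)
    (hf : AEStronglyMeasurable f (hypMeasure n)) {g : SO0 n} (h : FiniteTail d f g) {t : ℝ}
    (ht : 1 < Real.cosh t)
    (hint : IntegrableOn (rlIntegrand (d / 2)
      (fun v => (((sphereAbsMean f g v).toReal : ℝ) : ℂ)) (Real.cosh t)) (Ioi (Real.cosh t))) :
    Integrable (fun p : Rot n × EuclideanSpace ℝ (Fin d) => f (horoPoint g t p))
        ((rotHaar n).prod volume) := by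
  refine Horospherical.integrable_horoPoint hd hdn hf g t ?_
  have h5 := meanConst_pos hd
  have h6 := Real.Gamma_pos_of_pos (show (0 : ℝ) < (d : ℝ) / 2 by
    have : (0 : ℝ) < d := by exact_mod_cast hd
    positivity)
  have h7 := (hint.const_mul ((meanConst d * Real.exp (-(t * d / 2)) *
    (Real.Gamma (d / 2))⁻¹ : ℝ) : ℂ)).2
  refine lt_of_eq_of_lt ?_ h7
  refine lintegral_congr_ae ?_
  filter_upwards [ae_restrict_mem measurableSet_Ioi, h.ae_lt_top (by omega) hf ht] with v hv hfin
  have h8 : 0 < v - Real.cosh t := sub_pos.mpr hv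
  rw [rlIntegrand, enorm_mul, enorm_smul, Real.enorm_of_nonneg (by positivity),
    ← ofReal_norm, ← ofReal_norm, Complex.norm_real, Complex.norm_real,
    Real.norm_of_nonneg ENNReal.toReal_nonneg, ENNReal.ofReal_toReal hfin.ne,
    Real.norm_of_nonneg (by positivity), ← mul_assoc, ← ENNReal.ofReal_mul (by positivity),
    horoDensity]
  congr 2
  ring

/-- For d = 1 the kernel (v - r)^{-1/2} is unbounded, so the tail condition cannot give convergence
at every r; Tonelli's theorem gives it at almost every r. All t with cosh t = r are treated at once,
so both signs of t are covered. -/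
theorem FiniteTail.ae_integrable_horoPoint (hd : 1 ≤ d) (hdn : d ≤ n - 1)
    (hf : AEStronglyMeasurable f (hypMeasure n)) {g : SO0 n} (h : FiniteTail d f g) :
    ∀ᵐ r ∂volume.restrict (Ioi (1 : ℝ)), ∀ t, Real.cosh t = r →
      Integrable (fun p : Rot n × EuclideanSpace ℝ (Fin d) => f (horoPoint g t p))
        ((rotHaar n).prod volume) := by
  have hT := h.tailIntegrable_abs (by omega) hf
  have hd' : (1 : ℝ) ≤ d := by exact_mod_cast hd
  have hk : ∀ k : ℕ, ∀ᵐ r ∂volume.restrict (Ioi (1 : ℝ)), 1 + 1 / ((k : ℝ) + 1) < r →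
      IntegrableOn (rlIntegrand (d / 2)
      (fun v => (((sphereAbsMean f g v).toReal : ℝ) : ℂ)) r) (Ioi r) := fun k => by
    have hk0 : (0 : ℝ) < 1 / ((k : ℝ) + 1) := by positivity
    -- Only the almost everywhere convergence is used. The choice α = 1/2 makes α + d/2 ≥ 1 already
    -- for d = 1.
    have h1 := (rlIntegral_comp (α := 1 / 2) one_half_pos (by positivity) (by linarith) hT
      (show (1 : ℝ) < 1 + 1 / ((k : ℝ) + 1) by linarith)).1
    rw [ae_restrict_iff' measurableSet_Ioi] at h1 ⊢
    filter_upwards [h1] with r hr _ hkr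
    exact hr hkr
  filter_upwards [ae_all_iff.mpr hk, ae_restrict_mem measurableSet_Ioi] with r hr hr1 t ht
  obtain ⟨k, hk⟩ := exists_nat_one_div_lt (sub_pos.mpr (show (1 : ℝ) < r from hr1))
  refine h.integrable_horoPoint hd hdn hf (by rw [ht]; exact hr1) ?_
  rw [ht]
  exact hr k (by linarith)

/-- For d ≥ 2 the exponent d/2 - 1 is nonnegative, the kernel is dominated by v^{d/2-1}, and the
identity holds at every r > 1. -/
theorem FiniteTail.isRLIntegral (hd : 1 ≤ d) (hdn : d ≤ n - 1)
    (hf : AEStronglyMeasurable f (hypMeasure n)) {g : SO0 n} (h : FiniteTail d f g) :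
    IsRLIntegral d (sphereMean f g) (psi (horoTransform f : Horosphere n d → ℂ) g) where
  ae_eq := by
    filter_upwards [h.ae_integrable_horoPoint hd hdn hf, ae_restrict_mem measurableSet_Ioi]
      with r hr hr1
    exact psi_eq hd hdn hf g (le_of_lt hr1) (hr _ (Real.cosh_arcosh (le_of_lt hr1)))
  eq hd2 r hr := by
    have hd2' : (2 : ℝ) ≤ d := by exact_mod_cast hd2
    have hc := Real.cosh_arcosh (le_of_lt hr)
    refine psi_eq hd hdn hf g (le_of_lt hr) (h.integrable_horoPoint hd hdn hf
      (by rw [hc]; exact hr) ?_)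
    rw [hc]
    exact (h.tailIntegrable_abs (by omega) hf).rlIntegrand (by linarith) hr

end

/-! ### A continuous section of `SO₀(n,1) → ℍⁿ` -/

/-- The matrix of the reflection in the hyperplane orthogonal to `a` with respect to `form`. -/
noncomputable def formReflection {n : ℕ} (a : Fin (n + 1) → ℝ) :
    Matrix (Fin (n + 1)) (Fin (n + 1)) ℝ :=
  1 + Matrix.vecMulVec a (-(2 / form a a) • (gram n *ᵥ a))

theorem formReflection_mulVec {n : ℕ} (a x : Fin (n + 1) → ℝ) :
    formReflection a *ᵥ x = x - (2 * form a x / form a a) • a := by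
  have h : (gram n *ᵥ a) ⬝ᵥ x = form a x := by rw [form_comm, form_eq, dotProduct_comm]
  ext i
  simp only [formReflection, Matrix.add_mulVec, Matrix.one_mulVec, Matrix.vecMulVec_mulVec,
    smul_dotProduct, Pi.add_apply, Pi.sub_apply, Pi.smul_apply, smul_eq_mul,
    MulOpposite.smul_eq_mul_unop, MulOpposite.unop_op, h]
  ring

theorem det_formReflection {n : ℕ} {a : Fin (n + 1) → ℝ} (ha : form a a ≠ 0) :
    (formReflection a).det = -1 := by
  have h : (gram n *ᵥ a) ⬝ᵥ a = form a a := by rw [form_eq, dotProduct_comm]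
  rw [formReflection, Matrix.vecMulVec_eq Unit,
    Matrix.det_one_add_replicateCol_mul_replicateRow, smul_dotProduct, smul_eq_mul, h]
  field_simp
  norm_num

theorem form_formReflection {n : ℕ} {a : Fin (n + 1) → ℝ} (ha : form a a ≠ 0)
    (x y : Fin (n + 1) → ℝ) :
    form (formReflection a *ᵥ x) (formReflection a *ᵥ y) = form x y := by
  have h : ∀ z : Fin (n + 1) → ℝ, z - (2 * form a z / form a a) • a
      = z + (-(2 * form a z / form a a)) • a := fun z => by module
  rw [formReflection_mulVec, formReflection_mulVec, h, h]
  simp only [form_add_left, form_add_right, form_smul_left, form_smul_right, form_comm x a]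
  field_simp
  ring

theorem form_add_origin {n : ℕ} (x : HypSpace n) :
    form (x.1 + (origin n).1) (x.1 + (origin n).1) = 2 * (1 + height x) := by
  have h1 : form x.1 x.1 = 1 := x.2.1
  simp only [form_add_left, form_add_right, form_comm x.1 (origin n).1, form_origin_left,
    height_origin, h1]
  ring

/-- The element of `SO₀(n,1)` that maps `x₀` to `x` and is the identity on the orthogonal complement
of `x₀` and `x`. -/
noncomputable def translation {n : ℕ} (x : HypSpace n) : SO0 n :=
  -- The reflection in x₀ sends x₀ to -x₀, and the reflection in x + x₀ sends -x₀ to x; two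
  -- determinants -1 multiply to 1.
  ⟨formReflection (x.1 + (origin n).1) * formReflection (origin n).1, by
    have h1 : form (x.1 + (origin n).1) (x.1 + (origin n).1) ≠ 0 := by
      rw [form_add_origin]; linarith [height_pos x]
    have h2 : form (origin n).1 (origin n).1 = 1 := (origin n).2.1
    have h3 : form (origin n).1 (origin n).1 ≠ 0 := by rw [h2]; exact one_ne_zero
    refine ⟨gram_of_form_mulVec fun y z => ?_, ?_, ?_⟩
    · rw [← Matrix.mulVec_mulVec, ← Matrix.mulVec_mulVec, form_formReflection h1,
        form_formReflection h3]
    · rw [Matrix.det_mul, det_formReflection h1, det_formReflection h3]; norm_num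
    · refine lt_of_lt_of_eq ?_ (mulVec_single_last _)
      rw [← Matrix.mulVec_mulVec, formReflection_mulVec,
        formReflection_mulVec, form_add_origin, h2]
      have h4 := height_pos x
      have h5 := height_origin n
      have h6 : form (x.1 + (origin n).1) ((origin n).1 - (2 * 1 / 1 : ℝ) • (origin n).1)
          = -(1 + height x) := by
        have : (origin n).1 - (2 * 1 / 1 : ℝ) • (origin n).1 = (-1 : ℝ) • (origin n).1 := by module
        rw [this, form_smul_right, form_add_left, form_comm x.1, form_origin_left, h2]
        ring
      unfold height at h4 h5 h6
      rw [h6]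
      simp only [Pi.sub_apply, Pi.smul_apply, Pi.add_apply, smul_eq_mul, h5, height]
      field_simp
      ring_nf
      positivity⟩

theorem translation_smul {n : ℕ} (x y : HypSpace n) :
    (translation x • y).1 = y.1 - ((form x.1 y.1 + height y) / (1 + height x)) •
      (x.1 + (origin n).1) + (2 * height y) • x.1 := by
  have h2 : form (origin n).1 (origin n).1 = 1 := (origin n).2.1
  have h4 := height_pos x
  change (formReflection (x.1 + (origin n).1) * formReflection (origin n).1) *ᵥ y.1 = _
  rw [← Matrix.mulVec_mulVec, formReflection_mulVec, formReflection_mulVec, form_add_origin, h2,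
    form_origin_left]
  have h6 : form (x.1 + (origin n).1) (y.1 - (2 * height y / 1) • (origin n).1)
      = form x.1 y.1 + height y - 2 * height y * (1 + height x) := by
    have : y.1 - (2 * height y / 1) • (origin n).1 = y.1 + (-(2 * height y)) • (origin n).1 := by
      module
    rw [this, form_add_right, form_smul_right, form_add_left, form_add_left, form_origin_left,
      form_comm x.1 (origin n).1, form_origin_left, h2]
    ring
  rw [h6]
  ext i
  simp only [Pi.sub_apply, Pi.add_apply, Pi.smul_apply, smul_eq_mul]
  field_simp
  ring

theorem translation_smul_origin {n : ℕ} (x : HypSpace n) : translation x • origin n = x := by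
  refine Subtype.ext ?_
  have h4 := height_pos x
  rw [translation_smul, form_comm, form_origin_left, height_origin, add_comm (height x),
    div_self (by linarith)]
  module

/-- Joint continuity is the purpose of this section: it makes spherical means measurable functions
of centre and radius together. -/
theorem continuous_translation_smul {n : ℕ} :
    Continuous fun p : HypSpace n × HypSpace n => translation p.1 • p.2 := by
  refine Continuous.subtype_mk (f := fun p : HypSpace n × HypSpace n => (translation p.1 • p.2).1)
    ?_ _
  simp only [translation_smul]
  have h1 := continuous_form (n := n)
  have h2 : Continuous fun p : HypSpace n × HypSpace n => height p.1 :=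
    continuous_height.comp continuous_fst
  have h3 : Continuous fun p : HypSpace n × HypSpace n => height p.2 :=
    continuous_height.comp continuous_snd
  have h4 : ∀ p : HypSpace n × HypSpace n, 1 + height p.1 ≠ 0 := fun p => by
    linarith [height_pos p.1]
  fun_prop (disch := assumption)

theorem height_le_two_mul_form_mul_height {n : ℕ} (x y : HypSpace n) :
    height x ≤ 2 * form x.1 y.1 * height y :=
  height_le_form x y _ (translation_smul_origin y)

/-! ### Compact subsets of the hyperbolic space -/

/-- The set is closed, and xᵢ² ≤ `height x` ^ 2 - 1 bounds every other coordinate by the height. -/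
theorem isCompact_setOf_height_le {n : ℕ} (R : ℝ) : IsCompact {x : HypSpace n | height x ≤ R} := by
  rw [Subtype.isCompact_iff]
  have himg : ((↑) : HypSpace n → Fin (n + 1) → ℝ) '' {x | height x ≤ R}
      = {x | form x x = 1} ∩ {x | 1 ≤ x (Fin.last n)} ∩ {x | x (Fin.last n) ≤ R} := by
    ext x
    constructor
    · rintro ⟨y, hy, rfl⟩
      exact ⟨⟨y.2.1, one_le_height y⟩, hy⟩
    · rintro ⟨⟨h1, h2⟩, h3⟩
      exact ⟨⟨x, h1, lt_of_lt_of_le one_pos h2⟩, h3, rfl⟩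
  have hform : Continuous fun x : Fin (n + 1) → ℝ => form x x := by unfold form; fun_prop
  have hclosed : IsClosed ({x : Fin (n + 1) → ℝ | form x x = 1} ∩ {x | 1 ≤ x (Fin.last n)} ∩
      {x | x (Fin.last n) ≤ R}) :=
    ((isClosed_eq hform continuous_const).inter
      (isClosed_le continuous_const (continuous_apply _))).inter
      (isClosed_le (continuous_apply _) continuous_const)
  rw [himg]
  refine (isCompact_univ_pi fun _ : Fin (n + 1) =>
    isCompact_Icc (a := -R) (b := R)).of_isClosed_subset hclosed ?_
  rw [← himg]
  rintro _ ⟨y, hy, rfl⟩ i -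
  have hy' : height y ≤ R := hy
  have h0 := height_pos y
  rw [mem_Icc, ← abs_le]
  refine le_trans ?_ hy'
  refine Fin.lastCases (abs_of_pos h0).le (fun i => ?_) i
  have h1 := sum_sq_eq y
  have h2 : y.1 i.castSucc ^ 2 ≤ height y ^ 2 - 1 := h1 ▸ Finset.single_le_sum
    (f := fun j : Fin n => y.1 j.castSucc ^ 2) (fun j _ => sq_nonneg _) (Finset.mem_univ i)
  exact abs_le_of_sq_le_sq (by linarith) h0.le

/-- Continuous functions that vanish at infinity are uniformly continuous with respect to the
invariant distance. -/
theorem exists_norm_sub_lt_of_form_lt {n : ℕ} {f : HypSpace n → ℂ} (hf : Continuous f)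
    (h0 : ∀ ε > 0, ∃ R, ∀ x, R < height x → ‖f x‖ < ε) {ε : ℝ} (hε : 0 < ε) :
    ∃ δ > 0, ∀ x y : HypSpace n, form x.1 y.1 < 1 + δ → ‖f y - f x‖ < ε := by
  obtain ⟨R, hR⟩ := h0 (ε / 2) (half_pos hε)
  -- K collects the pairs of bounded height that violate the estimate. It is compact and misses the
  -- diagonal, so `form` has a minimum greater than 1 on it.
  set K : Set (HypSpace n × HypSpace n) :=
    ({x | height x ≤ 4 * R} ×ˢ {x | height x ≤ 4 * R}) ∩ {p | ε ≤ ‖f p.2 - f p.1‖} with hK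
  have hcomp : IsCompact K :=
    ((isCompact_setOf_height_le _).prod (isCompact_setOf_height_le _)).inter_right
      (isClosed_le continuous_const (by fun_prop))
  have hmin : ∃ δ > 0, δ ≤ 1 ∧ ∀ p ∈ K, 1 + δ ≤ form p.1.1 p.2.1 := by
    rcases K.eq_empty_or_nonempty with he | hne
    · exact ⟨1, one_pos, le_rfl, by simp [he]⟩
    · obtain ⟨p, hp, hpmin⟩ := hcomp.exists_isMinOn hne continuous_form.continuousOn
      have h1 : 1 < form p.1.1 p.2.1 := by
        refine lt_of_le_of_ne (one_le_form _ _) fun h => ?_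
        have h2 : ε ≤ ‖f p.2 - f p.1‖ := hp.2
        rw [eq_of_form_eq_one h.symm, sub_self, norm_zero] at h2
        linarith
      refine ⟨min 1 (form p.1.1 p.2.1 - 1), lt_min one_pos (sub_pos.mpr h1), min_le_left _ _,
        fun q hq => ?_⟩
      have h3 : form p.1.1 p.2.1 ≤ form q.1.1 q.2.1 := hpmin hq
      linarith [min_le_right 1 (form p.1.1 p.2.1 - 1)]
  obtain ⟨δ, hδ, hδ1, hδK⟩ := hmin
  refine ⟨δ, hδ, fun x y hxy => ?_⟩
  by_contra! hcon
  have hform := one_le_form x y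
  have hx0 := height_pos x
  have hy0 := height_pos y
  have hyx := height_le_two_mul_form_mul_height y x
  have hxy' := height_le_two_mul_form_mul_height x y
  rw [form_comm] at hyx
  -- Because δ ≤ 1, `form x y` < 2 and the two heights differ by a factor of at most 4. So either
  -- both exceed R, where f is below ε/2, or both are at most 4R.
  have hyx2 : height y ≤ 4 * height x := hyx.trans (by nlinarith)
  have hxy2 : height x ≤ 4 * height y := hxy'.trans (by nlinarith)
  by_cases hsmall : R < height x ∧ R < height y
  · have := norm_sub_le (f y) (f x)
    linarith [hR x hsmall.1, hR y hsmall.2]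
  · have hor : height x ≤ R ∨ height y ≤ R := by
      by_contra! h
      exact hsmall h
    have hmem : height x ≤ 4 * R ∧ height y ≤ 4 * R := by
      rcases hor with h | h <;> constructor <;> linarith
    exact absurd (hδK (x, y) ⟨⟨hmem.1, hmem.2⟩, hcon⟩) (not_le.mpr hxy)

/-! ### Inversion for continuous functions -/

theorem nonneg_of_decay {n : ℕ} {f : HypSpace n → ℂ} {μ C : ℝ}
    (hC : ∀ x, ‖f x‖ ≤ C * height x ^ (-μ)) : 0 ≤ C := by
  have := hC (origin n)
  rw [height_origin, Real.one_rpow, mul_one] at this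
  exact (norm_nonneg _).trans this

theorem exists_norm_lt_of_decay {n : ℕ} {f : HypSpace n → ℂ} {μ C : ℝ}
    (hμ : 0 < μ) (hC : ∀ x, ‖f x‖ ≤ C * height x ^ (-μ))
    {ε : ℝ} (hε : 0 < ε) : ∃ R, ∀ x, R < height x → ‖f x‖ < ε := by
  have h : Tendsto (fun h : ℝ => C * h ^ (-μ)) atTop (𝓝 (C * 0)) :=
    (tendsto_rpow_neg_atTop hμ).const_mul C
  rw [mul_zero] at h
  obtain ⟨R, hR⟩ := (h.eventually (gt_mem_nhds hε)).exists_forall_of_atTop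
  exact ⟨R, fun x hx => (hC x).trans_lt (hR _ hx.le)⟩

/-- Decay in the height is decay in the distance from any other centre x, at the cost of the factor
(2 `height x`)^μ, since b ≤ `form x y` ≤ 2 `height x` `height y`. -/
theorem norm_le_of_le_form {n : ℕ} {f : HypSpace n → ℂ} {μ C : ℝ}
    (hμ : 0 < μ) (hC : ∀ x, ‖f x‖ ≤ C * height x ^ (-μ)) {x y : HypSpace n} {b : ℝ}
    (hb : 0 < b) (hbf : b ≤ form x.1 y.1) :
    ‖f y‖ ≤ C * (2 * height x) ^ μ * b ^ (-μ) := by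
  have hx := height_pos x
  refine (hC y).trans ?_
  rw [mul_assoc]
  refine mul_le_mul_of_nonneg_left ?_ (nonneg_of_decay hC)
  have h1 : b / (2 * height x) ≤ height y := by
    rw [div_le_iff₀ (by positivity)]
    linarith [form_le x y]
  refine (Real.rpow_le_rpow_of_nonpos (by positivity) h1 (by linarith)).trans_eq ?_
  rw [Real.div_rpow hb.le (by positivity), Real.rpow_neg (by positivity : 0 ≤ 2 * height x),
    div_inv_eq_mul, mul_comm]

section

variable {n d : ℕ} [NeZero n] {f : HypSpace n → ℂ}

theorem boost_zero : (boost 0 : SO0 n) = 1 := by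
  refine Subtype.ext ?_
  change boostMatrix n 0 = 1
  simp [boostMatrix]

theorem height_unip_smul_origin (hdn : d ≤ n - 1) (w : EuclideanSpace ℝ (Fin d)) :
    height ((unip (tail n w) : SO0 n) • origin n) = 1 + ‖w‖ ^ 2 / 2 := by
  simpa [boost_zero] using height_boost_smul_unip hdn 0 w

theorem continuousOn_comp_spherePoint (hf : Continuous f) (g : SO0 n) (k : Rot n) :
    ContinuousOn (fun v => f (spherePoint g (k, v))) (Ici 1) :=
  hf.comp_continuousOn ((continuousOn_spherePoint g).comp (by fun_prop)
    fun v hv => ⟨mem_univ _, hv⟩)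

theorem continuous_comp_spherePoint (hf : Continuous f) (g : SO0 n) {v : ℝ} (hv : 1 ≤ v) :
    Continuous fun k => f (spherePoint g (k, v)) :=
  hf.comp (continuousOn_univ.mp ((continuousOn_spherePoint g).comp (f := fun k : Rot n => (k, v))
    (by fun_prop) fun k _ => ⟨mem_univ _, hv⟩))

theorem continuousOn_sphereMean (hf : Continuous f) {C : ℝ} (hC : ∀ x, ‖f x‖ ≤ C) (g : SO0 n) :
    ContinuousOn (sphereMean f g) (Ici 1) :=
  continuousOn_of_dominated (bound := fun _ => C)
    (fun _ hv => (continuous_comp_spherePoint hf g hv).aestronglyMeasurable)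
    (fun _ _ => Eventually.of_forall fun _ => hC _) (integrable_const C)
    (Eventually.of_forall fun k => continuousOn_comp_spherePoint hf g k)

theorem norm_sphereMean_sub_le (hf : Continuous f) (g : SO0 n) {v ε : ℝ} (hv : 1 ≤ v) {c : ℂ}
    (h : ∀ y : HypSpace n, form (g • origin n).1 y.1 = v → ‖f y - c‖ ≤ ε) :
    ‖sphereMean f g v - c‖ ≤ ε := by
  have hint : Integrable (fun k => f (spherePoint g (k, v))) (rotHaar n) :=
    (continuous_comp_spherePoint hf g hv).integrable_of_hasCompactSupport
      (HasCompactSupport.of_compactSpace _)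
  have h1 : sphereMean f g v - c = ∫ k, (f (spherePoint g (k, v)) - c) ∂rotHaar n := by
    rw [integral_sub hint (integrable_const c), integral_const]
    simp [sphereMean]
  rw [h1]
  refine (norm_integral_le_of_norm_le_const
    (Eventually.of_forall fun k => h _ (form_spherePoint g k hv))).trans ?_
  simp

/-- A continuous function vanishing at infinity is the uniform limit of its spherical means. -/
theorem tendstoUniformly_sphereMean (hf : Continuous f)
    (h0 : ∀ ε > 0, ∃ R, ∀ x, R < height x → ‖f x‖ < ε) (r : HypSpace n → SO0 n)
    (hr : ∀ x, r x • origin n = x) :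
    TendstoUniformly (fun s x => sphereMean f (r x) s) f (𝓝[>] 1) := by
  rw [Metric.tendstoUniformly_iff]
  intro ε hε
  obtain ⟨δ, hδ, h⟩ := exists_norm_sub_lt_of_form_lt hf h0 (half_pos hε)
  filter_upwards [Ioo_mem_nhdsGT (show (1 : ℝ) < 1 + δ by linarith)] with s hs x
  rw [dist_comm, dist_eq_norm]
  refine lt_of_le_of_lt (norm_sphereMean_sub_le hf _ hs.1.le fun y hy => ?_) (half_lt_self hε)
  rw [hr] at hy
  exact (h x y (by rw [hy]; exact hs.2)).le

/-- The spherical mean of |f| is O(v^{-μ}), and v^{d/2-1-μ} is integrable at infinity because μ >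
d/2. -/
theorem finiteTail_of_decay {μ C : ℝ} (hd : 1 ≤ d) (hμ : (d : ℝ) / 2 < μ)
    (hC : ∀ x, ‖f x‖ ≤ C * height x ^ (-μ)) (g : SO0 n) : FiniteTail d f g := fun s hs => by
  have hd' : (1 : ℝ) ≤ d := by exact_mod_cast hd
  set A := C * (2 * height (g • origin n)) ^ μ with hA
  have hint : IntegrableOn (fun v : ℝ => A * v ^ ((d : ℝ) / 2 - 1 - μ)) (Ioi s) :=
    (integrableOn_Ioi_rpow_of_lt (by linarith) (by linarith)).const_mul A
  refine lt_of_le_of_lt ?_ hint.2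
  refine setLIntegral_mono' measurableSet_Ioi fun v hv => ?_
  have hv0 : (0 : ℝ) < v := by linarith [show s < v from hv]
  have hbound : sphereAbsMean f g v ≤ ENNReal.ofReal (A * v ^ (-μ)) := by
    refine (lintegral_mono (g := fun _ => ENNReal.ofReal (A * v ^ (-μ))) fun k => ?_).trans_eq
      (by simp)
    rw [← ofReal_norm]
    exact ENNReal.ofReal_le_ofReal (norm_le_of_le_form (by linarith) hC hv0
      (form_spherePoint g k (by linarith [show s < v from hv])).ge)
  have hA0 : 0 ≤ A := by
    have := nonneg_of_decay hC
    have := height_pos (g • origin n)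
    positivity
  calc _ ≤ ENNReal.ofReal (v ^ ((d : ℝ) / 2 - 1)) * ENNReal.ofReal (A * v ^ (-μ)) := by gcongr
    _ = ‖A * v ^ ((d : ℝ) / 2 - 1 - μ)‖ₑ := by
      rw [← ENNReal.ofReal_mul (by positivity), Real.enorm_of_nonneg (by positivity),
        sub_eq_add_neg _ μ, Real.rpow_add hv0]
      congr 1
      ring

theorem integrable_one_add_norm_sq {μ : ℝ} (hμ : (d : ℝ) / 2 < μ) :
    Integrable fun w : EuclideanSpace ℝ (Fin d) => (1 + ‖w‖ ^ 2) ^ (-μ) := by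
  have h := integrable_rpow_neg_one_add_norm_sq (E := EuclideanSpace ℝ (Fin d)) (μ := volume)
    (r := 2 * μ) (by simp only [finrank_euclideanSpace_fin]; linarith)
  simpa [neg_div, mul_div_cancel_left₀] using h

/-- A direct domination by (1 + |w|²)^{-μ}, integrable on ℝᵈ because 2μ > d. Unlike the argument
through `FiniteTail`, it covers every t, including t = 0 and d = 1. -/
theorem integrable_horoPoint_of_decay (hdn : d ≤ n - 1) {μ C : ℝ} (hd : 1 ≤ d)
    (hμ : (d : ℝ) / 2 < μ) (hf : Continuous f) (hC : ∀ x, ‖f x‖ ≤ C * height x ^ (-μ))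
    (g : SO0 n) (t : ℝ) :
    Integrable (fun p : Rot n × EuclideanSpace ℝ (Fin d) => f (horoPoint g t p))
      ((rotHaar n).prod volume) := by
  have hd' : (1 : ℝ) ≤ d := by exact_mod_cast hd
  -- Chosen so that cosh t + eᵗ|w|²/2 ≥ c(1 + |w|²).
  set c := min 1 (Real.exp t / 2) with hc
  have hc0 : 0 < c := lt_min one_pos (half_pos (Real.exp_pos t))
  refine Integrable.mono' (((integrable_one_add_norm_sq hμ).comp_snd (rotHaar n)).const_mul
    (C * (2 * height (g • origin n)) ^ μ * c ^ (-μ)))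
    (hf.comp (continuous_horoPoint g t)).aestronglyMeasurable (Eventually.of_forall fun p => ?_)
  refine (norm_le_of_le_form (x := g • origin n) (b := c * (1 + ‖p.2‖ ^ 2)) (by linarith) hC
    (by positivity) ?_).trans_eq ?_
  · rw [horoPoint, form_smul_smul, form_origin_left, height_rot_smul, height_boost_smul_unip hdn]
    have h1 := Real.one_le_cosh t
    have h2 : c ≤ 1 := min_le_left _ _
    have h3 : c ≤ Real.exp t / 2 := min_le_right _ _
    nlinarith [sq_nonneg ‖p.2‖]
  · rw [Real.mul_rpow hc0.le (by positivity)]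
    ring

theorem integrable_horosphere_of_decay (hdn : d ≤ n - 1) {μ C : ℝ} (hd : 1 ≤ d)
    (hμ : (d : ℝ) / 2 < μ) (hf : Continuous f) (hC : ∀ x, ‖f x‖ ≤ C * height x ^ (-μ))
    (g : SO0 n) :
    Integrable fun w : EuclideanSpace ℝ (Fin d) => f ((g * unip (tail n w)) • origin n) := by
  have hd' : (1 : ℝ) ≤ d := by exact_mod_cast hd
  have hcont : Continuous fun w : EuclideanSpace ℝ (Fin d) =>
      f ((g * unip (tail n w)) • origin n) := by
    simp only [mul_smul]
    exact hf.comp ((continuous_smul_left g).comp continuous_unip_smul_origin)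
  refine Integrable.mono' ((integrable_one_add_norm_sq hμ).const_mul
    (C * (2 * height (g • origin n)) ^ μ * (1 / 2) ^ (-μ)))
    hcont.aestronglyMeasurable (Eventually.of_forall fun w => ?_)
  refine (norm_le_of_le_form (x := g • origin n) (b := 1 / 2 * (1 + ‖w‖ ^ 2)) (by linarith) hC
    (by positivity) ?_).trans_eq ?_
  · rw [mul_smul, form_smul_smul, form_origin_left, height_unip_smul_origin hdn]
    linarith
  · rw [Real.mul_rpow (x := (1 / 2 : ℝ)) (by norm_num) (by positivity)]
    ring

/-- Spherical means of a bounded continuous function are continuous in the radius, so the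
fundamental theorem of calculus applies at every s > 1. -/
theorem hasDerivAt_tailPrim_sphereMean (hd : 1 ≤ d) {C : ℝ} (hf : Continuous f)
    (hC : ∀ x, ‖f x‖ ≤ C) {g : SO0 n} (hT : TailIntegrable (d / 2) (sphereMean f g)) {s : ℝ}
    (hs : 1 < s) : HasDerivAt (tailPrim (fracBase d (sphereMean f g)))
      (-fracBase d (sphereMean f g) s) s := by
  refine hasDerivAt_tailPrim_of_continuousOn (fun s hs => integrableOn_fracBase hd hT hs) ?_ hs
  have h := (continuousOn_sphereMean hf hC g).mono Ioi_subset_Ici_self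
  unfold fracBase
  split_ifs
  · exact h
  · have hpow : ContinuousOn (fun v : ℝ => v ^ (-(1 / 2 : ℝ))) (Ioi 1) := fun v hv =>
      (Real.continuousAt_rpow_const _ _ (Or.inl (by linarith [show (1 : ℝ) < v from hv]))
        ).continuousWithinAt
    exact hpow.smul h

end

/-! ### Spherical means as functions of the centre -/

theorem apply_last_of_smul_origin {n : ℕ} {h : SO0 n} (hh : h • origin n = origin n)
    (i : Fin (n + 1)) : h.1 i (Fin.last n) = (origin n).1 i := by
  have h1 : (h • origin n).1 i = (origin n).1 i := by rw [hh]
  rw [coe_smul] at h1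
  simpa [origin] using h1

theorem apply_last_left_of_smul_origin {n : ℕ} {h : SO0 n} (hh : h • origin n = origin n)
    (j : Fin (n + 1)) : h.1 (Fin.last n) j = (origin n).1 j := by
  have h1 := form_mulVec_of_gram h.2.1 (origin n).1 (Pi.single j 1)
  have h2 : h.1 *ᵥ (origin n).1 = (origin n).1 := congrArg Subtype.val hh
  rw [h2] at h1
  simp only [origin, form_single_last] at h1
  rw [Matrix.mulVec_single_one] at h1
  simpa [origin, Pi.single_comm] using h1

theorem height_smul_of_smul_origin {n : ℕ} {h : SO0 n} (hh : h • origin n = origin n)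
    (y : HypSpace n) : height (h • y) = height y := by
  rw [← form_origin_left, ← form_origin_left]
  conv_lhs => rw [← hh]
  exact form_smul_smul h _ _

/-- The stabilizer of the origin consists of rotations. -/
theorem exists_rot_smul_eq {n : ℕ} {h : SO0 n} (hh : h • origin n = origin n) :
    ∃ k : Rot n, ∀ y : HypSpace n, h • y = rot k • y := by
  obtain ⟨B, hB⟩ : ∃ B : Matrix (Fin n) (Fin n) ℝ, ∀ i j, B i j = h.1 i.castSucc j.castSucc :=
    ⟨fun i j => h.1 i.castSucc j.castSucc, fun _ _ => rfl⟩
  have h0 : ∀ i : Fin n, (origin n).1 i.castSucc = 0 := fun i => by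
    simp [origin, Fin.castSucc_ne_last]
  -- Fixing x₀ determines the last column of h, and preserving the form then determines the last
  -- row.
  have hblock : h.1 = Matrix.reindex finSumFinEquiv finSumFinEquiv
      (Matrix.fromBlocks B 0 0 (1 : Matrix (Fin 1) (Fin 1) ℝ)) := by
    ext i j
    obtain ⟨i, rfl⟩ := (finSumFinEquiv (m := n) (n := 1)).surjective i
    obtain ⟨j, rfl⟩ := (finSumFinEquiv (m := n) (n := 1)).surjective j
    have hr : ∀ i : Fin 1, finSumFinEquiv (m := n) (Sum.inr i) = Fin.last n := fun i => by
      rw [Subsingleton.elim i 0]; rfl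
    have hl : ∀ i : Fin n, finSumFinEquiv (n := 1) (Sum.inl i) = i.castSucc := fun i => rfl
    rcases i with i | i <;> rcases j with j | j <;>
      rw [Matrix.reindex_apply, Matrix.submatrix_apply, Equiv.symm_apply_apply,
        Equiv.symm_apply_apply] <;>
      simp only [Matrix.fromBlocks_apply₁₁, Matrix.fromBlocks_apply₁₂,
        Matrix.fromBlocks_apply₂₁, Matrix.fromBlocks_apply₂₂, hr, hl,
        apply_last_of_smul_origin hh, apply_last_left_of_smul_origin hh, h0,
        Matrix.zero_apply, hB]
    rw [Subsingleton.elim i j, Matrix.one_apply_eq]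
    exact height_origin n
  have hdet : B.det = 1 := by
    have := h.2.2.1
    rwa [hblock, Matrix.det_reindex_self, Matrix.det_fromBlocks_zero₂₁, Matrix.det_one,
      mul_one] at this
  have horth : Bᵀ * B = 1 := by
    ext i j
    have h1 := form_mulVec_of_gram h.2.1 (Pi.single i.castSucc 1) (Pi.single j.castSucc 1)
    rw [Matrix.mulVec_single_one, Matrix.mulVec_single_one] at h1
    simp only [form, Matrix.col_apply, apply_last_left_of_smul_origin hh, h0] at h1
    simp only [Matrix.mul_apply, Matrix.transpose_apply, hB, Matrix.one_apply, eq_comm (a := i)]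
    simp only [Pi.single_apply, Fin.castSucc_inj, (Fin.castSucc_ne_last _).symm] at h1
    simpa using h1
  refine ⟨⟨B, ?_⟩, fun y => Subtype.ext (funext fun i => ?_)⟩
  · rw [Matrix.mem_specialOrthogonalGroup_iff, Matrix.mem_orthogonalGroup_iff']
    exact ⟨horth, hdet⟩
  · refine Fin.lastCases ?_ (fun i => ?_) i
    · exact (height_smul_of_smul_origin hh y).trans (height_rot_smul _ y).symm
    · rw [rot_smul_castSucc, coe_smul]
      simp [Matrix.mulVec, dotProduct, Fin.sum_univ_castSucc, apply_last_of_smul_origin hh, h0, hB]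

section

variable {n : ℕ} [NeZero n]

/-- Two elements that carry x₀ to the same point differ by a rotation, which left invariance
absorbs. This lets the arbitrary choice r_x be exchanged for the continuous one. -/
theorem sphereMean_congr (f : HypSpace n → ℂ) {g g' : SO0 n} (hg : g • origin n = g' • origin n)
    (v : ℝ) : sphereMean f g v = sphereMean f g' v := by
  have hh : (g⁻¹ * g') • origin n = origin n := by rw [mul_smul, ← hg, inv_smul_smul]
  obtain ⟨k, hk⟩ := exists_rot_smul_eq hh
  rw [sphereMean, sphereMean, ← integral_mul_left_eq_self (μ := rotHaar n) _ k]
  congr 1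
  funext l
  simp only [spherePoint, rot_mul, mul_smul]
  rw [← hk, mul_smul, smul_inv_smul]

/-- A null set of ℍⁿ meets almost every sphere about a fixed centre in a null set of that sphere. -/
theorem sphereMean_ae_eq (hn : 2 ≤ n) {f f' : HypSpace n → ℂ} (h : f =ᵐ[hypMeasure n] f')
    (g : SO0 n) : ∀ᵐ v ∂volume.restrict (Ioi (1 : ℝ)),
      (fun k => f (spherePoint g (k, v))) =ᵐ[rotHaar n] fun k => f' (spherePoint g (k, v)) := by
  have h1 := (map_spherePoint_absolutelyContinuous hn g (Measure.AbsolutelyContinuous.rfl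
    (μ := volume.restrict (Ioi (1 : ℝ))))).ae_le h
  have h2 := ae_of_ae_map (measurable_spherePoint g).aemeasurable h1
  rw [← Measure.prod_swap] at h2
  exact Measure.ae_ae_of_ae_prod (ae_of_ae_map measurable_swap.aemeasurable h2)

theorem spherePoint_eq_smul (g : SO0 n) (p : Rot n × ℝ) :
    spherePoint g p = g • spherePoint 1 p := by simp [spherePoint]

theorem measurable_spherePoint_translation : Measurable fun q : (HypSpace n × ℝ) × Rot n =>
    spherePoint (translation q.1.1) (q.2, q.1.2) := by
  have h : Measurable fun q : (HypSpace n × ℝ) × Rot n =>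
      (q.1.1, spherePoint (1 : SO0 n) (q.2, q.1.2)) :=
    (measurable_fst.comp measurable_fst).prodMk ((measurable_spherePoint 1).comp
      (measurable_snd.prodMk (measurable_snd.comp measurable_fst)))
  have h2 := (continuous_translation_smul (n := n)).measurable.comp h
  simp only [spherePoint_eq_smul (translation _)]
  exact h2

/-- The mean of `f` over the sphere of radius `arcosh v` centred at `x`. -/
noncomputable def meanValue (f : HypSpace n → ℂ) (p : HypSpace n × ℝ) : ℂ :=
  sphereMean f (translation p.1) p.2

theorem stronglyMeasurable_meanValue {f : HypSpace n → ℂ} (hf : StronglyMeasurable f) :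
    StronglyMeasurable (meanValue f) :=
  (hf.comp_measurable measurable_spherePoint_translation).integral_prod_right'

theorem measurable_lintegral_spherePoint {F : HypSpace n → ℝ≥0∞} (hF : Measurable F) :
    Measurable fun p : HypSpace n × ℝ =>
      ∫⁻ k, F (spherePoint (translation p.1) (k, p.2)) ∂rotHaar n :=
  (hF.comp measurable_spherePoint_translation).lintegral_prod_right'

instance instSFiniteHypMeasure (n : ℕ) : SFinite (hypMeasure n) := by
  unfold hypMeasure; infer_instance

/-- The mean value operators preserve integrals over the hyperbolic space. -/
theorem ae_lintegral_lintegral_spherePoint (hn : 2 ≤ n) {F : HypSpace n → ℝ≥0∞}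
    (hF : Measurable F) : ∀ᵐ s ∂volume.restrict (Ioi (1 : ℝ)),
      ∫⁻ x, ∫⁻ k, F (spherePoint (translation x) (k, s)) ∂rotHaar n ∂hypMeasure n
        = ∫⁻ x, F x ∂hypMeasure n := by
  have hL : Measurable fun p : HypSpace n × ℝ =>
      ∫⁻ k, F (spherePoint (translation p.1) (k, p.2)) ∂rotHaar n :=
    measurable_lintegral_spherePoint hF
  have hw : Measurable fun s => ENNReal.ofReal (hypWeight n s) :=
    (measurable_hypWeight n).ennreal_ofReal
  have hform : Measurable fun p : HypSpace n × HypSpace n => form p.1.1 p.2.1 :=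
    continuous_form.measurable
  -- Both sides are integrated over an arbitrary set A of radii, which is why the conclusion holds
  -- only for almost every s. The left side becomes the double integral of 1_A(form x y) F(y), and
  -- this kernel is symmetric in x and y.
  have key : (fun s => ENNReal.ofReal (hypWeight n s) *
      ∫⁻ x, ∫⁻ k, F (spherePoint (translation x) (k, s)) ∂rotHaar n ∂hypMeasure n)
      =ᵐ[volume.restrict (Ioi (1 : ℝ))]
      fun s => ENNReal.ofReal (hypWeight n s) * ∫⁻ x, F x ∂hypMeasure n := by
    refine ae_eq_of_forall_setLIntegral_eq_of_sigmaFinite (hw.mul hL.lintegral_prod_left')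
      (hw.mul measurable_const) fun A hA _ => ?_
    have hind : Measurable (A.indicator (1 : ℝ → ℝ≥0∞)) := measurable_one.indicator hA
    have hmean : ∀ (x : HypSpace n) (F : HypSpace n → ℝ≥0∞), Measurable F →
        ∫⁻ y, A.indicator 1 (form x.1 y.1) * F y ∂hypMeasure n
          = ∫⁻ s in A, ENNReal.ofReal (hypWeight n s) *
            ∫⁻ k, F (spherePoint (translation x) (k, s)) ∂rotHaar n
              ∂volume.restrict (Ioi (1 : ℝ)) := fun x F hF => by
      have hsec : Measurable fun y : HypSpace n => form x.1 y.1 :=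
        hform.comp measurable_prodMk_left
      refine (lintegral_spherePoint hn (translation x) _ ((hind.comp hsec).mul hF)).trans ?_
      rw [← lintegral_indicator hA]
      refine setLIntegral_congr_fun measurableSet_Ioi fun s hs => ?_
      have h1 : ∀ k, form x.1 (spherePoint (translation x) (k, s)).1 = s := fun k => by
        have := form_spherePoint (translation x) k (le_of_lt hs)
        rwa [translation_smul_origin] at this
      simp only [Pi.mul_apply, Function.comp_apply, h1]
      by_cases hsA : s ∈ A <;> simp [hsA]
    calc _ = ∫⁻ s in A, ∫⁻ x, ENNReal.ofReal (hypWeight n s) *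
            ∫⁻ k, F (spherePoint (translation x) (k, s)) ∂rotHaar n ∂hypMeasure n
              ∂volume.restrict (Ioi (1 : ℝ)) := by
          refine lintegral_congr fun s => ?_
          exact (lintegral_const_mul _ (hL.comp measurable_prodMk_right)).symm
      _ = ∫⁻ x, ∫⁻ s in A, ENNReal.ofReal (hypWeight n s) *
            ∫⁻ k, F (spherePoint (translation x) (k, s)) ∂rotHaar n
              ∂volume.restrict (Ioi (1 : ℝ)) ∂hypMeasure n := by
          refine lintegral_lintegral_swap ?_
          exact ((hw.comp measurable_fst).mul (hL.comp measurable_swap)).aemeasurable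
      _ = ∫⁻ x, ∫⁻ y, A.indicator 1 (form x.1 y.1) * F y ∂hypMeasure n ∂hypMeasure n :=
          lintegral_congr fun x => (hmean x F hF).symm
      _ = ∫⁻ y, ∫⁻ x, A.indicator 1 (form x.1 y.1) * F y ∂hypMeasure n ∂hypMeasure n := by
          refine lintegral_lintegral_swap ?_
          exact ((hind.comp hform).mul (hF.comp measurable_snd)).aemeasurable
      -- With the order exchanged, the integral in x is the volume of a union of spheres about y. By
      -- `hmean` for the constant function 1 it does not depend on y.
      _ = ∫⁻ y, F y * ∫⁻ s in A, ENNReal.ofReal (hypWeight n s)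
            ∂volume.restrict (Ioi (1 : ℝ)) ∂hypMeasure n := by
          refine lintegral_congr fun y => ?_
          have h1 := hmean y 1 measurable_one
          simp only [Pi.one_apply, mul_one, lintegral_one, measure_univ] at h1
          rw [← h1, ← lintegral_const_mul]
          · simp only [form_comm y.1, mul_comm]
          · exact hind.comp (hform.comp measurable_prodMk_left)
      _ = _ := by rw [lintegral_mul_const _ hF, lintegral_mul_const _ hw, mul_comm]
  filter_upwards [key, ae_restrict_mem measurableSet_Ioi] with s hs hs1
  exact (ENNReal.mul_right_inj (by simpa using hypWeight_pos hs1) ENNReal.ofReal_ne_top).mp hs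

end

/-! ### Inversion for functions of the class `Lᵖ` -/

/-- If a ≥ b, then a = a^{1-p} a^p ≤ b^{1-p} a^p. This pointwise bound takes the place of Hölder's
inequality, and it includes p = 1. -/
theorem le_add_rpow_mul {p a b : ℝ} (hp : 1 ≤ p) (ha : 0 ≤ a) (hb : 0 < b) :
    a ≤ b + b ^ (1 - p) * a ^ p := by
  rcases le_total a b with h | h
  · have : 0 ≤ b ^ (1 - p) * a ^ p := by positivity
    linarith
  · have ha0 : 0 < a := hb.trans_le h
    have h1 : a ^ (1 - p) ≤ b ^ (1 - p) := Real.rpow_le_rpow_of_nonpos hb h (by linarith)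
    have h2 : a ^ (1 - p) * a ^ p = a := by
      rw [← Real.rpow_add ha0, sub_add_cancel, Real.rpow_one]
    have h3 : a ^ (1 - p) * a ^ p ≤ b ^ (1 - p) * a ^ p := by gcongr
    linarith

/-- Away from v = 1 one has v² - 1 ≥ (1 - s⁻²) v², so the weight dominates a multiple of v^{n-2}. -/
theorem exists_rpow_le_hypWeight {n : ℕ} [NeZero n] (hn : 2 ≤ n) {s β : ℝ} (hs : 1 < s)
    (hβ : β ≤ (n : ℝ) - 2) : ∃ C : ℝ, ∀ v, s < v → v ^ β ≤ C * hypWeight n v := by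
  have hn' : (2 : ℝ) ≤ n := by exact_mod_cast hn
  set σ := (volume : Measure (EuclideanSpace ℝ (Fin n))).toSphere.real univ with hσ
  set c := 1 - (s ^ 2)⁻¹ with hc
  have hs2 : 1 < s ^ 2 := by nlinarith
  have hc0 : 0 < c := sub_pos.mpr (inv_lt_one_of_one_lt₀ hs2)
  have hσ0 : 0 < σ := by
    have h := hypWeight_pos (n := n) (one_lt_two)
    exact pos_of_mul_pos_left h (by positivity)
  refine ⟨(σ * c ^ (((n : ℝ) - 2) / 2))⁻¹, fun v hv => ?_⟩
  have hv0 : 0 < v := by linarith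
  have h1 : c * v ^ 2 ≤ v ^ 2 - 1 := by
    have h2 : s ^ 2 ≤ v ^ 2 := by nlinarith
    have h3 : 1 ≤ (s ^ 2)⁻¹ * v ^ 2 := by
      rw [inv_mul_eq_div, le_div_iff₀ (by positivity)]; linarith
    rw [hc]
    linarith
  have h4 : c ^ (((n : ℝ) - 2) / 2) * v ^ ((n : ℝ) - 2) ≤ (v ^ 2 - 1) ^ (((n : ℝ) - 2) / 2) := by
    have h5 : (v ^ 2) ^ (((n : ℝ) - 2) / 2) = v ^ ((n : ℝ) - 2) := by
      rw [← Real.rpow_natCast, ← Real.rpow_mul hv0.le]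
      congr 1
      push_cast
      ring
    rw [← h5, ← Real.mul_rpow hc0.le (by positivity)]
    exact Real.rpow_le_rpow (by positivity) h1 (by linarith)
  have h6 : v ^ β ≤ v ^ ((n : ℝ) - 2) :=
    Real.rpow_le_rpow_of_exponent_le (by linarith) hβ
  refine h6.trans ?_
  rw [inv_mul_eq_div, le_div_iff₀ (by positivity), hypWeight]
  calc _ = σ * (c ^ (((n : ℝ) - 2) / 2) * v ^ ((n : ℝ) - 2)) := by ring
    _ ≤ _ := by gcongr

theorem lintegral_enorm_rpow_lt_top {α : Type*} [MeasurableSpace α] {μ : Measure α} {p : ℝ}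
    (hp : 1 ≤ p) {f : α → ℂ} (hf : MemLp f (ENNReal.ofReal p) μ) :
    ∫⁻ x, ‖f x‖ₑ ^ p ∂μ < ∞ := by
  have h := lintegral_rpow_enorm_lt_top_of_eLpNorm_lt_top
    (by simpa using one_pos.trans_le hp) ENNReal.ofReal_ne_top hf.2
  rwa [ENNReal.toReal_ofReal (by linarith)] at h

theorem eLpNorm_ofReal_eq {α : Type*} [MeasurableSpace α] {μ : Measure α} {p : ℝ}
    (hp : 1 ≤ p) (f : α → ℂ) :
    eLpNorm f (ENNReal.ofReal p) μ = (∫⁻ x, ‖f x‖ₑ ^ p ∂μ) ^ (1 / p) := by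
  rw [eLpNorm_eq_lintegral_rpow_enorm_toReal (by simpa using one_pos.trans_le hp)
    ENNReal.ofReal_ne_top, ENNReal.toReal_ofReal (by linarith)]

section

variable {n d : ℕ} [NeZero n] {f : HypSpace n → ℂ}

theorem FiniteTail.congr (hn : 2 ≤ n) {f' : HypSpace n → ℂ} {g : SO0 n} (h : FiniteTail d f g)
    (hff' : f =ᵐ[hypMeasure n] f') : FiniteTail d f' g := fun s hs => by
  refine lt_of_eq_of_lt (lintegral_congr_ae ?_) (h s hs)
  filter_upwards [ae_restrict_of_ae_restrict_of_subset (Ioi_subset_Ioi (le_of_lt hs))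
    (sphereMean_ae_eq hn hff' g)] with v hv
  rw [sphereAbsMean, sphereAbsMean]
  congr 1
  refine lintegral_congr_ae ?_
  filter_upwards [hv] with k hk
  rw [hk]

/-- Compare |f| with v^{-γ} by `le_add_rpow_mul`: v^{d/2-1}|f| ≤ v^{d/2-1-γ} +
v^{d/2-1+γ(p-1)}|f|^p. The first term is integrable if γ > d/2. The second is controlled by the Lᵖ
norm in polar coordinates if its exponent is at most n - 2. Both can be arranged exactly because p <
2(n - 1)/d. -/
theorem finiteTail_of_memLp (hd : 1 ≤ d) (hdn : d ≤ n - 1) {p : ℝ} (hp : 1 ≤ p)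
    (hpn : p < 2 * ((n : ℝ) - 1) / d) (hf : MemLp f (ENNReal.ofReal p) (hypMeasure n))
    (g : SO0 n) : FiniteTail d f g := by
  have hn : 2 ≤ n := by omega
  wlog hfm : StronglyMeasurable f generalizing f
  · have h1 := this (f := hf.1.mk f) (hf.ae_eq hf.1.ae_eq_mk) hf.1.stronglyMeasurable_mk
    exact h1.congr hn hf.1.ae_eq_mk.symm
  intro s hs
  have hd0 : (0 : ℝ) < d := by exact_mod_cast hd
  rw [lt_div_iff₀ hd0] at hpn
  -- With γ = d/2 + ε the exponent condition reads pd/2 + ε(p - 1) ≤ n - 1, which εp = n - 1 - pd/2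
  -- guarantees.
  set ε := ((n : ℝ) - 1 - p * d / 2) / p with hε
  have hp0 : 0 < p := by linarith
  have hε0 : 0 < ε := div_pos (by linarith) hp0
  have hεp : ε * p = (n : ℝ) - 1 - p * d / 2 := by rw [hε]; field_simp
  set γ := (d : ℝ) / 2 + ε with hγ
  obtain ⟨C, hC⟩ := exists_rpow_le_hypWeight hn hs
    (show (d : ℝ) / 2 - 1 + γ * (p - 1) ≤ (n : ℝ) - 2 by rw [hγ]; nlinarith)
  have hC0 : 0 ≤ C := by
    have h1 := hC (s + 1) (by linarith)
    have h2 := hypWeight_pos (n := n) (show 1 < s + 1 by linarith)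
    have h3 : 0 < (s + 1) ^ ((d : ℝ) / 2 - 1 + γ * (p - 1)) := Real.rpow_pos_of_pos (by linarith) _
    exact (pos_of_mul_pos_left (h3.trans_le h1) h2.le).le
  have hm : Measurable fun v : ℝ => ENNReal.ofReal (v ^ ((d : ℝ) / 2 - 1 - γ)) := by fun_prop
  have hF : Measurable fun x => ‖f x‖ₑ ^ p := hfm.measurable.enorm.pow_const p
  have hle : ∀ v ∈ Ioi s, ENNReal.ofReal (v ^ ((d : ℝ) / 2 - 1)) * sphereAbsMean f g v ≤
      ENNReal.ofReal (v ^ ((d : ℝ) / 2 - 1 - γ)) + ENNReal.ofReal C *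
        (ENNReal.ofReal (hypWeight n v) * ∫⁻ k, ‖f (spherePoint g (k, v))‖ₑ ^ p ∂rotHaar n) := by
    intro v hv
    have hsv : s < v := hv
    have hv0 : 0 < v := by linarith
    have hpt : ∀ k, ENNReal.ofReal (v ^ ((d : ℝ) / 2 - 1)) * ‖f (spherePoint g (k, v))‖ₑ
        ≤ ENNReal.ofReal (v ^ ((d : ℝ) / 2 - 1 - γ)) + ENNReal.ofReal C *
          (ENNReal.ofReal (hypWeight n v) * ‖f (spherePoint g (k, v))‖ₑ ^ p) := fun k => by
      set a := ‖f (spherePoint g (k, v))‖ with ha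
      have ha0 : 0 ≤ a := norm_nonneg _
      have hw := hypWeight_pos (n := n) (show 1 < v by linarith)
      have h1 := le_add_rpow_mul hp ha0 (Real.rpow_pos_of_pos hv0 (-γ))
      rw [← ofReal_norm, ENNReal.ofReal_rpow_of_nonneg ha0 hp0.le,
        ← ENNReal.ofReal_mul hw.le, ← ENNReal.ofReal_mul hC0, ← ENNReal.ofReal_mul (by positivity),
        ← ENNReal.ofReal_add (by positivity) (by positivity)]
      refine ENNReal.ofReal_le_ofReal ?_
      have h2 : v ^ ((d : ℝ) / 2 - 1) * v ^ (-γ) = v ^ ((d : ℝ) / 2 - 1 - γ) := by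
        rw [← Real.rpow_add hv0, sub_eq_add_neg _ γ]
      have h3 : v ^ ((d : ℝ) / 2 - 1) * (v ^ (-γ)) ^ (1 - p)
          = v ^ ((d : ℝ) / 2 - 1 + γ * (p - 1)) := by
        rw [← Real.rpow_mul hv0.le, ← Real.rpow_add hv0]
        congr 1
        ring
      calc _ ≤ v ^ ((d : ℝ) / 2 - 1) * (v ^ (-γ) + (v ^ (-γ)) ^ (1 - p) * a ^ p) := by gcongr
        _ = v ^ ((d : ℝ) / 2 - 1 - γ) + v ^ ((d : ℝ) / 2 - 1 + γ * (p - 1)) * a ^ p := by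
          rw [← h2, ← h3]; ring
        _ ≤ v ^ ((d : ℝ) / 2 - 1 - γ) + C * hypWeight n v * a ^ p := by
          gcongr
          exact hC v hsv
        _ = _ := by ring
    have hsec : Measurable fun k : Rot n => spherePoint g (k, v) :=
      (measurable_spherePoint g).comp measurable_prodMk_right
    have hFs := hF.comp hsec
    rw [sphereAbsMean, ← lintegral_const_mul' _ _ ENNReal.ofReal_ne_top]
    refine (lintegral_mono hpt).trans_eq ?_
    rw [lintegral_add_left measurable_const, lintegral_const, measure_univ, mul_one,
      lintegral_const_mul' _ _ ENNReal.ofReal_ne_top,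
      lintegral_const_mul' _ _ ENNReal.ofReal_ne_top]
  refine (setLIntegral_mono' measurableSet_Ioi hle).trans_lt ?_
  rw [lintegral_add_left hm, lintegral_const_mul' _ _ ENNReal.ofReal_ne_top]
  refine ENNReal.add_lt_top.mpr ⟨?_, ENNReal.mul_lt_top ENNReal.ofReal_lt_top ?_⟩
  · have hint : IntegrableOn (fun v : ℝ => v ^ ((d : ℝ) / 2 - 1 - γ)) (Ioi s) :=
      integrableOn_Ioi_rpow_of_lt (by rw [hγ]; linarith) (by linarith)
    exact (hasFiniteIntegral_iff_ofReal (by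
      filter_upwards [ae_restrict_mem measurableSet_Ioi] with v hv
      exact Real.rpow_nonneg (by linarith [show s < v from hv]) _)).mp hint.2
  · refine (lintegral_mono_set (Ioi_subset_Ioi (le_of_lt hs))).trans_lt ?_
    rw [← lintegral_spherePoint hn g _ hF]
    exact lintegral_enorm_rpow_lt_top hp hf

/-- On (1, ∞) `Real.arcosh` is differentiable and so maps null sets to null sets. The exceptional t
lie in such an image, in its reflection, or at 0. -/
theorem ae_of_ae_cosh {P : ℝ → Prop}
    (h : ∀ᵐ r ∂volume.restrict (Ioi (1 : ℝ)), ∀ t, Real.cosh t = r → P t) : ∀ᵐ t : ℝ, P t := by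
  rw [ae_restrict_iff' measurableSet_Ioi] at h
  set Z : Set ℝ := {r | ¬ (r ∈ Ioi (1 : ℝ) → ∀ t, Real.cosh t = r → P t)} with hZ
  have hZ0 : volume Z = 0 := h
  have hZ1 : Z ⊆ Ioi 1 := fun r hr => by
    by_contra hcon
    exact hr fun h => absurd h hcon
  have him : volume (Real.arcosh '' Z) = 0 :=
    addHaar_image_eq_zero_of_differentiableOn_of_addHaar_eq_zero _ (fun r hr =>
      (Real.hasDerivAt_arcosh (hZ1 hr)).differentiableAt.differentiableWithinAt) hZ0
  have h1 : ∀ᵐ t : ℝ, t ∉ Real.arcosh '' Z := measure_eq_zero_iff_ae_notMem.mp him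
  have h2 : ∀ᵐ t : ℝ, -t ∉ Real.arcosh '' Z :=
    (Measure.measurePreserving_neg (volume : Measure ℝ)).quasiMeasurePreserving.ae h1
  have h3 : ∀ᵐ t : ℝ, t ≠ 0 := Measure.ae_ne volume 0
  filter_upwards [h1, h2, h3] with t ht1 ht2 ht3
  by_contra hcon
  have hmem : Real.cosh t ∈ Z := fun h => hcon (h (Real.one_lt_cosh.mpr ht3) t rfl)
  rcases le_total 0 t with h0 | h0
  · exact ht1 ⟨_, hmem, Real.arcosh_cosh h0⟩
  · refine ht2 ⟨_, hmem, ?_⟩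
    rw [← Real.cosh_neg]
    exact Real.arcosh_cosh (by linarith)

end

/-! ### Measurability of the set of differentiability points -/

/-- For continuous F, rational increments suffice to test differentiability. The criterion uses
countably many conditions, hence describes a measurable set. -/
theorem hasDerivAt_iff_forall_rat {F : ℝ → ℂ} (hc : ContinuousOn F (Ioi 1)) {c : ℂ} {s : ℝ}
    (hs : 1 < s) : HasDerivAt F c s ↔ ∀ k : ℕ, ∃ j : ℕ, ∀ q : ℚ, |(q : ℝ)| < 1 / ((j : ℝ) + 1) →
      ‖F (s + q) - F s - (q : ℝ) • c‖ ≤ 1 / ((k : ℝ) + 1) * |(q : ℝ)| := by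
  rw [hasDerivAt_iff_isLittleO_nhds_zero, Asymptotics.isLittleO_iff]
  constructor
  · intro h k
    obtain ⟨δ, hδ, hball⟩ := Metric.eventually_nhds_iff.mp
      (h (show (0 : ℝ) < 1 / ((k : ℝ) + 1) by positivity))
    obtain ⟨j, hj⟩ := exists_nat_one_div_lt hδ
    exact ⟨j, fun q hq => hball (by
      rw [dist_zero_right, Real.norm_eq_abs]; exact hq.trans hj)⟩
  · intro h ε hε
    obtain ⟨k, hk⟩ := exists_nat_one_div_lt hε
    obtain ⟨j, hj⟩ := h k
    have hj0 : (0 : ℝ) < 1 / ((j : ℝ) + 1) := by positivity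
    set δ := min (1 / ((j : ℝ) + 1)) (s - 1) with hδ
    have hδ0 : 0 < δ := lt_min hj0 (by linarith)
    filter_upwards [Ioo_mem_nhds (neg_lt_zero.mpr hδ0) hδ0] with x hx
    have hcont : ContinuousOn (fun y : ℝ => ‖F (s + y) - F s - y • c‖ - ε * |y|) (Ioo (-δ) δ) := by
      have h1 : ContinuousOn (fun y : ℝ => F (s + y)) (Ioo (-δ) δ) :=
        hc.comp (by fun_prop) fun y hy => by
          have := min_le_right (1 / ((j : ℝ) + 1)) (s - 1)
          have := hy.1
          simp only [mem_Ioi]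
          linarith
      exact ((h1.sub continuousOn_const).sub (by fun_prop)).norm.sub (by fun_prop)
    -- Failure of the estimate is an open condition on the increment, so it would also occur at some
    -- rational one.
    by_contra! hcon
    have hopen := hcont.isOpen_inter_preimage isOpen_Ioo (isOpen_Ioi (a := (0 : ℝ)))
    obtain ⟨q, hq⟩ := Rat.denseRange_cast (𝕜 := ℝ) |>.exists_mem_open hopen
      ⟨x, hx, by simpa using hcon⟩
    have hq1 : |(q : ℝ)| < 1 / ((j : ℝ) + 1) :=
      (abs_lt.mpr hq.1).trans_le (min_le_left _ _)
    have hq2 : 0 < ‖F (s + q) - F s - (q : ℝ) • c‖ - ε * |(q : ℝ)| := hq.2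
    have hq3 := hj q hq1
    have hq4 : 1 / ((k : ℝ) + 1) * |(q : ℝ)| ≤ ε * |(q : ℝ)| := by gcongr
    linarith

theorem measurableSet_hasDerivAt {α : Type*} [MeasurableSpace α] {F G : α × ℝ → ℂ}
    (hF : Measurable F) (hG : Measurable G) (hc : ∀ a, ContinuousOn (fun s => F (a, s)) (Ioi 1)) :
    MeasurableSet {p : α × ℝ | 1 < p.2 ∧ HasDerivAt (fun s => F (p.1, s)) (G p) p.2} := by
  have heq : {p : α × ℝ | 1 < p.2 ∧ HasDerivAt (fun s => F (p.1, s)) (G p) p.2}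
      = {p | 1 < p.2} ∩ ⋂ k : ℕ, ⋃ j : ℕ, ⋂ q : ℚ, ⋂ _ : |(q : ℝ)| < 1 / ((j : ℝ) + 1),
        {p | ‖F (p.1, p.2 + q) - F p - (q : ℝ) • G p‖ ≤ 1 / ((k : ℝ) + 1) * |(q : ℝ)|} := by
    ext p
    simp only [mem_inter_iff, mem_iInter, mem_iUnion, mem_ofPred_eq]
    exact and_congr_right fun h => (hasDerivAt_iff_forall_rat (hc p.1) h)
  rw [heq]
  refine (measurableSet_lt measurable_const measurable_snd).inter
    (MeasurableSet.iInter fun k => MeasurableSet.iUnion fun j => MeasurableSet.iInter fun q =>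
      MeasurableSet.iInter fun _ => measurableSet_le ?_ measurable_const)
  have h1 : Measurable fun p : α × ℝ => F (p.1, p.2 + q) := hF.comp (by fun_prop)
  fun_prop

/-! ### Convergence in `Lᵖ` -/

theorem IsRLIntegral.congr {d : ℕ} {M M' ψ : ℝ → ℂ} (h : IsRLIntegral d M ψ)
    (hM : ∀ᵐ v ∂volume.restrict (Ioi (1 : ℝ)), M v = M' v) : IsRLIntegral d M' ψ where
  ae_eq := by
    filter_upwards [h.ae_eq, ae_restrict_mem measurableSet_Ioi] with r hr hr1
    rw [hr]
    exact rlIntegral_congr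
      (ae_restrict_of_ae_restrict_of_subset (Ioi_subset_Ioi (le_of_lt hr1)) hM)
  eq hd r hr := by
    rw [h.eq hd r hr]
    exact rlIntegral_congr
      (ae_restrict_of_ae_restrict_of_subset (Ioi_subset_Ioi (le_of_lt hr)) hM)

/-- Jensen's inequality, obtained from the monotonicity of Lᵖ norms in p on a probability space. -/
theorem enorm_integral_rpow_le {α : Type*} [MeasurableSpace α] {ν : Measure α}
    [IsProbabilityMeasure ν] {p : ℝ} (hp : 1 ≤ p) {u : α → ℂ} (hu : AEStronglyMeasurable u ν) :
    ‖∫ x, u x ∂ν‖ₑ ^ p ≤ ∫⁻ x, ‖u x‖ₑ ^ p ∂ν := by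
  have h1 : ‖∫ x, u x ∂ν‖ₑ ≤ (∫⁻ x, ‖u x‖ₑ ^ p ∂ν) ^ (1 / p) := by
    rw [← eLpNorm_ofReal_eq hp]
    refine (enorm_integral_le_lintegral_enorm _).trans ?_
    rw [← eLpNorm_one_eq_lintegral_enorm]
    exact eLpNorm_le_eLpNorm_of_exponent_le (by simpa using hp) hu
  calc _ ≤ ((∫⁻ x, ‖u x‖ₑ ^ p ∂ν) ^ (1 / p)) ^ p := by gcongr
    _ = _ := by rw [← ENNReal.rpow_mul, one_div_mul_cancel (by linarith), ENNReal.rpow_one]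

section

variable {n d : ℕ} [NeZero n]

theorem measurable_spherePoint_translation_left (x : HypSpace n) (s : ℝ) :
    Measurable fun k : Rot n => spherePoint (translation x) (k, s) :=
  (measurable_spherePoint _).comp measurable_prodMk_right

/-- The contraction property: Jensen's inequality on each sphere, then preservation of the integral
of ‖h‖^p. -/
theorem eLpNorm_meanValue_le (hn : 2 ≤ n) {p : ℝ} (hp : 1 ≤ p) {h : HypSpace n → ℂ}
    (hm : StronglyMeasurable h) : ∀ᵐ s ∂volume.restrict (Ioi (1 : ℝ)),
      eLpNorm (fun x => meanValue h (x, s)) (ENNReal.ofReal p) (hypMeasure n)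
        ≤ eLpNorm h (ENNReal.ofReal p) (hypMeasure n) := by
  filter_upwards [ae_lintegral_lintegral_spherePoint hn (hm.measurable.enorm.pow_const p)] with s hs
  rw [eLpNorm_ofReal_eq hp, eLpNorm_ofReal_eq hp, ← hs]
  gcongr with x
  exact enorm_integral_rpow_le hp
    (hm.comp_measurable (measurable_spherePoint_translation_left x s)).aestronglyMeasurable

/-- Needed for additivity of the means, since an integral over a sphere is set to zero when it
diverges. -/
theorem ae_ae_integrable_spherePoint (hn : 2 ≤ n) {p : ℝ} (hp : 1 ≤ p) {h : HypSpace n → ℂ}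
    (hm : StronglyMeasurable h) (hh : MemLp h (ENNReal.ofReal p) (hypMeasure n)) :
    ∀ᵐ s ∂volume.restrict (Ioi (1 : ℝ)), ∀ᵐ x ∂hypMeasure n,
      Integrable (fun k => h (spherePoint (translation x) (k, s))) (rotHaar n) := by
  have hpow : Measurable fun x => ‖h x‖ₑ ^ p := hm.measurable.enorm.pow_const p
  filter_upwards [ae_lintegral_lintegral_spherePoint hn hpow] with s hs
  have hsm := (measurable_lintegral_spherePoint hpow).comp
    (measurable_prodMk_right (α := HypSpace n) (y := s))
  simp only [Function.comp_def] at hsm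
  have hfin := (lintegral_enorm_rpow_lt_top hp hh).ne
  rw [← hs] at hfin
  filter_upwards [ae_lt_top hsm hfin] with x hx
  have hLp : MemLp (fun k => h (spherePoint (translation x) (k, s))) (ENNReal.ofReal p)
      (rotHaar n) := by
    refine ⟨(hm.comp_measurable
      (measurable_spherePoint_translation_left x s)).aestronglyMeasurable, ?_⟩
    rw [eLpNorm_ofReal_eq hp]
    exact ENNReal.rpow_lt_top_of_nonneg (by positivity) hx.ne
  exact hLp.integrable (by simpa using hp)

theorem eLpNorm_meanValue_sub_le (hn : 2 ≤ n) {p : ℝ} (hp : 1 ≤ p) {f g : HypSpace n → ℂ}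
    (hf : StronglyMeasurable f) (hg : StronglyMeasurable g)
    (hfp : MemLp f (ENNReal.ofReal p) (hypMeasure n))
    (hgp : MemLp g (ENNReal.ofReal p) (hypMeasure n)) : ∀ᵐ s ∂volume.restrict (Ioi (1 : ℝ)),
      eLpNorm (fun x => meanValue f (x, s) - meanValue g (x, s)) (ENNReal.ofReal p) (hypMeasure n)
        ≤ eLpNorm (f - g) (ENNReal.ofReal p) (hypMeasure n) := by
  filter_upwards [ae_ae_integrable_spherePoint hn hp hf hfp,
    ae_ae_integrable_spherePoint hn hp hg hgp, eLpNorm_meanValue_le hn hp (hf.sub hg)]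
    with s hsf hsg hs
  refine (eLpNorm_congr_ae ?_).trans_le hs
  filter_upwards [hsf, hsg] with x hxf hxg
  simp only [meanValue, sphereMean, Pi.sub_apply]
  rw [integral_sub hxf hxg]

/-! ### Local finiteness and regularity of the invariant measure -/

/-- For n ≥ 2 the weight has a nonnegative exponent, so it is bounded on (1, R]. -/
theorem hypMeasure_setOf_height_le_lt_top (hn : 2 ≤ n) (R : ℝ) :
    hypMeasure n {x | height x ≤ R} < ∞ := by
  have hn' : (2 : ℝ) ≤ n := by exact_mod_cast hn
  have hm : MeasurableSet {x : HypSpace n | height x ≤ R} :=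
    measurableSet_le continuous_height.measurable measurable_const
  rw [← lintegral_indicator_one hm, lintegral_spherePoint hn 1 _ (measurable_one.indicator hm)]
  have hle : ∀ v ∈ Ioi (1 : ℝ), ENNReal.ofReal (hypWeight n v) *
      ∫⁻ k, {x | height x ≤ R}.indicator 1 (spherePoint (1 : SO0 n) (k, v)) ∂rotHaar n
      ≤ (Iic R).indicator (fun _ => ENNReal.ofReal (hypWeight n (max R 1))) v := fun v hv => by
    have hv1 : (1 : ℝ) < v := hv
    have hh : ∀ k, height (spherePoint (1 : SO0 n) (k, v)) = v := fun k => by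
      rw [← form_origin_left]
      simpa using form_spherePoint (1 : SO0 n) k hv1.le
    by_cases hvR : v ≤ R
    · simp only [indicator_apply, mem_ofPred_eq, hh, hvR, mem_Iic, if_true, Pi.one_apply,
        lintegral_one, measure_univ, mul_one]
      refine ENNReal.ofReal_le_ofReal ?_
      have h1 : v ≤ max R 1 := hvR.trans (le_max_left _ _)
      unfold hypWeight
      refine mul_le_mul_of_nonneg_left ?_ measureReal_nonneg
      exact Real.rpow_le_rpow (by nlinarith) (by nlinarith) (by linarith)
    · simp [hh, hvR]
  refine (setLIntegral_mono' measurableSet_Ioi hle).trans_lt ?_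
  rw [lintegral_indicator measurableSet_Iic, Measure.restrict_restrict measurableSet_Iic,
    lintegral_const, Measure.restrict_apply_univ, inter_comm, Ioi_inter_Iic]
  exact ENNReal.mul_lt_top ENNReal.ofReal_lt_top measure_Ioc_lt_top

theorem setOf_height_le_mem_nhds {n : ℕ} (x : HypSpace n) :
    {y : HypSpace n | height y ≤ height x + 1} ∈ 𝓝 x := by
  filter_upwards [continuous_height.continuousAt.eventually_lt_const
    (show height x < height x + 1 by linarith)] with y hy using le_of_lt hy

instance instWeaklyLocallyCompactSpaceHypSpace (n : ℕ) : WeaklyLocallyCompactSpace (HypSpace n) :=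
  ⟨fun x => ⟨_, isCompact_setOf_height_le _, setOf_height_le_mem_nhds x⟩⟩

/-- Regularity is what makes continuous functions of compact support dense in Lᵖ. -/
theorem regular_hypMeasure (hn : 2 ≤ n) : (hypMeasure n).Regular := by
  have h1 : IsLocallyFiniteMeasure (hypMeasure n) :=
    ⟨fun x => ⟨_, setOf_height_le_mem_nhds x, hypMeasure_setOf_height_le_lt_top hn _⟩⟩
  have h2 : SigmaCompactSpace (HypSpace n) := inferInstance
  infer_instance

/-- Uniform convergence gives convergence of the norms because, for 1 < s < 2, the differences are
supported in one fixed set of finite measure. -/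
theorem tendsto_eLpNorm_meanValue_sub (hn : 2 ≤ n) (p : ℝ≥0∞) {g : HypSpace n → ℂ}
    (hg : Continuous g) (hs : HasCompactSupport g) :
    Tendsto (fun s => eLpNorm (fun x => meanValue g (x, s) - g x) p (hypMeasure n))
      (𝓝[>] 1) (𝓝 0) := by
  obtain ⟨R, hR⟩ := (hs.isCompact.image continuous_height).bddAbove
  have hsupp : ∀ x, R < height x → g x = 0 := fun x hx => by
    by_contra hcon
    exact not_le.mpr hx (hR ⟨x, subset_tsupport g hcon, rfl⟩)
  have h0 : ∀ ε > 0, ∃ R, ∀ x, R < height x → ‖g x‖ < ε := fun ε hε =>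
    ⟨R, fun x hx => by rw [hsupp x hx, norm_zero]; exact hε⟩
  have hunif := Metric.tendstoUniformly_iff.mp (tendstoUniformly_sphereMean hg h0 translation
    translation_smul_origin)
  -- If `form x y` = s < 2, then `height x` < 4 `height y`; so for `height x` > 4|R| the sphere
  -- about x misses the support of g.
  set B : Set (HypSpace n) := {x | height x ≤ 4 * |R|} with hB
  set A := hypMeasure n B ^ p.toReal⁻¹ with hA
  have hAtop : A ≠ ∞ := ENNReal.rpow_ne_top_of_nonneg (by positivity)
    (hypMeasure_setOf_height_le_lt_top hn _).ne
  have hlim : Tendsto (fun η : ℝ => A * ENNReal.ofReal η) (𝓝[>] 0) (𝓝 (A * 0)) := by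
    refine ENNReal.Tendsto.const_mul ?_ (Or.inr hAtop)
    have := (ENNReal.continuous_ofReal.tendsto 0).mono_left (nhdsWithin_le_nhds (s := Ioi 0))
    rwa [ENNReal.ofReal_zero] at this
  rw [mul_zero] at hlim
  rw [ENNReal.tendsto_nhds_zero]
  intro ε hε
  obtain ⟨η, hη, hη0⟩ := ((ENNReal.tendsto_nhds_zero.mp hlim ε hε).and
    self_mem_nhdsWithin).exists
  filter_upwards [hunif η hη0, Ioo_mem_nhdsGT (one_lt_two)] with s hs1 hs2
  refine le_trans ?_ hη
  have hzero : (Function.support fun x => meanValue g (x, s) - g x) ⊆ B := fun x hx => by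
    by_contra hcon
    have hx4 : 4 * |R| < height x := not_le.mp hcon
    have hx0 := height_pos x
    have hgx : g x = 0 := hsupp x (by linarith [le_abs_self R, abs_nonneg R])
    refine hx ?_
    have hmean : meanValue g (x, s) = 0 := by
      refine integral_eq_zero_of_ae (Eventually.of_forall fun k => hsupp _ ?_)
      have h1 := form_spherePoint (translation x) k hs2.1.le
      rw [translation_smul_origin] at h1
      have h2 := height_le_two_mul_form_mul_height x (spherePoint (translation x) (k, s))
      rw [h1] at h2
      have h3 := height_pos (spherePoint (translation x) (k, s))
      have h4 := hs2.2
      simp only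
      nlinarith [le_abs_self R]
    simp only [hmean, hgx, sub_zero]
  rw [← eLpNorm_restrict_eq_of_support_subset hzero]
  refine (eLpNorm_le_of_ae_bound (C := η) (Eventually.of_forall fun x => ?_)).trans_eq ?_
  · have := hs1 x
    rw [dist_comm, dist_eq_norm] at this
    exact this.le
  · rw [Measure.restrict_apply_univ]

/-- The mean values of an `Lᵖ` function converge to it in `Lᵖ`. -/
theorem tendsto_eLpNorm_meanValue_sub_of_memLp (hn : 2 ≤ n) {p : ℝ} (hp : 1 ≤ p)
    {f : HypSpace n → ℂ} (hf : StronglyMeasurable f)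
    (hfp : MemLp f (ENNReal.ofReal p) (hypMeasure n)) :
    Tendsto (fun s => eLpNorm (fun x => meanValue f (x, s) - f x) (ENNReal.ofReal p)
      (hypMeasure n)) (𝓝[>] 1 ⊓ ae volume) (𝓝 0) := by
  have hreg := regular_hypMeasure hn
  have hp1 : 1 ≤ ENNReal.ofReal p := by simpa using hp
  rw [ENNReal.tendsto_nhds_zero]
  intro ε hε
  have hε3 : ε / 3 ≠ 0 := (ENNReal.div_pos hε.ne' (by norm_num)).ne'
  obtain ⟨g, hgs, hfg, hgc, hgp⟩ := hfp.exists_hasCompactSupport_eLpNorm_sub_le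
    ENNReal.ofReal_ne_top hε3
  have hgm : StronglyMeasurable g := hgc.stronglyMeasurable
  have h1 := (ENNReal.tendsto_nhds_zero.mp
    (tendsto_eLpNorm_meanValue_sub hn (ENNReal.ofReal p) hgc hgs) (ε / 3) (pos_iff_ne_zero.mpr hε3))
  have h2 := eLpNorm_meanValue_sub_le hn hp hf hgm hfp hgp
  rw [ae_restrict_iff' measurableSet_Ioi] at h2
  -- The approximation of g by its means holds for all s near 1, the contraction bound only for
  -- almost every s; the limit is therefore essential.
  filter_upwards [h1.filter_mono inf_le_left, h2.filter_mono inf_le_right,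
    (eventually_mem_nhdsWithin (a := (1 : ℝ)) (s := Ioi 1)).filter_mono inf_le_left]
    with s hs1 hs2 hs3
  have hfm : ∀ h : HypSpace n → ℂ, StronglyMeasurable h →
      AEStronglyMeasurable (fun x => meanValue h (x, s)) (hypMeasure n) := fun h hh =>
    ((stronglyMeasurable_meanValue hh).comp_measurable measurable_prodMk_right).aestronglyMeasurable
  have hsplit : (fun x => meanValue f (x, s) - f x)
      = (fun x => meanValue f (x, s) - meanValue g (x, s))
        + ((fun x => meanValue g (x, s) - g x) - (f - g)) := by
    funext x
    simp only [Pi.add_apply, Pi.sub_apply]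
    ring
  rw [hsplit]
  calc _ ≤ _ := eLpNorm_add_le ((hfm f hf).sub (hfm g hgm))
        (((hfm g hgm).sub hgm.aestronglyMeasurable).sub (hf.sub hgm).aestronglyMeasurable) hp1
    _ ≤ ε / 3 + (ε / 3 + ε / 3) := by
        gcongr
        · exact (hs2 hs3).trans hfg
        · refine (eLpNorm_sub_le ((hfm g hgm).sub hgm.aestronglyMeasurable)
            (hf.sub hgm).aestronglyMeasurable hp1).trans ?_
          gcongr
          exact hs1
    _ = ε := by rw [← add_assoc, ENNReal.add_thirds]

/-! ### The fractional derivative of the means of an `Lᵖ` function -/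

theorem measurable_fracBase_meanValue {f : HypSpace n → ℂ} (hf : StronglyMeasurable f) :
    Measurable fun p : HypSpace n × ℝ => fracBase d (fun s => meanValue f (p.1, s)) p.2 := by
  have h := (stronglyMeasurable_meanValue hf).measurable
  unfold fracBase
  split_ifs
  · exact h
  · have hpow : Measurable fun p : HypSpace n × ℝ => p.2 ^ (-(1 / 2 : ℝ)) := by fun_prop
    exact hpow.smul h

theorem measurable_tailPrim {α : Type*} [MeasurableSpace α] {B : α × ℝ → ℂ} (hB : Measurable B) :
    Measurable fun p : α × ℝ => tailPrim (fun v => B (p.1, v)) p.2 := by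
  have h1 : MeasurableSet {q : (α × ℝ) × ℝ | q.1.2 < q.2} :=
    measurableSet_lt (measurable_snd.comp measurable_fst) measurable_snd
  have h2 : Measurable fun q : (α × ℝ) × ℝ => B (q.1.1, q.2) := hB.comp (by fun_prop)
  have h3 := (h2.indicator h1).stronglyMeasurable.integral_prod_right' (ν := volume)
  convert h3.measurable using 2 with p
  rw [tailPrim, ← integral_indicator measurableSet_Ioi]
  rfl

end

/-! ### Almost every pair of centre and radius is admissible -/

section

variable {n d : ℕ} [NeZero n] {f : HypSpace n → ℂ}

theorem IsRLIntegral.fracDerivOdd_eq_fracDeriv {M ψ : ℝ → ℂ} (hd : 1 ≤ d)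
    (hM : TailIntegrable (d / 2) M) (hψ : IsRLIntegral d M ψ) {s : ℝ} (hs : 1 < s)
    (h : HasDerivAt (tailPrim (fracBase d M)) (-fracBase d M s) s) {m : ℕ} (hm : d + 1 = 2 * m) :
    FracDerivOddExists m ψ s ∧ fracDerivOdd m ψ s = fracDeriv d ψ s := by
  obtain ⟨j, rfl⟩ : ∃ j, m = j + 1 := ⟨m - 1, by omega⟩
  obtain rfl : d = 2 * j + 1 := by omega
  rw [(hψ.fracDeriv_eq hd hM hs h).2]
  exact hψ.fracDerivOdd_eq hM hs h

/-- The set of all `(x, s)` such that the derivative in the inversion formula exists and is the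
mean value of `f`. -/
def goodSet (d : ℕ) (f : HypSpace n → ℂ) : Set (HypSpace n × ℝ) :=
  {p | 1 < p.2 ∧ HasDerivAt (tailPrim (fracBase d fun v => meanValue f (p.1, v)))
    (-fracBase d (fun v => meanValue f (p.1, v)) p.2) p.2}

theorem tailIntegrable_meanValue (hd : 1 ≤ d) (hdn : d ≤ n - 1) {p : ℝ} (hp : 1 ≤ p)
    (hpn : p < 2 * ((n : ℝ) - 1) / d) (hf : MemLp f (ENNReal.ofReal p) (hypMeasure n))
    (x : HypSpace n) : TailIntegrable (d / 2) fun v => meanValue f (x, v) := by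
  have h := (finiteTail_of_memLp hd hdn hp hpn hf (translation x)).tailIntegrable (by omega) hf.1
  simp only [meanValue]
  exact h

/-- Two replacements under the Riemann–Liouville integral: f by a representative f', harmless for
almost every radius, and g by `translation x`, harmless for every radius. The transform on the right
remains that of f itself. -/
theorem isRLIntegral_meanValue (hd : 1 ≤ d) (hdn : d ≤ n - 1) {p : ℝ} (hp : 1 ≤ p)
    (hpn : p < 2 * ((n : ℝ) - 1) / d) (hf : MemLp f (ENNReal.ofReal p) (hypMeasure n))
    {f' : HypSpace n → ℂ} (hff' : f =ᵐ[hypMeasure n] f') {x : HypSpace n} {g : SO0 n}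
    (hg : g • origin n = x) :
    IsRLIntegral d (fun v => meanValue f' (x, v))
      (psi (horoTransform f : Horosphere n d → ℂ) g) := by
  refine ((finiteTail_of_memLp hd hdn hp hpn hf g).isRLIntegral hd hdn hf.1).congr ?_
  filter_upwards [sphereMean_ae_eq (by omega) hff' g] with v hv
  rw [meanValue, sphereMean_congr f' (show translation x • origin n = g • origin n by
    rw [translation_smul_origin, hg])]
  exact integral_congr_ae hv

theorem measurableSet_goodSet (hd : 1 ≤ d) (hdn : d ≤ n - 1) {p : ℝ} (hp : 1 ≤ p)
    (hpn : p < 2 * ((n : ℝ) - 1) / d) (hfm : StronglyMeasurable f)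
    (hf : MemLp f (ENNReal.ofReal p) (hypMeasure n)) : MeasurableSet (goodSet d f) := by
  have hB := measurable_fracBase_meanValue (d := d) hfm
  exact measurableSet_hasDerivAt (measurable_tailPrim hB) hB.neg fun x =>
    continuousOn_tailPrim fun s hs =>
      integrableOn_fracBase hd (tailIntegrable_meanValue hd hdn hp hpn hf x) hs

theorem ae_mem_goodSet (hd : 1 ≤ d) (hdn : d ≤ n - 1) {p : ℝ} (hp : 1 ≤ p)
    (hpn : p < 2 * ((n : ℝ) - 1) / d) (hf : MemLp f (ENNReal.ofReal p) (hypMeasure n))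
    (x : HypSpace n) : ∀ᵐ s ∂volume.restrict (Ioi (1 : ℝ)), (x, s) ∈ goodSet d f := by
  filter_upwards [ae_restrict_mem measurableSet_Ioi, ae_hasDerivAt_tailPrim fun s hs =>
    integrableOn_fracBase hd (tailIntegrable_meanValue hd hdn hp hpn hf x) hs] with s hs hs1
  exact ⟨hs, hs1⟩

end

end Horospherical

/-! ### The inversion theorem for both function classes -/

theorem theorem4p1 {n d : ℕ} [NeZero n] (hd : 1 ≤ d) (hdn : d ≤ n - 1)
    (r : Horospherical.HypSpace n → Horospherical.SO0 n)
    (hr : ∀ x, r x • Horospherical.origin n = x)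
    (f : Horospherical.HypSpace n → ℂ)
    (φ : Horospherical.Horosphere n d → ℂ) (hφ : φ = Horospherical.horoTransform f)
    (ψ : Horospherical.HypSpace n → ℝ → ℂ) (hψ : ∀ x, ψ x = Horospherical.psi φ (r x)) :
    -- functions of the class `C_μ`
    (∀ μ : ℝ, (d : ℝ) / 2 < μ → f ∈ Horospherical.decaySpace n μ →
      -- the transform and its means converge absolutely
      (∀ g : Horospherical.SO0 n, Integrable fun w : EuclideanSpace ℝ (Fin d) =>
        f ((g * Horospherical.unip (Horospherical.tail n w)) • Horospherical.origin n)) ∧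
      (∀ x t, Integrable (fun k => φ (Horospherical.horosphere d
        (r x * Horospherical.rot k * Horospherical.boost t))) (Horospherical.rotHaar n)) ∧
      -- the fractional derivative exists, and both of its forms agree for `d` odd
      (∀ x, ∀ s > 1, Horospherical.FracDerivExists d (ψ x) s) ∧
      (∀ m, d + 1 = 2 * m → ∀ x, ∀ s > 1, Horospherical.FracDerivOddExists m (ψ x) s ∧
        Horospherical.fracDerivOdd m (ψ x) s = Horospherical.fracDeriv d (ψ x) s) ∧
      -- the inversion formula
      TendstoUniformly (fun s x => Horospherical.fracDeriv d (ψ x) s) f (𝓝[>] 1)) ∧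
    -- functions of the class `L^p`
    (∀ p : ℝ, 1 ≤ p → p < 2 * ((n : ℝ) - 1) / d →
      MemLp f (ENNReal.ofReal p) (Horospherical.hypMeasure n) →
      -- the transform and its means converge absolutely
      (∀ x, ∀ᵐ t : ℝ, (∀ᵐ k ∂Horospherical.rotHaar n,
          Integrable fun w : EuclideanSpace ℝ (Fin d) =>
            f ((r x * Horospherical.rot k * Horospherical.boost t *
              Horospherical.unip (Horospherical.tail n w)) • Horospherical.origin n)) ∧
        Integrable (fun k => φ (Horospherical.horosphere d
          (r x * Horospherical.rot k * Horospherical.boost t))) (Horospherical.rotHaar n)) ∧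
      -- the fractional derivative exists, and both of its forms agree for `d` odd
      (∀ x, ∀ᵐ s ∂volume.restrict (Ioi (1 : ℝ)), Horospherical.FracDerivExists d (ψ x) s) ∧
      (∀ m, d + 1 = 2 * m → ∀ x, ∀ᵐ s ∂volume.restrict (Ioi (1 : ℝ)),
        Horospherical.FracDerivOddExists m (ψ x) s ∧
        Horospherical.fracDerivOdd m (ψ x) s = Horospherical.fracDeriv d (ψ x) s) ∧
      (∀ᵐ s ∂volume.restrict (Ioi (1 : ℝ)),
        (∀ᵐ x ∂Horospherical.hypMeasure n, Horospherical.FracDerivExists d (ψ x) s) ∧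
        MemLp (fun x => Horospherical.fracDeriv d (ψ x) s) (ENNReal.ofReal p)
          (Horospherical.hypMeasure n)) ∧
      -- the inversion formula
      Tendsto (fun s => eLpNorm (fun x => Horospherical.fracDeriv d (ψ x) s - f x)
        (ENNReal.ofReal p) (Horospherical.hypMeasure n))
        (𝓝[>] 1 ⊓ ae volume) (𝓝 0)) := by
  have hn : 2 ≤ n := by omega
  have hd' : (1 : ℝ) ≤ d := by exact_mod_cast hd
  subst hφ
  obtain rfl : ψ = fun x => Horospherical.psi (Horospherical.horoTransform f) (r x) := funext hψ
  refine ⟨fun μ hμ ⟨hf, C, hC⟩ => ?_, fun p hp hpn hf => ?_⟩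
  · have hfm : AEStronglyMeasurable f (Horospherical.hypMeasure n) := hf.aestronglyMeasurable
    have hμ0 : 0 < μ := by linarith
    have hC1 : ∀ x, ‖f x‖ ≤ C := fun x => by
      refine (hC x).trans (mul_le_of_le_one_right (Horospherical.nonneg_of_decay hC) ?_)
      exact Real.rpow_le_one_of_one_le_of_nonpos (Horospherical.one_le_height x) (by linarith)
    have hF := fun x => Horospherical.finiteTail_of_decay hd hμ hC (r x)
    have hT := fun x => (hF x).tailIntegrable hn hfm
    have hI := fun x => (hF x).isRLIntegral hd hdn hfm
    have hD := fun x s (hs : 1 < s) =>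
      Horospherical.hasDerivAt_tailPrim_sphereMean hd hf hC1 (hT x) hs
    refine ⟨Horospherical.integrable_horosphere_of_decay hdn hd hμ hf hC,
      fun x t => (Horospherical.integrable_horoTransform hdn (r x) t
        (Horospherical.integrable_horoPoint_of_decay hdn hd hμ hf hC (r x) t)).2,
      fun x s hs => ((hI x).fracDeriv_eq hd (hT x) hs (hD x s hs)).1,
      fun m hm x s hs => (hI x).fracDerivOdd_eq_fracDeriv hd (hT x) hs (hD x s hs) hm, ?_⟩
    intro u hu
    filter_upwards [Horospherical.tendstoUniformly_sphereMean hf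
      (fun ε hε => Horospherical.exists_norm_lt_of_decay hμ0 hC hε) r hr u hu,
      self_mem_nhdsWithin] with s hs hs1 x
    rw [((hI x).fracDeriv_eq hd (hT x) hs1 (hD x s hs1)).2]
    exact hs x
  -- A strongly measurable representative makes the means jointly measurable in centre and radius.
  · set f' := hf.1.mk f with hf'
    have hfm : StronglyMeasurable f' := hf.1.stronglyMeasurable_mk
    have hff' : f =ᵐ[Horospherical.hypMeasure n] f' := hf.1.ae_eq_mk
    have hfp : MemLp f' (ENNReal.ofReal p) (Horospherical.hypMeasure n) := hf.ae_eq hff'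
    have hI := fun x => Horospherical.isRLIntegral_meanValue hd hdn hp hpn hf hff' (hr x)
    have hT := fun x => Horospherical.tailIntegrable_meanValue hd hdn hp hpn hfp x
    have hae := fun x => Horospherical.ae_mem_goodSet hd hdn hp hpn hfp x
    have hgood := fun x s (h : (x, s) ∈ Horospherical.goodSet d f') =>
      (hI x).fracDeriv_eq hd (hT x) h.1 h.2
    -- For every x almost every s is good. Fubini's theorem on the measurable set `goodSet`
    -- exchanges the two quantifiers.
    have hswap : ∀ᵐ s ∂volume.restrict (Ioi (1 : ℝ)), ∀ᵐ x ∂Horospherical.hypMeasure n,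
        (x, s) ∈ Horospherical.goodSet d f' :=
      (Measure.ae_ae_comm (p := fun x s => (x, s) ∈ Horospherical.goodSet d f')
        (Horospherical.measurableSet_goodSet hd hdn hp hpn hfm hfp)).mp
        (Eventually.of_forall hae)
    have heq : ∀ᵐ s ∂volume.restrict (Ioi (1 : ℝ)), ∀ᵐ x ∂Horospherical.hypMeasure n,
        Horospherical.fracDeriv d
          (Horospherical.psi (Horospherical.horoTransform f : Horospherical.Horosphere n d → ℂ)
            (r x)) s = Horospherical.meanValue f' (x, s) := by
      filter_upwards [hswap] with s hs
      filter_upwards [hs] with x hx using (hgood x s hx).2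
    refine ⟨fun x => ?_, fun x => ?_, fun m hm x => ?_, ?_, ?_⟩
    · refine Horospherical.ae_of_ae_cosh ?_
      filter_upwards [(Horospherical.finiteTail_of_memLp hd hdn hp hpn hf
        (r x)).ae_integrable_horoPoint hd hdn hf.1] with s hs t ht
      exact Horospherical.integrable_horoTransform hdn (r x) t (hs t ht)
    · filter_upwards [hae x] with s hs using (hgood x s hs).1
    · filter_upwards [hae x] with s hs
      exact (hI x).fracDerivOdd_eq_fracDeriv hd (hT x) hs.1 hs.2 hm
    · filter_upwards [hswap, heq, Horospherical.eLpNorm_meanValue_le hn hp hfm] with s hs hs1 hs2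
      -- Measurability of the fractional derivative in x is not evident for an arbitrary choice of
      -- r_x; it is inherited from the mean value, with which it agrees almost everywhere.
      refine ⟨hs.mono fun x hx => (hgood x s hx).1, MemLp.ae_eq (hs1.mono fun x hx => hx.symm)
        ⟨?_, hs2.trans_lt hfp.2⟩⟩
      exact ((Horospherical.stronglyMeasurable_meanValue hfm).comp_measurable
        measurable_prodMk_right).aestronglyMeasurable
    · refine (Horospherical.tendsto_eLpNorm_meanValue_sub_of_memLp hn hp hfm hfp).congr' ?_
      rw [ae_restrict_iff' measurableSet_Ioi] at heq
      filter_upwards [heq.filter_mono inf_le_right,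
        (eventually_mem_nhdsWithin (a := (1 : ℝ)) (s := Ioi 1)).filter_mono inf_le_left]
        with s hs hs1
      refine eLpNorm_congr_ae ?_
      filter_upwards [hs hs1, hff'] with x hx hx'
      rw [hx, hx']
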